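/- Let $M$ be a compact connected Sasakian manifold of dimension $2n+1$ with contact form $\eta$ and Reeb vector field $\xi$, and let $\varphi_t$ be the flow of $\xi$. Assume that $M$ is quasi-regular, that is, every orbit of $\varphi$ is closed. Let $r>0$ be its period, the smallest positive number with $\varphi_r=\mathrm{id}_M$, let $S^1=\mathbb{R}/r\mathbb{Z}$ act on $M$ through $\varphi$, and let $M_{reg}\subset M$ be the set of the points $y$ with $\varphi_t(y)\neq y$ for all $0<t<r$. Let $X=M/S^1$ be the quotient orbifold. Its orbifold fundamental group at $S^1x$ is $\pi_1^{orb}(X,S^1x)=\pi_1(BX,[e,x])$, where $BX=ES^1\times_{S^1}M$, $ES^1$ is the total space of the universal principal $S^1$-bundle and $e\in ES^1$ is a base point. The map $M\to BX$, $y\mapsto[e,y]$, induces the natural (surjective) homomorphism $q_*:\pi_1(M,x)\to\pi_1^{orb}(X,S^1x)$. Let $(E,D)$ be a smooth complex vector bundle of finite rank on $M$ with a flat connection. It is a basic vector bundle for the Reeb foliation, whose local basic sections are the local smooth sections $s$ with $D_\xi s=0$. Let $\Phi_t:E\to E$ be the flow that lifts $\varphi_t$ and is given by $\Phi_t(s(y))=s(\varphi_t(y))$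 for local basic sections $s$ and small $t$. The bundle $E$ is called a quasi-regular basic bundle if $\Phi_{mr}=\mathrm{id}_E$ for some integer $m\geq 1$, and a regular basic bundle if $\Phi_r=\mathrm{id}_E$. Fix $x\in M_{reg}$ and let $\rho:\pi_1(M,x)\to\mathrm{GL}(E_x)$ be the monodromy representation of $(E,D)$. Then: 1. $E$ is a regular basic bundle if and only if $\rho$ factors through $\pi_1^{orb}(X,S^1x)$, that is, $\rho=\tau\circ q_*$ for some homomorphism $\tau:\pi_1^{orb}(X,S^1x)\to\mathrm{GL}(E_x)$. 2. $E$ is a quasi-regular basic bundle if and only if the image of the homomorphism $\mathbb{Z}=\pi_1(S^1)\to\mathrm{GL}(E_x)$, $k\mapsto\rho([\gamma])^k$, is finite, where $\gamma:[0,1]\to M$, $\gamma(t)=\varphi_{tr}(x)$, is the Reeb loop at $x$. -/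

import Mathlib

open scoped Manifold ContDiff Topology
open Bundle Set

noncomputable section

/-! ### Vector fields, one-forms and complex vector fields -/

namespace VecField

variable {m : ℕ} {M : Type*} [TopologicalSpace M] [ChartedSpace (EuclideanSpace ℝ (Fin m)) M]

/-- A smooth vector field on the whole manifold. -/
def IsSmooth [IsManifold (𝓡 m) ∞ M] (X : Π p : M, TangentSpace (𝓡 m) p) : Prop :=
  ContMDiff (𝓡 m) (𝓡 m).tangent ∞ (fun p ↦ (⟨p, X p⟩ : TangentBundle (𝓡 m) M))

/-- The exterior derivative of a one-form `η`, evaluated on two vector fields by Cartan's formula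
`dη(X, Y) = X(η(Y)) - Y(η(X)) - η([X, Y])`. -/
def extDerivForm (η : Π p : M, TangentSpace (𝓡 m) p →L[ℝ] ℝ)
    (X Y : Π p : M, TangentSpace (𝓡 m) p) (p : M) : ℝ :=
  mvfderiv (𝓡 m) (fun q ↦ η q (Y q)) p (X p) - mvfderiv (𝓡 m) (fun q ↦ η q (X q)) p (Y p)
    - η p (VectorField.mlieBracket (𝓡 m) X Y p)

/-- The real part of the bracket of the complex vector fields `X + iY` and `X' + iY'`. -/
def bracketRe (X Y X' Y' : Π p : M, TangentSpace (𝓡 m) p) (p : M) : TangentSpace (𝓡 m) p :=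
  VectorField.mlieBracket (𝓡 m) X X' p - VectorField.mlieBracket (𝓡 m) Y Y' p

/-- The imaginary part of the bracket of the complex vector fields `X + iY` and `X' + iY'`. -/
def bracketIm (X Y X' Y' : Π p : M, TangentSpace (𝓡 m) p) (p : M) : TangentSpace (𝓡 m) p :=
  VectorField.mlieBracket (𝓡 m) X Y' p + VectorField.mlieBracket (𝓡 m) Y X' p

/-- The complex tangent vector `v + iw` lies in `T^{1,0}`, the `i`-eigenspace of `J` acting on the
complexification of `S = ker η`. -/
def MemT10 (η : Π p : M, TangentSpace (𝓡 m) p →L[ℝ] ℝ)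
    (J : Π p : M, TangentSpace (𝓡 m) p →L[ℝ] TangentSpace (𝓡 m) p)
    (p : M) (v w : TangentSpace (𝓡 m) p) : Prop :=
  η p v = 0 ∧ η p w = 0 ∧ J p v = -w ∧ J p w = v

end VecField

/-! ### Sasakian manifolds -/

/-- A Sasakian structure on a manifold of dimension `2n + 1`: a contact form `η` with Reeb field
`ξ` and a CR structure `(T^{1,0}, S, J)`, `S = ker η`, with `J` extended to `TM` by `J ξ = 0`, such
that the Levi form `dη(X, JY)` is positive definite on `S` and `ξ` preserves `T^{1,0}`.
Positivity of the Levi form makes `dη` non-degenerate on `ker η`, so `η` is a contact form. -/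
structure SasakianStructure (n : ℕ) (M : Type*) [TopologicalSpace M]
    [ChartedSpace (EuclideanSpace ℝ (Fin (2 * n + 1))) M]
    [IsManifold (𝓡 (2 * n + 1)) ∞ M] where
  /-- The contact form. -/
  η : Π p : M, TangentSpace (𝓡 (2 * n + 1)) p →L[ℝ] ℝ
  /-- The Reeb vector field. -/
  ξ : Π p : M, TangentSpace (𝓡 (2 * n + 1)) p
  /-- The complex structure on `S = ker η`, extended by zero on `ξ`. -/
  J : Π p : M, TangentSpace (𝓡 (2 * n + 1)) p →L[ℝ] TangentSpace (𝓡 (2 * n + 1)) p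
  smooth_η : ContMDiff (𝓡 (2 * n + 1))
    ((𝓡 (2 * n + 1)).prod 𝓘(ℝ, EuclideanSpace ℝ (Fin (2 * n + 1)) →L[ℝ] ℝ)) ∞
    (fun p ↦ TotalSpace.mk' (EuclideanSpace ℝ (Fin (2 * n + 1)) →L[ℝ] ℝ)
      (E := fun p : M ↦ TangentSpace (𝓡 (2 * n + 1)) p →L[ℝ] Bundle.Trivial M ℝ p) p (η p))
  smooth_ξ : VecField.IsSmooth ξ
  smooth_J : ContMDiff (𝓡 (2 * n + 1))
    ((𝓡 (2 * n + 1)).prod 𝓘(ℝ, EuclideanSpace ℝ (Fin (2 * n + 1)) →L[ℝ]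
      EuclideanSpace ℝ (Fin (2 * n + 1)))) ∞
    (fun p ↦ TotalSpace.mk' (EuclideanSpace ℝ (Fin (2 * n + 1)) →L[ℝ]
        EuclideanSpace ℝ (Fin (2 * n + 1)))
      (E := fun p : M ↦ TangentSpace (𝓡 (2 * n + 1)) p →L[ℝ] TangentSpace (𝓡 (2 * n + 1)) p)
      p (J p))
  η_ξ : ∀ p, η p (ξ p) = 1
  dη_ξ : ∀ X, VecField.IsSmooth X → ∀ p, VecField.extDerivForm η ξ X p = 0
  J_ξ : ∀ p, J p (ξ p) = 0
  η_J : ∀ p v, η p (J p v) = 0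
  J_J : ∀ p v, η p v = 0 → J p (J p v) = -v
  /-- `T^{1,0}` is integrable. -/
  integrable : ∀ X Y X' Y', VecField.IsSmooth X → VecField.IsSmooth Y → VecField.IsSmooth X' →
    VecField.IsSmooth Y' → (∀ p, VecField.MemT10 η J p (X p) (Y p)) →
    (∀ p, VecField.MemT10 η J p (X' p) (Y' p)) →
    ∀ p, VecField.MemT10 η J p (VecField.bracketRe X Y X' Y' p) (VecField.bracketIm X Y X' Y' p)
  /-- The Levi form is positive definite. -/
  levi_pos : ∀ X, VecField.IsSmooth X → (∀ p, η p (X p) = 0) →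
    ∀ p, X p ≠ 0 → 0 < VecField.extDerivForm η X (fun q ↦ J q (X q)) p
  /-- `[ξ, C^∞(T^{1,0})] ⊆ C^∞(T^{1,0})`. -/
  ξ_T10 : ∀ X Y, VecField.IsSmooth X → VecField.IsSmooth Y →
    (∀ p, VecField.MemT10 η J p (X p) (Y p)) →
    ∀ p, VecField.MemT10 η J p (VecField.bracketRe ξ 0 X Y p) (VecField.bracketIm ξ 0 X Y p)

namespace SasakianStructure

variable {n : ℕ} {M : Type*} [TopologicalSpace M]
  [ChartedSpace (EuclideanSpace ℝ (Fin (2 * n + 1))) M] [IsManifold (𝓡 (2 * n + 1)) ∞ M]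
  (S : SasakianStructure n M)

open Classical in
/-- The flow `φ_t` of the Reeb vector field: `t ↦ φ_t(p)` is the integral curve of `ξ` that starts
at `p` (it exists for all times and is unique on a compact manifold). -/
def reebFlow (t : ℝ) (p : M) : M :=
  if h : ∃ γ : ℝ → M, γ 0 = p ∧ IsMIntegralCurve (I := 𝓡 (2 * n + 1)) γ S.ξ then h.choose t else p

/-- Every leaf of the Reeb foliation is closed. -/
def IsQuasiRegular : Prop :=
  ∀ p : M, IsClosed (range fun t : ℝ ↦ S.reebFlow t p)

/-- The period `r`: the smallest positive time at which the Reeb flow is the identity of `M`. -/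
def period : ℝ :=
  sInf {t : ℝ | 0 < t ∧ ∀ p : M, S.reebFlow t p = p}

/-- `M_reg`: the points whose own smallest positive return time is the period `r`. -/
def regularPoints : Set M :=
  {p | IsLeast {t : ℝ | 0 < t ∧ S.reebFlow t p = p} S.period}

/-! ### The orbifold fundamental group of `X = M / S¹` -/

/-- The total space of the universal principal circle bundle: the unit sphere of `ℓ²(ℕ, ℂ)`, on
which the unit complex numbers act freely by multiplication. -/
abbrev UniversalCircleBundle : Type :=
  Metric.sphere (0 : lp (fun _ : ℕ ↦ ℂ) 2) 1

/-- A base point of the universal principal circle bundle, the first basis vector. -/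
def universalBasePoint : UniversalCircleBundle :=
  ⟨lp.single 2 0 (1 : ℂ), by simp [lp.norm_single]⟩

/-- Two points of `ES¹ × M` are in the same orbit of the diagonal action of the circle, where
`exp(2πi t / r)` acts on `M` by `φ_t` and on `ES¹` by multiplication. -/
def borelRel (a b : UniversalCircleBundle × M) : Prop :=
  ∃ t : ℝ, (b.1 : lp (fun _ : ℕ ↦ ℂ) 2) =
      Complex.exp (2 * Real.pi * Complex.I * (t / S.period : ℝ)) • (a.1 : lp (fun _ : ℕ ↦ ℂ) 2) ∧
    b.2 = S.reebFlow t a.2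

/-- The classifying space `BX = ES¹ ×_{S¹} M` of the orbifold `X = M / S¹`, with the quotient
topology. -/
def BorelConstruction : Type _ :=
  Quot S.borelRel

instance : TopologicalSpace S.BorelConstruction :=
  inferInstanceAs (TopologicalSpace (Quot S.borelRel))

/-- The map `M → BX`, `y ↦ [e, y]`, with `e` the base point of `ES¹`. It is the composition of the
homotopy equivalence `M → ES¹ × M` with the principal circle bundle `ES¹ × M → BX`. -/
def toBorel : C(M, S.BorelConstruction) where
  toFun y := Quot.mk S.borelRel (universalBasePoint, y)
  continuous_toFun := continuous_quot_mk.comp (Continuous.prodMk continuous_const continuous_id)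

/-- The orbifold fundamental group `π₁^orb(X, S¹x) = π₁(BX)`. -/
abbrev OrbifoldFundamentalGroup (x : M) : Type _ :=
  FundamentalGroup S.BorelConstruction (S.toBorel x)

/-- The natural homomorphism `π₁(M, x) → π₁^orb(X, S¹x)`. -/
def toOrbifoldFundamentalGroup (x : M) : FundamentalGroup M x →* S.OrbifoldFundamentalGroup x :=
  FundamentalGroup.map S.toBorel x

end SasakianStructure

/-! ### Flat bundles -/

/-- A flat connection on a smooth complex vector bundle `V` of finite rank: a smooth connection
that is complex linear and has zero curvature. `D σ p v` is the derivative `(D_v σ)(p)`. -/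
structure FlatConnection (m : ℕ) (M : Type*) [TopologicalSpace M]
    [ChartedSpace (EuclideanSpace ℝ (Fin m)) M] [IsManifold (𝓡 m) ∞ M]
    (F : Type*) [NormedAddCommGroup F] [NormedSpace ℂ F]
    (V : M → Type*) [TopologicalSpace (TotalSpace F V)]
    [∀ p, AddCommGroup (V p)] [∀ p, Module ℂ (V p)] [∀ p, TopologicalSpace (V p)]
    [∀ p, IsTopologicalAddGroup (V p)] [∀ p, ContinuousSMul ℝ (V p)]
    [FiberBundle F V] [VectorBundle ℝ F V]
    [ContMDiffVectorBundle ∞ F V (𝓡 m)] where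
  /-- The underlying covariant derivative. -/
  D : CovariantDerivative (𝓡 m) F V
  smooth : D.ContMDiffCovariantDerivative ∞
  map_smul : ∀ (c : ℂ) (σ : Π p : M, V p) (p : M) (v : TangentSpace (𝓡 m) p),
    MDifferentiableAt (𝓡 m) ((𝓡 m).prod 𝓘(ℝ, F)) (fun q ↦ TotalSpace.mk' F q (σ q)) p →
    D (fun q ↦ c • σ q) p v = c • D σ p v
  flat : ∀ X Y : Π p : M, TangentSpace (𝓡 m) p, VecField.IsSmooth X → VecField.IsSmooth Y →
    ∀ σ : Π p : M, V p,
    ContMDiff (𝓡 m) ((𝓡 m).prod 𝓘(ℝ, F)) ∞ (fun q ↦ TotalSpace.mk' F q (σ q)) →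
    ∀ p, D (fun q ↦ D σ q (Y q)) p (X p) - D (fun q ↦ D σ q (X q)) p (Y p)
      - D σ p (VectorField.mlieBracket (𝓡 m) X Y p) = 0

namespace FlatConnection

section Monodromy

variable {m : ℕ} {M : Type*} [TopologicalSpace M]
    [ChartedSpace (EuclideanSpace ℝ (Fin m)) M] [IsManifold (𝓡 m) ∞ M]
    {F : Type*} [NormedAddCommGroup F] [NormedSpace ℂ F]
    {V : M → Type*} [TopologicalSpace (TotalSpace F V)]
    [∀ p, AddCommGroup (V p)] [∀ p, Module ℂ (V p)] [∀ p, TopologicalSpace (V p)]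
    [∀ p, IsTopologicalAddGroup (V p)] [∀ p, ContinuousSMul ℝ (V p)]
    [FiberBundle F V] [VectorBundle ℝ F V]
    [ContMDiffVectorBundle ∞ F V (𝓡 m)]
    (E : FlatConnection m M F V)

/-- `s` restricts to a smooth section on `U` with `D s = 0`. -/
def IsFlatOn (U : Set M) (s : Π p : M, V p) : Prop :=
  ContMDiffOn (𝓡 m) ((𝓡 m).prod 𝓘(ℝ, F)) ∞ (fun q ↦ TotalSpace.mk' F q (s q)) U ∧
    ∀ p ∈ U, E.D s p = 0

/-- `σ` is a parallel lift of the path `γ`: it is locally given by flat sections of `(V, D)`. -/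
def IsParallelLift {x y : M} (γ : Path x y) (σ : unitInterval → TotalSpace F V) : Prop :=
  ∀ t₀ : unitInterval, ∃ U : Set M, IsOpen U ∧ γ t₀ ∈ U ∧ ∃ s : Π p : M, V p, E.IsFlatOn U s ∧
    ∀ᶠ t in 𝓝 t₀, σ t = TotalSpace.mk' F (γ t) (s (γ t))

/-- `ρ` sends the class of each loop `γ` to the parallel transport along `γ`. (In Mathlib's
fundamental group, `[γ] * [γ']` is the loop that runs through `γ'` first.) -/
def IsMonodromy (x : M)
    (ρ : FundamentalGroup M x →* LinearMap.GeneralLinearGroup ℂ (V x)) : Prop :=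
  ∀ (γ : Path x x) (v : V x), ∃ σ : unitInterval → TotalSpace F V,
    E.IsParallelLift γ σ ∧ σ 0 = TotalSpace.mk' F x v ∧
    σ 1 = TotalSpace.mk' F x ((ρ (FundamentalGroup.fromPath ⟦γ⟧) : V x →ₗ[ℂ] V x) v)

open Classical in
/-- The monodromy representation `π₁(M, x) → GL(V_x)` of the flat bundle, that is, the unique
homomorphism given by parallel transport along loops. -/
def monodromy (x : M) : FundamentalGroup M x →* LinearMap.GeneralLinearGroup ℂ (V x) :=
  if h : ∃ ρ, E.IsMonodromy x ρ then h.choose else 1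

end Monodromy

section Basic

variable {n : ℕ} {M : Type*} [TopologicalSpace M]
    [ChartedSpace (EuclideanSpace ℝ (Fin (2 * n + 1))) M] [IsManifold (𝓡 (2 * n + 1)) ∞ M]
    {F : Type*} [NormedAddCommGroup F] [NormedSpace ℂ F]
    {V : M → Type*} [TopologicalSpace (TotalSpace F V)]
    [∀ p, AddCommGroup (V p)] [∀ p, Module ℂ (V p)] [∀ p, TopologicalSpace (V p)]
    [∀ p, IsTopologicalAddGroup (V p)] [∀ p, ContinuousSMul ℝ (V p)]
    [FiberBundle F V] [VectorBundle ℝ F V]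
    [ContMDiffVectorBundle ∞ F V (𝓡 (2 * n + 1))]
    (E : FlatConnection (2 * n + 1) M F V) (S : SasakianStructure n M)

/-- `s` restricts to a basic section on `U`, for the basic vector bundle structure that corresponds
to the flat partial connection along the Reeb foliation obtained by restricting `D`: a smooth
section with `D_ξ s = 0`. -/
def IsBasicOn (U : Set M) (s : Π p : M, V p) : Prop :=
  ContMDiffOn (𝓡 (2 * n + 1)) ((𝓡 (2 * n + 1)).prod 𝓘(ℝ, F)) ∞
    (fun q ↦ TotalSpace.mk' F q (s q)) U ∧ ∀ p ∈ U, E.D s p (S.ξ p) = 0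

/-- `σ` lifts the Reeb orbit of `p`, and is locally given by basic sections. -/
def IsBasicLift (p : M) (σ : ℝ → TotalSpace F V) : Prop :=
  ∀ t₀ : ℝ, ∃ U : Set M, IsOpen U ∧ S.reebFlow t₀ p ∈ U ∧ ∃ s : Π p : M, V p,
    E.IsBasicOn S U s ∧
    ∀ᶠ t in 𝓝 t₀, σ t = TotalSpace.mk' F (S.reebFlow t p) (s (S.reebFlow t p))

open Classical in
/-- The flow `Φ_t` on the total space of the basic bundle that lifts the Reeb flow: in local
trivializations by basic sections it is `(x, v) ↦ (φ_t(x), v)`. -/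
def basicFlow (t : ℝ) (e : TotalSpace F V) : TotalSpace F V :=
  if h : ∃ σ : ℝ → TotalSpace F V, E.IsBasicLift S e.proj σ ∧ σ 0 = e then h.choose t else e

/-- The bundle is a quasi-regular basic bundle: `Φ_{mr} = id` for some integer `m ≥ 1`, where `r` is
the period of the Sasakian manifold. -/
def IsQuasiRegular : Prop :=
  ∃ m : ℕ, 0 < m ∧ ∀ e : TotalSpace F V, E.basicFlow S (m * S.period) e = e

/-- The bundle is a regular basic bundle: `Φ_r = id`. -/
def IsRegular : Prop :=
  ∀ e : TotalSpace F V, E.basicFlow S S.period e = e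

end Basic

end FlatConnection

end

/-!
The total space of the flat bundle, retopologized so that the local flat sections are continuous, is
a covering space `FlatSpace` of `M`. This is the Frobenius theorem: in a chart and a trivialization
the connection is `d + A` with `dA + A ∧ A = 0`, and then `dG = -A G` has an invertible solution
(`FlatForm.exists_hasFDerivAt_eq_neg_mul`), so that flat frames exist
(`FlatConnection.exists_flatFrame`). The solution is built by parallel transport along rays, as the
solution of a linear integral equation in the Banach algebra of continuous functions on `[0, 1]`.

Lifts of paths to `FlatSpace` are the parallel lifts, so the monodromy representation is the
monodromy of this covering (`FlatConnection.mk_monodromy`). A section `s` with `D_ξ s = 0` has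
constant coordinates in a flat frame along the Reeb orbits, so the flow `Φ` of the basic bundle is
the lift of the Reeb flow to the covering (`FlatConnection.basicFlow_eq`). On the fibre over `x` this
gives `Φ_r = ρ([γ])`. Since `Φ_{mr}` is a deck transformation and `M` is connected, `Φ_{mr} = id`
holds everywhere as soon as it holds on one fibre, that is, if and only if `ρ([γ])^m = 1`
(`FlatConnection.forall_basicFlow_eq_iff`). This proves the second part, and reduces the first one to
the claim that `ρ` factors through `q_*` if and only if `ρ([γ]) = 1`.

In `BX` the Reeb loop is homotopic to a loop of the contractible space `ES¹`, so `q_*[γ] = 1`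
(`SasakianStructure.toOrbifoldFundamentalGroup_orbitLoop`), and a representation that factors through
`q_*` is trivial on `[γ]`. Conversely, `q_*` is surjective, because loops of `BX` lift to `ES¹ × M`
(`SasakianStructure.toOrbifoldFundamentalGroup_surjective`). If `Φ_r = id`, then the circle acts on
`FlatSpace` through `Φ`, and `ES¹ ×_{S¹} FlatSpace → BX` is a covering
(`HomotopyQuotient.isCoveringMap_map`). Null-homotopies in `BX` lift to it, and since the circle acts
freely on `ES¹` the kernel of `q_*` lies in the kernel of `ρ`
(`FlatConnection.ker_toOrbifoldFundamentalGroup_le`).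

The charts of a Borel construction `ES¹ ×_{S¹} Y` used throughout are the sets where a coordinate of
`ES¹ ⊆ ℓ²` does not vanish: each orbit there has a unique representative for which this coordinate
is positive.
-/

set_option linter.unusedSectionVars false

noncomputable section

/-! ### The Frobenius theorem for a flat connection form -/

namespace FlatForm

open unitInterval MeasureTheory

open scoped BoundedContinuousFunction

section Family

variable {E R : Type*} [NormedAddCommGroup E] [NormedSpace ℝ E] [NormedAddCommGroup R]
  [NormedSpace ℝ R] {K : Type*} [TopologicalSpace K] [CompactSpace K]

/-- A continuous function on a compact space, as a bounded continuous function. -/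
abbrev ofContinuous {Y : Type*} [PseudoMetricSpace Y] (f : K → Y) (hf : Continuous f) : K →ᵇ Y :=
  BoundedContinuousFunction.mkOfCompact ⟨f, hf⟩

omit [CompactSpace K] in
/-- A continuous family of linear maps, seen as a linear map into continuous functions. -/
def flipCLM (L : K →ᵇ (E →L[ℝ] R)) : E →L[ℝ] (K →ᵇ R) :=
  LinearMap.mkContinuous
    { toFun := fun h ↦ BoundedContinuousFunction.ofNormedAddCommGroup (fun t ↦ L t h)
        (L.continuous.clm_apply continuous_const) (‖L‖ * ‖h‖) fun t ↦
          (ContinuousLinearMap.le_opNorm _ _).trans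
            (mul_le_mul_of_nonneg_right (L.norm_coe_le_norm t) (norm_nonneg _))
      map_add' := fun h k ↦ by ext t; simp
      map_smul' := fun c h ↦ by ext t; simp } ‖L‖ fun h ↦ by
    rw [BoundedContinuousFunction.norm_le (by positivity)]
    intro t
    exact (ContinuousLinearMap.le_opNorm _ _).trans
      (mul_le_mul_of_nonneg_right (L.norm_coe_le_norm t) (norm_nonneg _))

omit [CompactSpace K] in
@[simp] lemma flipCLM_apply (L : K →ᵇ (E →L[ℝ] R)) (h : E) (t : K) : flipCLM L h t = L t h := rfl

/-- A family of functions that is differentiable for each value of the parameter `t ∈ K`, with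
derivative jointly continuous, is differentiable as a map into the functions on `K`. -/
lemma hasFDerivAt_family {f : E → K →ᵇ R} {f' : E → K →ᵇ (E →L[ℝ] R)}
    (hf : ∀ x t, HasFDerivAt (fun y ↦ f y t) (f' x t) x)
    (hf' : Continuous fun p : E × K ↦ f' p.1 p.2) (x : E) :
    HasFDerivAt f (flipCLM (f' x)) x := by
  rw [hasFDerivAt_iff_isLittleO, Asymptotics.isLittleO_iff]
  intro c hc
  have h1 : ∀ᶠ y in 𝓝 x, ∀ t ∈ (univ : Set K), ‖f' y t - f' x t‖ < c := by
    refine isCompact_univ.eventually_forall_of_forall_eventually fun t _ ↦ ?_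
    have h2 : Continuous fun p : E × K ↦ ‖f' p.1 p.2 - f' x p.2‖ :=
      (hf'.sub ((f' x).continuous.comp continuous_snd)).norm
    exact h2.tendsto (x, t) |>.eventually (gt_mem_nhds (by simpa using hc))
  obtain ⟨δ, hδ, h1⟩ := Metric.eventually_nhds_iff_ball.1 h1
  filter_upwards [Metric.ball_mem_nhds x hδ] with y hy
  rw [BoundedContinuousFunction.norm_le (by positivity)]
  intro t
  exact Convex.norm_image_sub_le_of_norm_hasFDerivWithin_le' (f := fun y ↦ f y t)
    (f' := fun y ↦ f' y t) (φ := f' x t) (fun z _ ↦ (hf z t).hasFDerivWithinAt)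
    (fun z hz ↦ (h1 z hz t trivial).le) (convex_ball x δ) (Metric.mem_ball_self hδ) hy

end Family

variable {E R : Type*} [NormedAddCommGroup E] [NormedSpace ℝ E] [NormedRing R]
  [NormedAlgebra ℝ R] [CompleteSpace R]

/-- The primitive vanishing at `0` of a continuous function on the unit interval. -/
def primitive : (I →ᵇ R) →L[ℝ] (I →ᵇ R) :=
  LinearMap.mkContinuous
    { toFun := fun g : (I →ᵇ R) ↦ ofContinuous
        (fun t : I ↦ ∫ τ in (0 : ℝ)..t, g (projIcc 0 1 zero_le_one τ))
        ((intervalIntegral.continuous_primitive (fun a b ↦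
          (g.continuous.comp continuous_projIcc).intervalIntegrable a b) 0).comp
          continuous_subtype_val)
      map_add' := fun g h ↦ by
        ext t
        exact intervalIntegral.integral_add
          ((g.continuous.comp continuous_projIcc).intervalIntegrable _ _)
          ((h.continuous.comp continuous_projIcc).intervalIntegrable _ _)
      map_smul' := fun c g ↦ by
        ext t
        exact intervalIntegral.integral_smul c (fun τ ↦ g (projIcc 0 1 zero_le_one τ)) }
    1 fun g ↦ by
    rw [one_mul, BoundedContinuousFunction.norm_le (by positivity)]
    intro t
    refine (intervalIntegral.norm_integral_le_of_norm_le_const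
      (fun τ _ ↦ g.norm_coe_le_norm _)).trans ?_
    rw [sub_zero, abs_of_nonneg t.2.1]
    exact mul_le_of_le_one_right (norm_nonneg _) t.2.2

omit [CompleteSpace R] in
lemma primitive_apply (g : (I →ᵇ R)) (t : I) :
    primitive g t = ∫ τ in (0 : ℝ)..t, g (projIcc 0 1 zero_le_one τ) := rfl

omit [CompleteSpace R] in
lemma norm_primitive_le : ‖(primitive : (I →ᵇ R) →L[ℝ] (I →ᵇ R))‖ ≤ 1 :=
  LinearMap.mkContinuous_norm_le _ zero_le_one _

lemma hasDerivAt_primitive (g : (I →ᵇ R)) (t : ℝ) :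
    HasDerivAt (fun t : ℝ ↦ ∫ τ in (0 : ℝ)..t, g (projIcc 0 1 zero_le_one τ))
      (g (projIcc 0 1 zero_le_one t)) t :=
  ((g.continuous.comp continuous_projIcc).integral_hasStrictDerivAt 0 t).hasDerivAt

/-- A function on the real line with vanishing initial value is the primitive of its derivative. -/
lemma eq_primitive {w : ℝ → R} {w' : (I →ᵇ R)} (h0 : w 0 = 0)
    (hw : ∀ t : I, HasDerivAt w (w' t) t) (t : I) : w t = primitive w' t := by
  rw [primitive_apply, intervalIntegral.integral_eq_sub_of_hasDerivAt (f := w), h0, sub_zero]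
  · intro τ hτ
    rw [uIcc_of_le t.2.1] at hτ
    have hτ' : τ ∈ I := ⟨hτ.1, hτ.2.trans t.2.2⟩
    rw [projIcc_of_mem zero_le_one hτ']
    exact hw ⟨τ, hτ'⟩
  · exact (w'.continuous.comp continuous_projIcc).intervalIntegrable _ _

/-- The linear integral equation `g + J (a g) = 1` in a Banach algebra has, for small `a`, a unique
solution, which depends differentiably on `a`. -/
lemma exists_solution {E C : Type*} [NormedAddCommGroup E] [NormedSpace ℝ E] [NormedRing C]
    [NormedAlgebra ℝ C] [CompleteSpace C] {J : C →L[ℝ] C} (hJ : ‖J‖ ≤ 1) (a : E → C) :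
    ∃ g : E → C, ∀ x, ‖a x‖ < 1 → (g x + J (a x * g x) = 1) ∧
      (∀ z w, z + J (a x * z) = w + J (a x * w) → z = w) ∧
      ∀ a' : E →L[ℝ] C, HasFDerivAt a a' x → ∃ g' : E →L[ℝ] C, (HasFDerivAt g g' x) ∧
        ∀ h, g' h + J (a' h * g x + a x * g' h) = 0 := by
  let L : C →L[ℝ] C →L[ℝ] C :=
    (ContinuousLinearMap.compL ℝ C C C J) ∘L (ContinuousLinearMap.mul ℝ C)
  have hLn : ∀ c, ‖L c‖ ≤ ‖c‖ := fun c ↦ by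
    refine ContinuousLinearMap.opNorm_le_bound _ (norm_nonneg _) fun g ↦ ?_
    calc ‖J (c * g)‖ ≤ ‖J‖ * ‖c * g‖ := ContinuousLinearMap.le_opNorm _ _
      _ ≤ 1 * (‖c‖ * ‖g‖) := mul_le_mul hJ (norm_mul_le _ _) (norm_nonneg _) zero_le_one
      _ = _ := one_mul _
  let T : E → (C →L[ℝ] C) := fun x ↦ 1 + L (a x)
  have hTa : ∀ x z, T x z = z + J (a x * z) := fun x z ↦ rfl
  have hunit : ∀ x, ‖a x‖ < 1 → IsUnit (T x) := fun x hx ↦ by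
    have := isUnit_one_sub_of_norm_lt_one (x := -L (a x))
      (by rw [norm_neg]; exact (hLn _).trans_lt hx)
    rwa [sub_neg_eq_add] at this
  let g : E → C := fun x ↦ Ring.inverse (T x) 1
  have hgeq : ∀ x, ‖a x‖ < 1 → g x + J (a x * g x) = 1 := fun x hx ↦ by
    have h1 : (T x * Ring.inverse (T x)) 1 = (1 : C →L[ℝ] C) 1 := by
      rw [Ring.mul_inverse_cancel _ (hunit x hx)]
    exact h1
  refine ⟨g, fun x hx ↦ ⟨hgeq x hx, fun z w hzw ↦ ?_, fun a' ha' ↦ ?_⟩⟩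
  · have hl : ∀ z, Ring.inverse (T x) (T x z) = z := fun z ↦ by
      change (Ring.inverse (T x) * T x) z = (1 : C →L[ℝ] C) z
      rw [Ring.inverse_mul_cancel _ (hunit x hx)]
    rw [← hl z, ← hl w, hTa, hTa, hzw]
  have hTd : DifferentiableAt ℝ T x :=
    (L.differentiableAt.comp x ha'.differentiableAt).const_add (1 : C →L[ℝ] C)
  have hgd : DifferentiableAt ℝ g x :=
    (hTd.inverse (hunit x hx)).clm_apply (differentiableAt_const _)
  refine ⟨fderiv ℝ g x, hgd.hasFDerivAt, fun h ↦ ?_⟩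
  have h1 : HasFDerivAt (𝕜 := ℝ) (fun y ↦ g y + J (a y * g y)) _ x :=
    hgd.hasFDerivAt.add (J.hasFDerivAt.comp x (ha'.mul' hgd.hasFDerivAt))
  have h2 : HasFDerivAt (fun y ↦ g y + J (a y * g y)) (0 : E →L[ℝ] C) x := by
    refine (hasFDerivAt_const (1 : C) x).congr_of_eventuallyEq ?_
    filter_upwards [ha'.continuousAt.norm.eventually (gt_mem_nhds hx)] with y hy using hgeq y hy
  have h3 := congrArg (fun L : E →L[ℝ] C ↦ L h) (h1.unique h2)
  simpa [add_comm] using h3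

/-- The restriction of the form `A` to the ray from `0` to `x`, as a function of time. -/
def radial (A : E → E →L[ℝ] R) (hA : Continuous A) (x : E) : (I →ᵇ R) :=
  ofContinuous (fun t : I ↦ A ((t : ℝ) • x) x) (by fun_prop)

/-- The derivative of the radial component of `A` in the endpoint of the ray. -/
def radialDeriv (A : E → E →L[ℝ] R) (hA : ContDiff ℝ 1 A) (x : E) : (I →ᵇ (E →L[ℝ] R)) :=
  ofContinuous (fun t : I ↦ (t : ℝ) • (fderiv ℝ A ((t : ℝ) • x)).flip x + A ((t : ℝ) • x)) (by
    have := hA.continuous_fderiv one_ne_zero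
    have := hA.continuous
    have h2 := (ContinuousLinearMap.flipₗᵢ ℝ E E R).continuous
    have h3 : Continuous fun t : I ↦ (fderiv ℝ A ((t : ℝ) • x)).flip :=
      h2.comp (by fun_prop : Continuous fun t : I ↦ fderiv ℝ A ((t : ℝ) • x))
    fun_prop)

omit [CompleteSpace R] in
lemma hasFDerivAt_radial (A : E → E →L[ℝ] R) (hA : ContDiff ℝ 1 A) (x : E) :
    HasFDerivAt (radial A hA.continuous) (flipCLM (radialDeriv A hA x)) x := by
  refine hasFDerivAt_family (fun y t ↦ ?_) ?_ x
  · have h1 : HasFDerivAt (fun z ↦ A ((t : ℝ) • z))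
        ((fderiv ℝ A ((t : ℝ) • y)) ∘L ((t : ℝ) • ContinuousLinearMap.id ℝ E)) y :=
      ((hA.differentiable one_ne_zero) ((t : ℝ) • y)).hasFDerivAt.comp y
        ((hasFDerivAt_id y).const_smul (t : ℝ))
    refine (h1.clm_apply (hasFDerivAt_id y)).congr_fderiv ?_
    ext h
    simp [radialDeriv, add_comm]
  · have := hA.continuous_fderiv one_ne_zero
    have := hA.continuous
    have h2 := (ContinuousLinearMap.flipₗᵢ ℝ E E R).continuous
    have h3 : Continuous fun p : E × I ↦ (fderiv ℝ A ((p.2 : ℝ) • p.1)).flip :=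
      h2.comp (by fun_prop : Continuous fun p : E × I ↦ fderiv ℝ A ((p.2 : ℝ) • p.1))
    change Continuous fun p : E × I ↦ ((p.2 : ℝ) • (fderiv ℝ A ((p.2 : ℝ) • p.1)).flip p.1
      + A ((p.2 : ℝ) • p.1))
    fun_prop

/-- **Frobenius theorem for a flat connection form.** A form `A` with values in a Banach algebra
and `dA + A ∧ A = 0` near `0` is, near `0`, of the form `-dG G⁻¹`. The function `G` is the
parallel transport along the rays from `0`. -/
theorem exists_hasFDerivAt_eq_neg_mul (A : E → E →L[ℝ] R) (hA : ContDiff ℝ 1 A)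
    (hflat : ∀ᶠ y in 𝓝 (0 : E), ∀ u v, fderiv ℝ A y u v - fderiv ℝ A y v u
      + (A y u * A y v - A y v * A y u) = 0) :
    ∃ G : E → R, G 0 = 1 ∧ ∀ᶠ x in 𝓝 (0 : E),
      HasFDerivAt G (-((ContinuousLinearMap.mul ℝ R).flip (G x) ∘L A x)) x := by
  set a := radial A hA.continuous with ha
  obtain ⟨g, hg⟩ := exists_solution (norm_primitive_le (R := R)) a
  have ha0 : a 0 = 0 := by ext t; simp [ha, radial]
  obtain ⟨δ, hδ, hflat⟩ := Metric.eventually_nhds_iff_ball.1 hflat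
  have hacont : Continuous a :=
    continuous_iff_continuousAt.2 fun x ↦ (hasFDerivAt_radial A hA x).continuousAt
  have hsmall : ∀ᶠ x in 𝓝 (0 : E), ‖a x‖ < 1 := by
    have := hacont.norm.tendsto 0
    rw [ha0, norm_zero] at this
    exact this.eventually (gt_mem_nhds zero_lt_one)
  refine ⟨fun x ↦ g x 1, ?_, ?_⟩
  · have := (hg 0 (by rw [ha0]; simp)).1
    rw [ha0] at this
    simp only [zero_mul, map_zero, add_zero] at this
    simp [this]
  filter_upwards [hsmall, Metric.ball_mem_nhds 0 hδ] with x hx hxδ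
  obtain ⟨hgeq, hinj, hder⟩ := hg x hx
  obtain ⟨g', hg', hlin⟩ := hder _ (hasFDerivAt_radial A hA x)
  set a' := flipCLM (radialDeriv A hA x)
  -- the solution `w` of the linearized integral equation: flatness of `A` is what makes it one
  have hkey : ∀ h (t : I), g' h t = -((t : ℝ) • (A ((t : ℝ) • x) h * g x t)) := by
    intro h
    let w : (I →ᵇ R) := ofContinuous (fun t : I ↦ -((t : ℝ) • (A ((t : ℝ) • x) h * g x t))) (by
      have := hA.continuous
      have := (g x).continuous
      fun_prop)
    have hw : w + primitive (a' h * g x + a x * w) = 0 := by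
      -- the extension of `g x` to the real line
      let ge : ℝ → R := fun t ↦ 1 - ∫ τ in (0 : ℝ)..t, (a x * g x) (projIcc 0 1 zero_le_one τ)
      have hge : ∀ t : I, ge t = g x t := fun t ↦ by
        have := congrArg (fun f : (I →ᵇ R) ↦ f t) hgeq
        simp only [BoundedContinuousFunction.add_apply, primitive_apply,
          BoundedContinuousFunction.coe_one, Pi.one_apply] at this
        exact sub_eq_of_eq_add this.symm
      have hged : ∀ t : I, HasDerivAt ge (-(a x t * g x t)) t := fun t ↦ by
        have := (hasDerivAt_primitive (a x * g x) t).const_sub 1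
        rwa [projIcc_val, BoundedContinuousFunction.mul_apply] at this
      have hwd : ∀ t : I, HasDerivAt (fun t : ℝ ↦ -(t • (A (t • x) h * ge t)))
          ((-(a' h * g x + a x * w)) t) t := fun t ↦ by
        have h1 : HasDerivAt (fun t : ℝ ↦ A (t • x)) (fderiv ℝ A ((t : ℝ) • x) x) t := by
          have := (hA.differentiable one_ne_zero ((t : ℝ) • x)).hasFDerivAt.comp_hasDerivAt
            (t : ℝ) ((hasDerivAt_id (t : ℝ)).smul_const x)
          exact HasDerivAt.congr_deriv (f := fun t : ℝ ↦ A (t • x)) this (by simp)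
        have h2 := h1.clm_apply (hasDerivAt_const (t : ℝ) h)
        have h3 := ((hasDerivAt_id (t : ℝ)).smul (h2.mul (hged t))).neg
        refine h3.congr_deriv ?_
        have hF := hflat ((t : ℝ) • x) (by
          simp only [Metric.mem_ball, dist_zero_right] at hxδ ⊢
          rw [norm_smul, Real.norm_eq_abs, abs_of_nonneg t.2.1]
          exact (mul_le_of_le_one_left (norm_nonneg _) t.2.2).trans_lt hxδ) x h
        have hF' : fderiv ℝ A ((t : ℝ) • x) x h = fderiv ℝ A ((t : ℝ) • x) h x
            - (A ((t : ℝ) • x) x * A ((t : ℝ) • x) h - A ((t : ℝ) • x) h * A ((t : ℝ) • x) x) := by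
          rw [← sub_eq_zero, ← hF]; abel
        simp only [hge, id, map_zero, add_zero, hF', Pi.mul_apply,
          BoundedContinuousFunction.neg_apply, BoundedContinuousFunction.add_apply,
          BoundedContinuousFunction.mul_apply, a', flipCLM_apply, radialDeriv,
          BoundedContinuousFunction.mkOfCompact_apply, ContinuousMap.coe_mk, _root_.add_apply,
          _root_.smul_apply, ContinuousLinearMap.flip_apply, w, ha, radial, smul_add, smul_sub,
          sub_mul, add_mul,
          mul_neg, smul_neg, one_smul, smul_mul_assoc, mul_smul_comm, mul_assoc]
        abel
      ext t
      have := eq_primitive (w := fun t : ℝ ↦ -(t • (A (t • x) h * ge t))) (by simp) hwd t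
      simp only [map_neg, BoundedContinuousFunction.neg_apply, hge] at this
      simp only [BoundedContinuousFunction.add_apply, BoundedContinuousFunction.coe_zero,
        Pi.zero_apply]
      rw [← eq_neg_iff_add_eq_zero, ← this]
      rfl
    have hgw : g' h = w := hinj _ _ <| by
      have e1 := hlin h
      rw [map_add, ← hw, map_add] at e1
      have := sub_eq_zero.2 e1
      rw [← sub_eq_zero, ← this]; abel
    intro t
    rw [hgw]; rfl
  have hev := (BoundedContinuousFunction.evalCLM ℝ (1 : I)).hasFDerivAt.comp x hg'
  refine HasFDerivAt.congr_fderiv (f := fun x ↦ g x 1) hev ?_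
  ext h
  simpa using hkey h 1

omit [CompleteSpace R] in
/-- A solution of `dG = -A G` is as smooth as `A` allows. -/
lemma contDiffOn_of_hasFDerivAt {A : E → E →L[ℝ] R} (hA : ContDiff ℝ ∞ A) {G : E → R} {s : Set E}
    (hs : IsOpen s)
    (hG : ∀ x ∈ s, HasFDerivAt G (-((ContinuousLinearMap.mul ℝ R).flip (G x) ∘L A x)) x) :
    ContDiffOn ℝ ∞ G s := by
  rw [contDiffOn_infty]
  intro n
  induction n with
  | zero =>
    exact contDiffOn_zero.2 fun x hx ↦ (hG x hx).continuousAt.continuousWithinAt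
  | succ n ih =>
    push_cast
    rw [contDiffOn_succ_iff_fderiv_of_isOpen hs]
    refine ⟨fun x hx ↦ (hG x hx).differentiableAt.differentiableWithinAt, by simp, ?_⟩
    have h1 : ContDiffOn ℝ n (fun x ↦ -((ContinuousLinearMap.mul ℝ R).flip (G x) ∘L A x)) s := by
      refine ContDiffOn.neg (ContDiffOn.clm_comp ?_ ?_)
      · exact (ContinuousLinearMap.contDiff _).comp_contDiffOn ih
      · exact (hA.of_le (by exact_mod_cast le_top)).contDiffOn
    exact h1.congr fun x hx ↦ (hG x hx).fderiv

end FlatForm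

/-! ### Coordinate vector fields -/

section CoordinateFields

variable {m : ℕ} {M : Type*} [TopologicalSpace M]
  [ChartedSpace (EuclideanSpace ℝ (Fin m)) M] [IsManifold (𝓡 m) ∞ M]

/-- The coordinate vector field of the preferred chart at `p₀` in the direction `u`. -/
def coordField (p₀ : M) (u : EuclideanSpace ℝ (Fin m)) : Π p : M, TangentSpace (𝓡 m) p :=
  VectorField.mpullback (𝓡 m) 𝓘(ℝ, EuclideanSpace ℝ (Fin m)) (extChartAt (𝓡 m) p₀) (fun _ ↦ u)

lemma contMDiffAt_coordField (p₀ : M) (u : EuclideanSpace ℝ (Fin m)) {q : M}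
    (hq : q ∈ (chartAt (EuclideanSpace ℝ (Fin m)) p₀).source) :
    ContMDiffAt (𝓡 m) (𝓡 m).tangent ∞
      (fun p ↦ (⟨p, coordField p₀ u p⟩ : TangentBundle (𝓡 m) M)) q := by
  refine ContMDiffAt.mpullback_vectorField_preimage (n := ∞) ?_ (contMDiffAt_extChartAt' hq)
    (isInvertible_mfderiv_extChartAt (by simpa using hq)) (by simp)
  exact contMDiffAt_vectorSpace_iff_contDiffAt.2 contDiffAt_const

/-- Coordinate vector fields commute. -/
lemma mlieBracket_coordField (p₀ : M) (u v : EuclideanSpace ℝ (Fin m)) {q : M}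
    (hq : q ∈ (chartAt (EuclideanSpace ℝ (Fin m)) p₀).source) :
    VectorField.mlieBracket (𝓡 m) (coordField p₀ u) (coordField p₀ v) q = 0 := by
  have hc : ∀ w : EuclideanSpace ℝ (Fin m), MDifferentiableAt 𝓘(ℝ, EuclideanSpace ℝ (Fin m))
      𝓘(ℝ, EuclideanSpace ℝ (Fin m)).tangent (fun p ↦ (⟨p, w⟩ :
        TangentBundle 𝓘(ℝ, EuclideanSpace ℝ (Fin m)) (EuclideanSpace ℝ (Fin m))))
      (extChartAt (𝓡 m) p₀ q) := fun w ↦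
    (contMDiffAt_vectorSpace_iff_contDiffAt.2 contDiffAt_const :
      ContMDiffAt _ _ ∞ _ _).mdifferentiableAt (by simp)
  have : IsManifold (𝓡 m) (minSmoothness ℝ 2) M := IsManifold.of_le (n := ∞)
    (by simpa using (ENat.LEInfty.out : (2 : ℕ∞ω) ≤ ∞))
  refine (VectorField.mpullback_mlieBracket (n := ∞) (hc u) (hc v)
    (contMDiffAt_extChartAt' hq)
    (by simpa using (ENat.LEInfty.out : (2 : ℕ∞ω) ≤ ∞))).symm.trans ?_
  have h0 : VectorField.mlieBracket 𝓘(ℝ, EuclideanSpace ℝ (Fin m))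
      (fun _ : EuclideanSpace ℝ (Fin m) ↦ u) (fun _ : EuclideanSpace ℝ (Fin m) ↦ v) = 0 := by
    funext y
    refine (congrFun (VectorField.mlieBracketWithin_eq_lieBracketWithin (s := univ)) y).trans ?_
    rw [VectorField.lieBracketWithin_univ]
    simp [VectorField.lieBracket]
    rfl
  refine (congrArg (fun W ↦ VectorField.mpullback (𝓡 m) 𝓘(ℝ, EuclideanSpace ℝ (Fin m))
    (extChartAt (𝓡 m) p₀) W q) h0).trans ?_
  exact congrFun VectorField.mpullback_zero q

lemma coordField_mfderiv (p₀ : M) {q : M}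
    (hq : q ∈ (chartAt (EuclideanSpace ℝ (Fin m)) p₀).source) (v : TangentSpace (𝓡 m) q) :
    coordField p₀ (mfderiv (𝓡 m) 𝓘(ℝ, EuclideanSpace ℝ (Fin m)) (extChartAt (𝓡 m) p₀) q v) q
      = v := by
  have := isInvertible_mfderiv_extChartAt (I := 𝓡 m) (x := p₀) (y := q) (by simpa using hq)
  obtain ⟨L, hL⟩ := this
  change (mfderiv (𝓡 m) 𝓘(ℝ, EuclideanSpace ℝ (Fin m)) (extChartAt (𝓡 m) p₀) q).inverse
    (mfderiv (𝓡 m) 𝓘(ℝ, EuclideanSpace ℝ (Fin m)) (extChartAt (𝓡 m) p₀) q v) = v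
  rw [← hL, ContinuousLinearMap.inverse_equiv]
  exact L.symm_apply_apply v

lemma mfderiv_coordField (p₀ : M) {q : M}
    (hq : q ∈ (chartAt (EuclideanSpace ℝ (Fin m)) p₀).source) (u : EuclideanSpace ℝ (Fin m)) :
    mfderiv (𝓡 m) 𝓘(ℝ, EuclideanSpace ℝ (Fin m)) (extChartAt (𝓡 m) p₀) q (coordField p₀ u q)
      = u := by
  have := isInvertible_mfderiv_extChartAt (I := 𝓡 m) (x := p₀) (y := q) (by simpa using hq)
  obtain ⟨L, hL⟩ := this
  change (mfderiv (𝓡 m) 𝓘(ℝ, EuclideanSpace ℝ (Fin m)) (extChartAt (𝓡 m) p₀) q)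
    ((mfderiv (𝓡 m) 𝓘(ℝ, EuclideanSpace ℝ (Fin m)) (extChartAt (𝓡 m) p₀) q).inverse
      (u : TangentSpace 𝓘(ℝ, EuclideanSpace ℝ (Fin m)) (extChartAt (𝓡 m) p₀ q))) = u
  rw [← hL, ContinuousLinearMap.inverse_equiv]
  exact L.apply_symm_apply u

variable {F : Type*} [NormedAddCommGroup F] [NormedSpace ℝ F]

lemma mvfderiv_congr {f g : M → F} {q : M} (h : f =ᶠ[𝓝 q] g) :
    mvfderiv (𝓡 m) f q = mvfderiv (𝓡 m) g q := by
  have := h.mfderiv_eq (I := 𝓡 m) (I' := 𝓘(ℝ, F))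
  exact this

/-- Derivatives of functions on the manifold are computed in a chart. -/
lemma mvfderiv_comp_extChartAt (p₀ : M) {q : M}
    (hq : q ∈ (chartAt (EuclideanSpace ℝ (Fin m)) p₀).source) {g : EuclideanSpace ℝ (Fin m) → F}
    (hg : DifferentiableAt ℝ g (extChartAt (𝓡 m) p₀ q)) (v : TangentSpace (𝓡 m) q) :
    mvfderiv (𝓡 m) (fun p ↦ g (extChartAt (𝓡 m) p₀ p)) q v =
      fderiv ℝ g (extChartAt (𝓡 m) p₀ q)
        (mfderiv (𝓡 m) 𝓘(ℝ, EuclideanSpace ℝ (Fin m)) (extChartAt (𝓡 m) p₀) q v) := by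
  have h := HasMFDerivAt.comp q (hg.hasFDerivAt.hasMFDerivAt)
    (mdifferentiableAt_extChartAt (I := 𝓡 m) hq).hasMFDerivAt
  have h2 := h.mfderiv
  rw [mvfderiv]
  change NormedSpace.fromTangentSpace _ (mfderiv (𝓡 m) 𝓘(ℝ, F) (g ∘ extChartAt (𝓡 m) p₀) q v) = _
  rw [h2]
  rfl

lemma mdifferentiableAt_extChartAt_symm' (p₀ : M) {q : M}
    (hq : q ∈ (chartAt (EuclideanSpace ℝ (Fin m)) p₀).source) :
    MDifferentiableAt 𝓘(ℝ, EuclideanSpace ℝ (Fin m)) (𝓡 m) (extChartAt (𝓡 m) p₀).symm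
      (extChartAt (𝓡 m) p₀ q) := by
  have hq' : q ∈ (extChartAt (𝓡 m) p₀).source := by simpa using hq
  have := mdifferentiableWithinAt_extChartAt_symm (I := 𝓡 m) (x := p₀)
        ((extChartAt (𝓡 m) p₀).map_source hq')
  rw [(𝓡 m).range_eq_univ] at this
  exact this.mdifferentiableAt Filter.univ_mem

lemma differentiableAt_comp_extChartAt_symm (p₀ : M) {q : M}
    (hq : q ∈ (chartAt (EuclideanSpace ℝ (Fin m)) p₀).source) {h : M → F}
    (hh : MDifferentiableAt (𝓡 m) 𝓘(ℝ, F) h q) :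
    DifferentiableAt ℝ (h ∘ (extChartAt (𝓡 m) p₀).symm) (extChartAt (𝓡 m) p₀ q) := by
  have hq' : q ∈ (extChartAt (𝓡 m) p₀).source := by simpa using hq
  rw [← mdifferentiableAt_iff_differentiableAt]
  refine MDifferentiableAt.comp (I' := 𝓡 m) _ ?_ (mdifferentiableAt_extChartAt_symm' p₀ hq)
  rwa [(extChartAt (𝓡 m) p₀).left_inv hq']

lemma eventuallyEq_comp_extChartAt (p₀ : M) {q : M}
    (hq : q ∈ (chartAt (EuclideanSpace ℝ (Fin m)) p₀).source) (h : M → F) :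
    h =ᶠ[𝓝 q] fun p ↦ (h ∘ (extChartAt (𝓡 m) p₀).symm) (extChartAt (𝓡 m) p₀ p) := by
  have hq' : q ∈ (extChartAt (𝓡 m) p₀).source := by simpa using hq
  filter_upwards [extChartAt_source_mem_nhds' (I := 𝓡 m) hq'] with p hp
  rw [Function.comp_apply, (extChartAt (𝓡 m) p₀).left_inv hp]

/-- Coordinate vector fields act on functions as partial derivatives in the chart. -/
lemma mvfderiv_coordField (p₀ : M) {q : M}
    (hq : q ∈ (chartAt (EuclideanSpace ℝ (Fin m)) p₀).source) {h : M → F}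
    (hh : MDifferentiableAt (𝓡 m) 𝓘(ℝ, F) h q) (u : EuclideanSpace ℝ (Fin m)) :
    mvfderiv (𝓡 m) h q (coordField p₀ u q) =
      fderiv ℝ (h ∘ (extChartAt (𝓡 m) p₀).symm) (extChartAt (𝓡 m) p₀ q) u := by
  have h1 := mvfderiv_comp_extChartAt p₀ hq (differentiableAt_comp_extChartAt_symm p₀ hq hh)
    (coordField p₀ u q)
  rw [mfderiv_coordField p₀ hq] at h1
  rw [← h1, mvfderiv_congr (eventuallyEq_comp_extChartAt p₀ hq h)]

/-- A function with vanishing derivative is locally constant. -/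
lemma eventually_eq_of_mvfderiv_eq_zero {h : M → F} {p : M}
    (hh : ∀ᶠ q in 𝓝 p, MDifferentiableAt (𝓡 m) 𝓘(ℝ, F) h q ∧ mvfderiv (𝓡 m) h q = 0) :
    ∀ᶠ q in 𝓝 p, h q = h p := by
  set φ := extChartAt (𝓡 m) p with hφ
  have h1 : ∀ᶠ q in 𝓝 p, q ∈ φ.source ∧
      MDifferentiableAt (𝓡 m) 𝓘(ℝ, F) h q ∧ mvfderiv (𝓡 m) h q = 0 := by
    filter_upwards [extChartAt_source_mem_nhds (I := 𝓡 m) p, hh] with q h1 h2 using ⟨h1, h2⟩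
  have h2 : ∀ᶠ y in 𝓝 (φ p), y ∈ φ.target ∧ (φ.symm y ∈ φ.source ∧
      MDifferentiableAt (𝓡 m) 𝓘(ℝ, F) h (φ.symm y) ∧ mvfderiv (𝓡 m) h (φ.symm y) = 0) := by
    have := (continuousAt_extChartAt_symm (I := 𝓡 m) p)
    rw [ContinuousAt, extChartAt_to_inv] at this
    filter_upwards [extChartAt_target_mem_nhds (I := 𝓡 m) p, this.eventually h1] with y h3 h4
      using ⟨h3, h4⟩
  obtain ⟨ε, hε, hball⟩ := Metric.eventually_nhds_iff_ball.1 h2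
  have hd : ∀ y ∈ Metric.ball (φ p) ε, HasFDerivAt (h ∘ φ.symm) (0 : _ →L[ℝ] F) y := by
    intro y hy
    obtain ⟨ht, hs, hdiff, hzero⟩ := hball y hy
    have hs' : φ.symm y ∈ (chartAt (EuclideanSpace ℝ (Fin m)) p).source := by
      rwa [hφ, extChartAt_source] at hs
    have e1 := differentiableAt_comp_extChartAt_symm p hs' hdiff
    have e2 : fderiv ℝ (h ∘ φ.symm) (φ (φ.symm y)) = 0 := by
      ext u
      rw [← mvfderiv_coordField p hs' hdiff u, hzero]
      rfl
    rw [← hφ] at e1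
    rw [φ.right_inv ht] at e1 e2
    rw [← e2]
    exact e1.hasFDerivAt
  have hconst : ∀ y ∈ Metric.ball (φ p) ε, (h ∘ φ.symm) y = (h ∘ φ.symm) (φ p) := by
    intro y hy
    refine (convex_ball (φ p) ε).is_const_of_fderivWithin_eq_zero (𝕜 := ℝ)
      (fun z hz ↦ (hd z hz).differentiableAt.differentiableWithinAt) (fun z hz ↦ ?_) hy
      (Metric.mem_ball_self hε)
    rw [fderivWithin_of_isOpen Metric.isOpen_ball hz, (hd z hz).fderiv]
  have h3 : ∀ᶠ q in 𝓝 p, φ q ∈ Metric.ball (φ p) ε :=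
    (continuousAt_extChartAt (I := 𝓡 m) p).eventually (Metric.ball_mem_nhds _ hε)
  filter_upwards [h3, extChartAt_source_mem_nhds (I := 𝓡 m) p] with q hq hq'
  have := hconst _ hq
  rwa [Function.comp_apply, Function.comp_apply, φ.left_inv hq',
    φ.left_inv (mem_extChartAt_source p)] at this

end CoordinateFields

/-! ### Connection forms -/

lemma fderiv_apply_apply {E₁ E₂ E₃ E₄ : Type*} [NormedAddCommGroup E₁] [NormedSpace ℝ E₁]
    [NormedAddCommGroup E₂] [NormedSpace ℝ E₂] [NormedAddCommGroup E₃] [NormedSpace ℝ E₃]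
    [NormedAddCommGroup E₄] [NormedSpace ℝ E₄] {A : E₁ → E₂ →L[ℝ] E₃ →L[ℝ] E₄} {y : E₁}
    (hA : DifferentiableAt ℝ A y) (u : E₁) (v : E₂) (f : E₃) :
    fderiv ℝ (fun z ↦ A z v f) y u = fderiv ℝ A y u v f := by
  have h1 : HasFDerivAt (fun z ↦ A z v) _ y := hA.hasFDerivAt.clm_apply (hasFDerivAt_const v y)
  have h2 : HasFDerivAt (fun z ↦ A z v f) _ y := h1.clm_apply (hasFDerivAt_const f y)
  rw [h2.fderiv]
  simp

namespace FlatConnection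

section LocalForm

variable {m : ℕ} {M : Type*} [TopologicalSpace M]
    [ChartedSpace (EuclideanSpace ℝ (Fin m)) M] [IsManifold (𝓡 m) ∞ M]
    {F : Type*} [NormedAddCommGroup F] [NormedSpace ℂ F]
    {V : M → Type*} [TopologicalSpace (TotalSpace F V)]
    [∀ p, AddCommGroup (V p)] [∀ p, Module ℂ (V p)] [∀ p, TopologicalSpace (V p)]
    [FiberBundle F V] [VectorBundle ℝ F V]

/-- The coordinates of a section in a local trivialization. -/
def sectionCoord (e : Trivialization F (TotalSpace.proj : TotalSpace F V → M))
    [MemTrivializationAtlas e] (τ : Π p, V p) (p : M) : F :=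
  e.continuousLinearMapAt ℝ p (τ p)

section coord
variable (e : Trivialization F (TotalSpace.proj : TotalSpace F V → M)) [MemTrivializationAtlas e]

lemma sectionCoord_eventuallyEq {p : M} (hp : p ∈ e.baseSet) (τ : Π p, V p) :
    sectionCoord e τ =ᶠ[𝓝 p] fun q ↦ (e ⟨q, τ q⟩).2 := by
  filter_upwards [e.open_baseSet.mem_nhds hp] with q hq
  exact e.continuousLinearMapAt_apply_of_mem ℝ hq (τ q)

variable [ContMDiffVectorBundle ∞ F V (𝓡 m)]

lemma mdifferentiableAt_sectionCoord_iff {p : M} (hp : p ∈ e.baseSet) {τ : Π p, V p} :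
    MDifferentiableAt (𝓡 m) 𝓘(ℝ, F) (sectionCoord e τ) p ↔
      MDifferentiableAt (𝓡 m) ((𝓡 m).prod 𝓘(ℝ, F)) (fun q ↦ TotalSpace.mk' F q (τ q)) p := by
  rw [(sectionCoord_eventuallyEq e hp τ).mdifferentiableAt_iff]
  exact (e.mdifferentiableAt_section_iff (𝓡 m) τ hp).symm

lemma contMDiffAt_sectionCoord_iff {p : M} (hp : p ∈ e.baseSet) {τ : Π p, V p} :
    ContMDiffAt (𝓡 m) 𝓘(ℝ, F) ∞ (sectionCoord e τ) p ↔
      ContMDiffAt (𝓡 m) ((𝓡 m).prod 𝓘(ℝ, F)) ∞ (fun q ↦ TotalSpace.mk' F q (τ q)) p := by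
  rw [(sectionCoord_eventuallyEq e hp τ).contMDiffAt_iff]
  exact (e.contMDiffAt_section_iff hp).symm

/-- The flat connection on the restriction of the bundle to the base set of a trivialization for
which the constant sections are parallel. -/
def trivialConnection (τ : Π p, V p) (p : M) : TangentSpace (𝓡 m) p →L[ℝ] V p :=
  e.symmL ℝ p ∘L mvfderiv (𝓡 m) (sectionCoord e τ) p

variable [∀ p, IsTopologicalAddGroup (V p)] [∀ p, ContinuousSMul ℝ (V p)]

lemma isCovariantDerivativeOn_trivialConnection :
    IsCovariantDerivativeOn F (trivialConnection (m := m) e) e.baseSet where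
  add {σ σ' x} hσ hσ' hx := by
    have h := mvfderiv_add ((mdifferentiableAt_sectionCoord_iff e hx).2 hσ)
      ((mdifferentiableAt_sectionCoord_iff e hx).2 hσ')
    have h' : sectionCoord e (σ + σ') = sectionCoord e σ + sectionCoord e σ' := by
      funext q; simp [sectionCoord]
    simp only [trivialConnection]
    rw [h', h, ContinuousLinearMap.comp_add]
  leibniz {σ g x} hσ hg hx := by
    have h := mvfderiv_smul hg ((mdifferentiableAt_sectionCoord_iff e hx).2 hσ)
    have h' : sectionCoord e (g • σ) = g • sectionCoord e σ := by
      funext q; simp [sectionCoord]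
    simp only [trivialConnection]
    rw [h', h]
    ext v
    have h1 := e.symmL_continuousLinearMapAt (R := ℝ) hx (σ x)
    simp only [ContinuousLinearMap.comp_apply, add_apply, smul_apply,
      ContinuousLinearMap.smulRight_apply, map_add, _root_.map_smul, sectionCoord, h1]

end coord

variable [∀ p, IsTopologicalAddGroup (V p)] [∀ p, ContinuousSMul ℝ (V p)]
    [FiniteDimensional ℂ F]
    [ContMDiffVectorBundle ∞ F V (𝓡 m)]
    (E : FlatConnection m M F V)

/-- In a trivialization, a connection is `d + A`: its difference with the trivial connection is
tensorial. -/
lemma exists_connection_form (e : Trivialization F (TotalSpace.proj : TotalSpace F V → M))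
    [MemTrivializationAtlas e] :
    ∃ A : Π p : M, F →ₗ[ℝ] TangentSpace (𝓡 m) p →ₗ[ℝ] F, ∀ p ∈ e.baseSet, ∀ τ : Π p, V p,
      MDifferentiableAt (𝓡 m) ((𝓡 m).prod 𝓘(ℝ, F)) (fun q ↦ TotalSpace.mk' F q (τ q)) p →
      ∀ v, e.continuousLinearMapAt ℝ p (E.D τ p v) =
        mvfderiv (𝓡 m) (sectionCoord e τ) p v + A p (sectionCoord e τ p) v := by
  let B := IsCovariantDerivativeOn.difference (I := 𝓡 m) (F := F) (V := V)
    (E.D.isCovariantDerivativeOn (s := e.baseSet)) (isCovariantDerivativeOn_trivialConnection e)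
  refine ⟨fun p ↦ LinearMap.mk₂ ℝ
    (fun f v ↦ e.continuousLinearMapAt ℝ p (B p (e.symmL ℝ p f) v))
    (by intros; simp) (by intros; simp) (by intros; simp) (by intros; simp), ?_⟩
  intro p hp τ hτ v
  have h := IsCovariantDerivativeOn.difference_apply (I := 𝓡 m) (F := F) (V := V)
    (E.D.isCovariantDerivativeOn (s := e.baseSet))
    (isCovariantDerivativeOn_trivialConnection e) hp hτ
  have h1 : E.D τ p v = trivialConnection e τ p v + B p (τ p) v := by
    rw [h]; simp
  rw [h1, map_add]
  simp only [LinearMap.mk₂_apply, sectionCoord, e.symmL_continuousLinearMapAt hp]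
  simp only [trivialConnection]
  congr 1
  exact e.continuousLinearMapAt_symmL hp _

lemma coordField_add (p₀ : M) (u v : EuclideanSpace ℝ (Fin m)) (q : M) :
    coordField p₀ (u + v) q = coordField p₀ u q + coordField p₀ v q :=
  map_add (mfderiv (𝓡 m) 𝓘(ℝ, EuclideanSpace ℝ (Fin m)) (extChartAt (𝓡 m) p₀) q).inverse u v

lemma coordField_smul (p₀ : M) (c : ℝ) (u : EuclideanSpace ℝ (Fin m)) (q : M) :
    coordField p₀ (c • u) q = c • coordField p₀ u q :=
  _root_.map_smul
    (mfderiv (𝓡 m) 𝓘(ℝ, EuclideanSpace ℝ (Fin m)) (extChartAt (𝓡 m) p₀) q).inverse c u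

set_option synthInstance.maxHeartbeats 200000 in
/-- Near every point, a flat connection is `d + A` in a trivialization and a chart, for a smooth
matrix valued one-form `A` with `dA + A ∧ A = 0`. -/
lemma exists_local_connection_form [T2Space M] (p₀ : M) :
    ∃ N : Set M, IsOpen N ∧ p₀ ∈ N ∧ N ⊆ (trivializationAt F V p₀).baseSet ∧
      N ⊆ (chartAt (EuclideanSpace ℝ (Fin m)) p₀).source ∧
      ∃ A : EuclideanSpace ℝ (Fin m) → EuclideanSpace ℝ (Fin m) →L[ℝ] F →L[ℝ] F,
      (∀ q ∈ N, ContDiffAt ℝ ∞ A (extChartAt (𝓡 m) p₀ q)) ∧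
      (∀ q ∈ N, ∀ u v, fderiv ℝ A (extChartAt (𝓡 m) p₀ q) u v
        - fderiv ℝ A (extChartAt (𝓡 m) p₀ q) v u
        + (A (extChartAt (𝓡 m) p₀ q) u * A (extChartAt (𝓡 m) p₀ q) v
          - A (extChartAt (𝓡 m) p₀ q) v * A (extChartAt (𝓡 m) p₀ q) u) = 0) ∧
      ∀ q ∈ N, ∀ τ : Π p, V p,
        MDifferentiableAt (𝓡 m) ((𝓡 m).prod 𝓘(ℝ, F)) (fun q ↦ TotalSpace.mk' F q (τ q)) q →
        ∀ v, (trivializationAt F V p₀).continuousLinearMapAt ℝ q (E.D τ q v) =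
          mvfderiv (𝓡 m) (sectionCoord (trivializationAt F V p₀) τ) q v +
          A (extChartAt (𝓡 m) p₀ q)
            (mfderiv (𝓡 m) 𝓘(ℝ, EuclideanSpace ℝ (Fin m)) (extChartAt (𝓡 m) p₀) q v)
            (sectionCoord (trivializationAt F V p₀) τ q) := by
  set e := trivializationAt F V p₀ with he
  set φ := extChartAt (𝓡 m) p₀ with hφ
  obtain ⟨B, hB⟩ := E.exists_connection_form e
  have hW : e.baseSet ∩ (chartAt (EuclideanSpace ℝ (Fin m)) p₀).source ∈ 𝓝 p₀ :=
    Filter.inter_mem (e.open_baseSet.mem_nhds (FiberBundle.mem_baseSet_trivializationAt' p₀))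
      ((chartAt _ p₀).open_source.mem_nhds (mem_chart_source _ p₀))
  obtain ⟨χ, -, hχ⟩ := (SmoothBumpFunction.nhds_basis_tsupport (I := 𝓡 m) p₀).mem_iff.1 hW
  have hχe : tsupport χ ⊆ e.baseSet := hχ.trans inter_subset_left
  have hχc : tsupport χ ⊆ (chartAt (EuclideanSpace ℝ (Fin m)) p₀).source :=
    hχ.trans inter_subset_right
  -- Smoothness and flatness of the connection are statements about global sections and fields, so
  -- frame sections and coordinate fields are cut off. `N` is where the cutoff is locally one.
  let N : Set M := {q | ∀ᶠ p in 𝓝 q, χ p = 1}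
  have hNo : IsOpen N := isOpen_setOfPred_eventually_nhds
  have hN1 : ∀ q ∈ N, χ q = 1 := fun q hq ↦
    Filter.Eventually.self_of_nhds (p := fun p ↦ χ p = 1) hq
  have hNt : N ⊆ tsupport χ := fun q hq ↦ subset_tsupport _ (by simp [hN1 q hq])
  have hNe : N ⊆ e.baseSet := hNt.trans hχe
  have hNc := hNt.trans hχc
  let σ : F → Π p, V p := fun f p ↦ χ p • e.symmL ℝ p f
  let X : EuclideanSpace ℝ (Fin m) → Π p : M, TangentSpace (𝓡 m) p :=
    fun u p ↦ χ p • coordField p₀ u p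
  have hσ : ∀ f, ContMDiff (𝓡 m) ((𝓡 m).prod 𝓘(ℝ, F)) ∞
      (fun q ↦ TotalSpace.mk' F q (σ f q)) := by
    intro f
    refine ContMDiffOn.smul_section_of_tsupport (u := e.baseSet) χ.contMDiff.contMDiffOn
      e.open_baseSet hχe ?_
    intro p hp
    refine ((contMDiffAt_sectionCoord_iff e hp).1 ?_).contMDiffWithinAt
    refine contMDiffAt_const (c := f) |>.congr_of_eventuallyEq ?_
    filter_upwards [e.open_baseSet.mem_nhds hp] with q hq
    exact e.continuousLinearMapAt_symmL hq f
  have hX : ∀ u, VecField.IsSmooth (X u) := by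
    intro u
    refine ContMDiffOn.smul_section_of_tsupport
      (u := (chartAt (EuclideanSpace ℝ (Fin m)) p₀).source) χ.contMDiff.contMDiffOn
      (chartAt _ p₀).open_source hχc ?_
    intro p hp
    exact (contMDiffAt_coordField p₀ u hp).contMDiffWithinAt
  have hXN : ∀ u, ∀ q ∈ N, X u q = coordField p₀ u q := fun u q hq ↦ by simp [X, hN1 q hq]
  have hXev : ∀ u, ∀ q ∈ N, X u =ᶠ[𝓝 q] coordField p₀ u := fun u q hq ↦ by
    filter_upwards [hNo.mem_nhds hq] with p hp using hXN u p hp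
  have hbr : ∀ u v, ∀ q ∈ N, VectorField.mlieBracket (𝓡 m) (X u) (X v) q = 0 := fun u v q hq ↦ by
    rw [(hXev u q hq).mlieBracket_vectorField_eq (hXev v q hq)]
    exact mlieBracket_coordField p₀ u v (hNc hq)
  -- the coordinates of `D_u σ_f`
  let h : EuclideanSpace ℝ (Fin m) → F → M → F := fun u f q ↦ B q f (coordField p₀ u q)
  have hDsm : ∀ u f, ContMDiff (𝓡 m) ((𝓡 m).prod 𝓘(ℝ, F)) ∞
      (fun q ↦ TotalSpace.mk' F q (E.D (σ f) q (X u q))) := by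
    intro u f
    have h1 := E.smooth.contMDiff.contMDiff (σ := σ f) (by simpa using (hσ f).contMDiffOn)
    exact ContMDiff.clm_bundle_apply (contMDiffOn_univ.1 h1) (hX u)
  have hσc : ∀ f, ∀ q ∈ N, sectionCoord e (σ f) q = f := fun f q hq ↦ by
    simp only [sectionCoord, σ, hN1 q hq, one_smul]
    exact e.continuousLinearMapAt_symmL (hNe hq) f
  have hDc : ∀ u f, ∀ q ∈ N, sectionCoord e (fun p ↦ E.D (σ f) p (X u p)) q = h u f q := by
    intro u f q hq
    have h1 := hB q (hNe hq) (σ f) ((hσ f).mdifferentiableAt (by simp)) (X u q)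
    have h2 : mvfderiv (𝓡 m) (sectionCoord e (σ f)) q = 0 := by
      rw [mvfderiv_congr (g := fun _ ↦ f) (by
        filter_upwards [hNo.mem_nhds hq] with p hp using hσc f p hp)]
      exact mvfderiv_const f
    rw [h2, hσc f q hq, hXN u q hq] at h1
    simp only [sectionCoord, h]
    rw [hXN u q hq, h1]
    simp
  have hDev : ∀ u f, ∀ q ∈ N, sectionCoord e (fun p ↦ E.D (σ f) p (X u p)) =ᶠ[𝓝 q] h u f := by
    intro u f q hq
    filter_upwards [hNo.mem_nhds hq] with p hp using hDc u f p hp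
  have hsm : ∀ u f, ∀ q ∈ N, ContMDiffAt (𝓡 m) 𝓘(ℝ, F) ∞ (h u f) q := by
    intro u f q hq
    exact ((contMDiffAt_sectionCoord_iff e (hNe hq)).2 (hDsm u f q)).congr_of_eventuallyEq
      (hDev u f q hq).symm
  -- the connection form in the chart
  let A : EuclideanSpace ℝ (Fin m) → EuclideanSpace ℝ (Fin m) →L[ℝ] F →L[ℝ] F := fun y ↦
    (LinearMap.mk₂ ℝ (fun u f ↦ h u f (φ.symm y))
      (by intros; simp [h, coordField_add]) (by intros; simp [h, coordField_smul])
      (by intros; simp [h]) (by intros; simp [h])).toContinuousBilinearMap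
  have hA : ∀ y u f, A y u f = h u f (φ.symm y) := fun y u f ↦ rfl
  have hφs : ∀ q ∈ N, φ.symm (φ q) = q := fun q hq ↦ φ.left_inv (by
    rw [hφ, extChartAt_source]; exact hNc hq)
  have hAsm : ∀ q ∈ N, ContDiffAt ℝ ∞ A (φ q) := by
    have hO : IsOpen (φ.target ∩ φ.symm ⁻¹' N) :=
      (continuousOn_extChartAt_symm (I := 𝓡 m) p₀).isOpen_inter_preimage
        (isOpen_extChartAt_target p₀) hNo
    have hsO : ContDiffOn ℝ ∞ A (φ.target ∩ φ.symm ⁻¹' N) := by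
      rw [contDiffOn_clm_apply]
      intro u
      rw [contDiffOn_clm_apply]
      intro f y hy
      refine ContDiffAt.contDiffWithinAt ?_
      rw [← contMDiffAt_iff_contDiffAt]
      exact ContMDiffAt.comp (I' := 𝓡 m) y (hsm u f _ hy.2)
        ((contMDiffOn_extChartAt_symm p₀).contMDiffAt
          ((isOpen_extChartAt_target (I := 𝓡 m) p₀).mem_nhds hy.1))
    intro q hq
    have hqs : q ∈ φ.source := by rw [hφ, extChartAt_source]; exact hNc hq
    exact hsO.contDiffAt (hO.mem_nhds ⟨φ.map_source hqs, by rw [mem_preimage, hφs q hq]; exact hq⟩)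
  refine ⟨N, hNo, χ.eventuallyEq_one, hNe, hNc, A, hAsm, ?_, ?_⟩
  · intro q hq u v
    ext f
    have hcurv := E.flat (X u) (X v) (hX u) (hX v) (σ f) (hσ f) q
    rw [hbr u v q hq, map_zero, sub_zero] at hcurv
    have hkey : ∀ u v, e.continuousLinearMapAt ℝ q
        (E.D (fun p ↦ E.D (σ f) p (X v p)) q (X u q)) =
        fderiv ℝ A (φ q) u v f + A (φ q) u (A (φ q) v f) := by
      intro u v
      rw [hB q (hNe hq) _ ((hDsm v f).mdifferentiableAt (by simp)), hDc v f q hq,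
        mvfderiv_congr (hDev v f q hq), hXN u q hq,
        mvfderiv_coordField p₀ (hNc hq) ((hsm v f q hq).mdifferentiableAt (by simp))]
      congr 1
      · exact fderiv_apply_apply ((hAsm q hq).differentiableAt (by simp)) u v f
      · rw [hA, hA, hφs q hq]
    have h5 := congrArg (e.continuousLinearMapAt ℝ q) hcurv
    rw [map_sub, hkey, hkey, map_zero] at h5
    change fderiv ℝ A (φ q) u v f - fderiv ℝ A (φ q) v u f +
      (A (φ q) u (A (φ q) v f) - A (φ q) v (A (φ q) u f)) = 0
    rw [← h5]
    abel
  · intro q hq τ hτ v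
    rw [hB q (hNe hq) τ hτ v]
    congr 1
    refine Eq.trans ?_ (hA (φ q) (mfderiv (𝓡 m) 𝓘(ℝ, EuclideanSpace ℝ (Fin m)) φ q v)
      (sectionCoord e τ q)).symm
    rw [hφs q hq]
    exact congrArg (B q (sectionCoord e τ q)) (coordField_mfderiv p₀ (hNc hq) v).symm

end LocalForm
end FlatConnection

/-! ### Flat frames -/

namespace FlatForm

/-- A flat matrix valued one-form defined near a point has a fundamental solution there: an
invertible `G` with `dG = - A G`. -/
lemma exists_fundamental_solution {E R : Type*} [NormedAddCommGroup E] [NormedSpace ℝ E]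
    [HasContDiffBump E] [NormedRing R] [NormedAlgebra ℝ R] [CompleteSpace R]
    (A : E → E →L[ℝ] R) (c : E) {N : Set E} (hN : N ∈ 𝓝 c)
    (hA : ∀ y ∈ N, ContDiffAt ℝ ∞ A y)
    (hflat : ∀ y ∈ N, ∀ u v, fderiv ℝ A y u v - fderiv ℝ A y v u
      + (A y u * A y v - A y v * A y u) = 0) :
    ∃ s : Set E, IsOpen s ∧ c ∈ s ∧ s ⊆ N ∧ ∃ G : E → R, ContDiffOn ℝ ∞ G s ∧
      ∀ y ∈ s, IsUnit (G y) ∧ ∀ u, fderiv ℝ G y u = -(A y u * G y) := by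
  obtain ⟨ε, hε, hball⟩ := Metric.nhds_basis_closedBall.mem_iff.1 hN
  -- recentre at the origin and cut off
  let ψ : ContDiffBump (0 : E) := ⟨ε / 2, ε, by positivity, by linarith⟩
  let A' : E → E →L[ℝ] R := fun y ↦ ψ y • A (y + c)
  have hmem : ∀ y ∈ Metric.closedBall (0 : E) ε, y + c ∈ N := fun y hy ↦ hball (by
    simpa [Metric.mem_closedBall, dist_eq_norm] using hy)
  have hA' : ContDiff ℝ ∞ A' := by
    rw [contDiff_iff_contDiffAt]
    intro y
    by_cases hy : y ∈ tsupport ψ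
    · rw [ψ.tsupport_eq] at hy
      refine ψ.contDiff.contDiffAt.smul ?_
      exact ContDiffAt.comp (g := A) y (hA _ (hmem y hy)) (contDiffAt_id.add contDiffAt_const)
    · refine (contDiffAt_const (c := (0 : E →L[ℝ] R))).congr_of_eventuallyEq ?_
      filter_upwards [(isClosed_tsupport ψ).isOpen_compl.mem_nhds hy] with z hz
      simp only [A', image_eq_zero_of_notMem_tsupport hz]
      exact zero_smul ℝ (A (z + c))
  have hψ : ∀ᶠ y in 𝓝 (0 : E), A' =ᶠ[𝓝 y] fun z ↦ A (z + c) := by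
    filter_upwards [ψ.eventuallyEq_one.eventuallyEq_nhds] with y hy
    filter_upwards [hy] with z hz
    simp [A', hz]
  have hd : ∀ᶠ y in 𝓝 (0 : E), fderiv ℝ A' y = fderiv ℝ A (y + c) := by
    filter_upwards [hψ] with y hy
    rw [hy.fderiv_eq, fderiv_comp_add_right]
  have hin : ∀ᶠ y in 𝓝 (0 : E), y + c ∈ N := by
    filter_upwards [Metric.closedBall_mem_nhds (0 : E) hε] with y hy using hmem y hy
  obtain ⟨G, hG0, hG⟩ := exists_hasFDerivAt_eq_neg_mul A' (hA'.of_le (by simp)) (by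
    filter_upwards [hψ, hd, hin] with y h1 h2 h3 u v
    rw [h2, h1.self_of_nhds]
    exact hflat _ h3 u v)
  have hGc : ContinuousAt G 0 := hG.self_of_nhds.continuousAt
  have hunit : ∀ᶠ y in 𝓝 (0 : E), IsUnit (G y) :=
    hGc.eventually (Units.isOpen.mem_nhds (by rw [mem_ofPred_eq, hG0]; exact isUnit_one))
  obtain ⟨t, ht, hto, h0t⟩ := eventually_nhds_iff.1 (hG.and (hunit.and (hψ.and hin)))
  refine ⟨(fun y ↦ y - c) ⁻¹' t, hto.preimage (continuous_id.sub continuous_const), by simpa,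
    fun y hy ↦ by simpa using (ht _ hy).2.2.2, fun y ↦ G (y - c), ?_, ?_⟩
  · exact (contDiffOn_of_hasFDerivAt hA' hto fun x hx ↦ (ht x hx).1).comp
      (contDiff_id.sub contDiff_const).contDiffOn (fun y hy ↦ hy)
  · intro y hy
    obtain ⟨h1, h2, h3, -⟩ := ht _ hy
    refine ⟨h2, fun u ↦ ?_⟩
    have h4 : fderiv ℝ (fun y ↦ G (y - c)) y = fderiv ℝ G (y - c) := by
      simpa [sub_eq_add_neg] using fderiv_comp_add_right (𝕜 := ℝ) (f := G) (x := y) (-c)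
    rw [h4, h1.fderiv, h3.self_of_nhds]
    simp

end FlatForm

namespace FlatConnection

section Frame

variable {m : ℕ} {M : Type*} [TopologicalSpace M]
    [ChartedSpace (EuclideanSpace ℝ (Fin m)) M] [IsManifold (𝓡 m) ∞ M]
    {F : Type*} [NormedAddCommGroup F] [NormedSpace ℂ F]
    {V : M → Type*} [TopologicalSpace (TotalSpace F V)]
    [∀ p, AddCommGroup (V p)] [∀ p, Module ℂ (V p)] [∀ p, TopologicalSpace (V p)]
    [∀ p, IsTopologicalAddGroup (V p)] [∀ p, ContinuousSMul ℝ (V p)]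
    [FiberBundle F V] [VectorBundle ℝ F V]
    [ContMDiffVectorBundle ∞ F V (𝓡 m)]
    (E : FlatConnection m M F V)

/-- A flat frame over the open set `U`: fibrewise bijective coordinates `V q → F` for which the
sections with constant coordinates are flat, and in which differentiating the coordinates amounts
to differentiating covariantly. -/
structure FlatFrame (U : Set M) where
  /-- The coordinates of a vector. -/
  coord : Π q, V q → F
  /-- The section with given constant coordinates. -/
  sec : F → Π q, V q
  sec_coord : ∀ q ∈ U, ∀ v, sec (coord q v) q = v
  coord_sec : ∀ q ∈ U, ∀ f, coord q (sec f q) = f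
  flat : ∀ f, E.IsFlatOn U (sec f)
  mdifferentiableAt : ∀ q ∈ U, ∀ τ : Π p, V p,
    MDifferentiableAt (𝓡 m) ((𝓡 m).prod 𝓘(ℝ, F)) (fun q ↦ TotalSpace.mk' F q (τ q)) q →
    MDifferentiableAt (𝓡 m) 𝓘(ℝ, F) (fun p ↦ coord p (τ p)) q
  mvfderiv_eq_zero : ∀ q ∈ U, ∀ τ : Π p, V p,
    MDifferentiableAt (𝓡 m) ((𝓡 m).prod 𝓘(ℝ, F)) (fun q ↦ TotalSpace.mk' F q (τ q)) q →
    ∀ v, E.D τ q v = 0 → mvfderiv (𝓡 m) (fun p ↦ coord p (τ p)) q v = 0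

/-- A flat connection has flat frames near every point: in a chart and a trivialization, where the
connection is `d + A`, a fundamental solution `G` of `dG = -A G` gives the flat sections
`q ↦ G(q) f`. -/
theorem exists_flatFrame [T2Space M] [FiniteDimensional ℂ F] (p₀ : M) :
    ∃ U : Set M, IsOpen U ∧ p₀ ∈ U ∧ Nonempty (E.FlatFrame U) := by
  obtain ⟨N, hNo, hpN, hNe, hNc, A, hA, hflat, hD⟩ := E.exists_local_connection_form p₀
  set e := trivializationAt F V p₀ with he
  set φ := extChartAt (𝓡 m) p₀ with hφ
  have hNs : N ⊆ φ.source := by rw [hφ, extChartAt_source]; exact hNc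
  have hleft : ∀ q ∈ N, φ.symm (φ q) = q := fun q hq ↦ φ.left_inv (hNs hq)
  let O : Set (EuclideanSpace ℝ (Fin m)) := φ.target ∩ φ.symm ⁻¹' N
  have hO : IsOpen O := (continuousOn_extChartAt_symm (I := 𝓡 m) p₀).isOpen_inter_preimage
    (isOpen_extChartAt_target p₀) hNo
  have hpO : φ p₀ ∈ O := ⟨φ.map_source (hNs hpN), by rw [mem_preimage, hleft _ hpN]; exact hpN⟩
  have : CompleteSpace F := FiniteDimensional.complete ℝ F
  obtain ⟨s, hs, hps, hsO, G, hGs, hG⟩ := FlatForm.exists_fundamental_solution A (φ p₀)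
    (hO.mem_nhds hpO)
    (fun y hy ↦ by have := hA _ hy.2; rwa [φ.right_inv hy.1] at this)
    (fun y hy ↦ by have := hflat _ hy.2; rwa [φ.right_inv hy.1] at this)
  let U : Set M := N ∩ φ ⁻¹' s
  have hU : IsOpen U :=
    ((continuousOn_extChartAt (I := 𝓡 m) p₀).mono hNs).isOpen_inter_preimage hNo hs
  have hGd : ∀ q ∈ U, DifferentiableAt ℝ G (φ q) := fun q hq ↦
    (hGs.contDiffAt (hs.mem_nhds hq.2)).differentiableAt (by simp)
  have hinv : ∀ q ∈ U, ∀ f, Ring.inverse (G (φ q)) (G (φ q) f) = f := fun q hq f ↦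
    congrArg (fun L : F →L[ℝ] F ↦ L f) (Ring.inverse_mul_cancel _ (hG _ hq.2).1)
  have hinv' : ∀ q ∈ U, ∀ f, G (φ q) (Ring.inverse (G (φ q)) f) = f := fun q hq f ↦
    congrArg (fun L : F →L[ℝ] F ↦ L f) (Ring.mul_inverse_cancel _ (hG _ hq.2).1)
  have hchart : ∀ q ∈ U, ContMDiffAt (𝓡 m) 𝓘(ℝ, EuclideanSpace ℝ (Fin m)) ∞ φ q :=
    fun q hq ↦ contMDiffAt_extChartAt' (hNc hq.1)
  let sec : F → Π q, V q := fun f q ↦ e.symmL ℝ q (G (φ q) f)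
  let coord : Π q, V q → F := fun q v ↦ Ring.inverse (G (φ q)) (e.continuousLinearMapAt ℝ q v)
  have hsecc : ∀ f, ∀ q ∈ U, sectionCoord e (sec f) q = G (φ q) f := fun f q hq ↦
    e.continuousLinearMapAt_symmL (hNe hq.1) _
  have hsecev : ∀ f, ∀ q ∈ U, sectionCoord e (sec f) =ᶠ[𝓝 q] fun p ↦ G (φ p) f := fun f q hq ↦ by
    filter_upwards [hU.mem_nhds hq] with p hp using hsecc f p hp
  have hsm : ∀ f, ∀ q ∈ U, ContMDiffAt (𝓡 m) ((𝓡 m).prod 𝓘(ℝ, F)) ∞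
      (fun q ↦ TotalSpace.mk' F q (sec f q)) q := by
    intro f q hq
    refine (contMDiffAt_sectionCoord_iff e (hNe hq.1)).1 ?_
    refine ContMDiffAt.congr_of_eventuallyEq ?_ (hsecev f q hq)
    have h1 : ContDiffAt ℝ ∞ (fun y ↦ G y f) (φ q) :=
      (hGs.contDiffAt (hs.mem_nhds hq.2)).clm_apply contDiffAt_const
    exact ContMDiffAt.comp q h1.contMDiffAt (hchart q hq)
  have hcoord : ∀ q ∈ U, ∀ τ : Π p, V p,
      MDifferentiableAt (𝓡 m) ((𝓡 m).prod 𝓘(ℝ, F)) (fun q ↦ TotalSpace.mk' F q (τ q)) q →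
      MDifferentiableAt (𝓡 m) 𝓘(ℝ, F) (fun p ↦ coord p (τ p)) q := by
    intro q hq τ hτ
    have h1 := (mdifferentiableAt_sectionCoord_iff e (hNe hq.1)).2 hτ
    have h2 : DifferentiableAt ℝ (fun y ↦ Ring.inverse (G y)) (φ q) :=
      (differentiableAt_inverse (hG _ hq.2).1).comp (φ q) (hGd q hq)
    have h3 : MDifferentiableAt (𝓡 m) 𝓘(ℝ, F →L[ℝ] F) (fun p ↦ Ring.inverse (G (φ p))) q :=
      h2.comp_mdifferentiableAt ((hchart q hq).mdifferentiableAt (by simp))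
    exact h3.clm_apply h1
  refine ⟨U, hU, ⟨hpN, hps⟩, ⟨⟨coord, sec, ?_, ?_, ?_, hcoord, ?_⟩⟩⟩
  · intro q hq v
    simp only [sec, coord]
    rw [hinv' q hq, e.symmL_continuousLinearMapAt (hNe hq.1)]
  · intro q hq f
    simp only [sec, coord]
    rw [e.continuousLinearMapAt_symmL (hNe hq.1), hinv q hq]
  · refine fun f ↦ ⟨fun q hq ↦ (hsm f q hq).contMDiffWithinAt, fun q hq ↦ ?_⟩
    ext v
    have h1 := hD q hq.1 (sec f) ((hsm f q hq).mdifferentiableAt (by simp)) v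
    rw [mvfderiv_congr (hsecev f q hq), hsecc f q hq] at h1
    have h2 : DifferentiableAt ℝ (fun y ↦ G y f) (φ q) :=
      (hGd q hq).clm_apply (differentiableAt_const f)
    have h3 := mvfderiv_comp_extChartAt p₀ (hNc hq.1) h2 v
    have h4 : ∀ u, fderiv ℝ (fun y ↦ G y f) (φ q) u = -(A (φ q) u (G (φ q) f)) := by
      intro u
      have h5 : HasFDerivAt (fun y ↦ G y f) _ (φ q) :=
        (hGd q hq).hasFDerivAt.clm_apply (hasFDerivAt_const f _)
      have h6 := congrArg (fun L : F →L[ℝ] F ↦ L f) ((hG _ hq.2).2 u)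
      rw [h5.fderiv]
      simpa using h6
    rw [h3, ← hφ] at h1
    have h7 : e.continuousLinearMapAt ℝ q (E.D (sec f) q v) = 0 := by
      rw [h1]
      refine (congrArg₂ (· + ·) (h4 _) rfl).trans ?_
      exact neg_add_cancel _
    rw [← e.symmL_continuousLinearMapAt (R := ℝ) (hNe hq.1) (E.D (sec f) q v), h7]
    simp
  · intro q hq τ hτ v hv
    have hk : MDifferentiableAt (𝓡 m) 𝓘(ℝ, F) (fun p ↦ coord p (τ p)) q := hcoord q hq τ hτ
    have hτ' := (mdifferentiableAt_sectionCoord_iff e (hNe hq.1)).2 hτ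
    have h1 := hD q hq.1 τ hτ v
    rw [hv, map_zero] at h1
    -- differentiate `e τ = G (coord τ)` in the chart
    obtain ⟨u, hu⟩ : ∃ u : EuclideanSpace ℝ (Fin m), coordField p₀ u q = v :=
      ⟨_, coordField_mfderiv p₀ (hNc hq.1) v⟩
    have hev : (sectionCoord e τ ∘ φ.symm) =ᶠ[𝓝 (φ q)]
        fun y ↦ G y (((fun p ↦ coord p (τ p)) ∘ φ.symm) y) := by
      have hOU : φ.target ∩ φ.symm ⁻¹' U ∈ 𝓝 (φ q) :=
        ((continuousOn_extChartAt_symm (I := 𝓡 m) p₀).isOpen_inter_preimage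
          (isOpen_extChartAt_target p₀) hU).mem_nhds
          ⟨φ.map_source (hNs hq.1), by rw [mem_preimage, hleft q hq.1]; exact hq⟩
      filter_upwards [hOU] with y hy
      have h2 := hinv' _ hy.2 (e.continuousLinearMapAt ℝ (φ.symm y) (τ (φ.symm y)))
      rw [φ.right_inv hy.1] at h2
      simp only [Function.comp_apply, coord, sectionCoord, φ.right_inv hy.1]
      exact h2.symm
    have hkd := differentiableAt_comp_extChartAt_symm p₀ (hNc hq.1) hk
    have h3 : HasFDerivAt (fun y ↦ G y (((fun p ↦ coord p (τ p)) ∘ φ.symm) y)) _ (φ q) :=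
      (hGd q hq).hasFDerivAt.clm_apply hkd.hasFDerivAt
    have h4 := mvfderiv_coordField p₀ (hNc hq.1) hτ' u
    rw [← hφ, hev.fderiv_eq, h3.fderiv] at h4
    have h5 : mfderiv (𝓡 m) 𝓘(ℝ, EuclideanSpace ℝ (Fin m)) φ q v = u := by
      rw [← hu]; exact mfderiv_coordField p₀ (hNc hq.1) u
    have h6 : sectionCoord e τ q = G (φ q) (coord q (τ q)) := (hinv' q hq _).symm
    rw [hu] at h4
    rw [h4, h5, h6] at h1
    have h7 : fderiv ℝ G (φ q) u (coord q (τ q)) = -(A (φ q) u (G (φ q) (coord q (τ q)))) :=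
      congrArg (fun L : F →L[ℝ] F ↦ L (coord q (τ q))) ((hG _ hq.2).2 u)
    have h8 : G (φ q) (fderiv ℝ ((fun p ↦ coord p (τ p)) ∘ φ.symm) (φ q) u) = 0 := by
      have h9 : (0 : F) = G (φ q) (fderiv ℝ ((fun p ↦ coord p (τ p)) ∘ φ.symm) (φ q) u)
          + fderiv ℝ G (φ q) u (coord (φ.symm (φ q)) (τ (φ.symm (φ q))))
          + A (φ q) u (G (φ q) (coord q (τ q))) := h1
      rw [hleft q hq.1, h7, neg_add_cancel_right] at h9
      exact h9.symm
    rw [← hu, mvfderiv_coordField p₀ (hNc hq.1) hk u, ← hφ, ← hinv q hq (fderiv ℝ _ (φ q) u), h8,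
      map_zero]

end Frame
end FlatConnection

namespace FlatConnection

section Frame

variable {m : ℕ} {M : Type*} [TopologicalSpace M]
    [ChartedSpace (EuclideanSpace ℝ (Fin m)) M] [IsManifold (𝓡 m) ∞ M]
    {F : Type*} [NormedAddCommGroup F] [NormedSpace ℂ F]
    {V : M → Type*} [TopologicalSpace (TotalSpace F V)]
    [∀ p, AddCommGroup (V p)] [∀ p, Module ℂ (V p)] [∀ p, TopologicalSpace (V p)]
    [∀ p, IsTopologicalAddGroup (V p)] [∀ p, ContinuousSMul ℝ (V p)]
    [FiberBundle F V] [VectorBundle ℝ F V]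
    [ContMDiffVectorBundle ∞ F V (𝓡 m)]
    {E : FlatConnection m M F V}

/-- Flat sections have locally constant coordinates in a flat frame. -/
lemma FlatFrame.eventually_eq_sec {U W : Set M} (Φ : E.FlatFrame U) (hU : IsOpen U)
    (hW : IsOpen W) {τ : Π p, V p} (hτ : E.IsFlatOn W τ) {q : M} (hqU : q ∈ U) (hqW : q ∈ W) :
    ∀ᶠ p in 𝓝 q, τ p = Φ.sec (Φ.coord q (τ q)) p := by
  have hd : ∀ p ∈ W, MDifferentiableAt (𝓡 m) ((𝓡 m).prod 𝓘(ℝ, F))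
      (fun q ↦ TotalSpace.mk' F q (τ q)) p := fun p hp ↦
    ((hτ.1 p hp).contMDiffAt (hW.mem_nhds hp)).mdifferentiableAt (by simp)
  have h : ∀ᶠ p in 𝓝 q, Φ.coord p (τ p) = Φ.coord q (τ q) := by
    refine eventually_eq_of_mvfderiv_eq_zero (m := m) (h := fun p ↦ Φ.coord p (τ p)) ?_
    filter_upwards [hU.mem_nhds hqU, hW.mem_nhds hqW] with p hpU hpW
    refine ⟨Φ.mdifferentiableAt p hpU τ (hd p hpW), ?_⟩
    ext v
    exact Φ.mvfderiv_eq_zero p hpU τ (hd p hpW) v (by rw [hτ.2 p hpW]; rfl)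
  filter_upwards [h, hU.mem_nhds hqU] with p hp hpU
  rw [← hp, Φ.sec_coord p hpU]

/-- Along an integral curve of `v`, a section whose covariant derivative in the direction `v`
vanishes has locally constant coordinates in a flat frame. -/
lemma FlatFrame.eventually_eq_sec_of_integralCurve {U W : Set M} (Φ : E.FlatFrame U)
    (hU : IsOpen U) (hW : IsOpen W) {v : Π p : M, TangentSpace (𝓡 m) p} {τ : Π p, V p}
    (hτ : ContMDiffOn (𝓡 m) ((𝓡 m).prod 𝓘(ℝ, F)) ∞ (fun q ↦ TotalSpace.mk' F q (τ q)) W)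
    (hτv : ∀ p ∈ W, E.D τ p (v p) = 0) {γ : ℝ → M} (hγ : IsMIntegralCurve γ v) {t₀ : ℝ}
    (h0U : γ t₀ ∈ U) (h0W : γ t₀ ∈ W) :
    ∀ᶠ t in 𝓝 t₀, τ (γ t) = Φ.sec (Φ.coord (γ t₀) (τ (γ t₀))) (γ t) := by
  have hd : ∀ p ∈ W, MDifferentiableAt (𝓡 m) ((𝓡 m).prod 𝓘(ℝ, F))
      (fun q ↦ TotalSpace.mk' F q (τ q)) p := fun p hp ↦
    ((hτ p hp).contMDiffAt (hW.mem_nhds hp)).mdifferentiableAt (by simp)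
  have hcont := hγ.continuous
  have hopen : IsOpen (γ ⁻¹' (U ∩ W)) := (hU.inter hW).preimage hcont
  obtain ⟨ε, hε, hball⟩ := Metric.isOpen_iff.1 hopen t₀ ⟨h0U, h0W⟩
  let k : M → F := fun p ↦ Φ.coord p (τ p)
  have hk : ∀ t ∈ Metric.ball t₀ ε, HasDerivAt (k ∘ γ) 0 t := by
    intro t ht
    have hk1 := Φ.mdifferentiableAt _ (hball ht).1 τ (hd _ (hball ht).2)
    have h0 := Φ.mvfderiv_eq_zero _ (hball ht).1 τ (hd _ (hball ht).2) (v (γ t)) (hτv _ (hball ht).2)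
    let L : ℝ →L[ℝ] F := (mvfderiv (𝓡 m) k (γ t)).comp ((1 : ℝ →L[ℝ] ℝ).smulRight (v (γ t)))
    have hc : HasFDerivAt (k ∘ γ) L t :=
      (HasMFDerivAt.comp t hk1.hasMFDerivAt (hγ t)).hasFDerivAt
    have hL : L 1 = 0 :=
      (congrArg (mvfderiv (𝓡 m) k (γ t)) (one_smul ℝ (v (γ t)))).trans h0
    have hc' := hc.hasDerivAt
    rwa [hL] at hc'
  have hconst : ∀ t ∈ Metric.ball t₀ ε, (k ∘ γ) t = (k ∘ γ) t₀ := by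
    intro t ht
    refine (convex_ball t₀ ε).is_const_of_fderivWithin_eq_zero (𝕜 := ℝ)
      (fun z hz ↦ (hk z hz).differentiableAt.differentiableWithinAt) (fun z hz ↦ ?_) ht
      (Metric.mem_ball_self hε)
    rw [fderivWithin_of_isOpen Metric.isOpen_ball hz, (hk z hz).hasFDerivAt.fderiv]
    ext
    simp
  filter_upwards [Metric.ball_mem_nhds t₀ hε] with t ht
  have := hconst t ht
  simp only [Function.comp_apply, k] at this
  rw [← this, Φ.sec_coord _ (hball ht).1]

end Frame
end FlatConnection

/-! ### Flows on compact manifolds -/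

section Flow

variable {m : ℕ} {M : Type*} [TopologicalSpace M]
  [ChartedSpace (EuclideanSpace ℝ (Fin m)) M] [IsManifold (𝓡 m) ∞ M]
  {v : Π p : M, TangentSpace (𝓡 m) p}

/-- A smooth vector field has a local flow near every point. -/
lemma VecField.exists_local_flow (hv : VecField.IsSmooth v) (p₀ : M) :
    ∃ W ∈ 𝓝 p₀, ∃ ε > (0 : ℝ), ∃ α : M × ℝ → M,
      (∀ p ∈ W, α (p, 0) = p ∧ IsMIntegralCurveOn (fun t ↦ α (p, t)) v (Ioo (-ε) ε)) ∧
      ContinuousOn α (W ×ˢ Ioo (-ε) ε) := by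
  set φ := extChartAt (𝓡 m) p₀ with hφ
  -- the vector field in the chart
  let w : EuclideanSpace ℝ (Fin m) → EuclideanSpace ℝ (Fin m) := fun y ↦
    mfderiv (𝓡 m) 𝓘(ℝ, EuclideanSpace ℝ (Fin m)) φ (φ.symm y) (v (φ.symm y))
  have hw : ContDiffAt ℝ 1 w (φ p₀) := by
    let e := trivializationAt (EuclideanSpace ℝ (Fin m)) (TangentSpace (𝓡 m) : M → Type _) p₀
    have h1 : ContMDiffAt (𝓡 m) 𝓘(ℝ, EuclideanSpace ℝ (Fin m)) ∞
        (fun q ↦ (e ⟨q, v q⟩).2) p₀ :=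
      (e.contMDiffAt_section_iff (FiberBundle.mem_baseSet_trivializationAt' p₀)).1 (hv p₀)
    have h2 : ContMDiffAt 𝓘(ℝ, EuclideanSpace ℝ (Fin m)) 𝓘(ℝ, EuclideanSpace ℝ (Fin m)) ∞
        ((fun q ↦ (e ⟨q, v q⟩).2) ∘ φ.symm) (φ p₀) := by
      refine ContMDiffAt.comp (I' := 𝓡 m) _ ?_ ?_
      · rwa [extChartAt_to_inv]
      · exact (contMDiffOn_extChartAt_symm p₀).contMDiffAt (extChartAt_target_mem_nhds p₀)
    refine (h2.contDiffAt.of_le (by simp)).congr_of_eventuallyEq ?_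
    filter_upwards [extChartAt_target_mem_nhds (I := 𝓡 m) p₀] with y hy
    have hs : φ.symm y ∈ (chartAt (EuclideanSpace ℝ (Fin m)) p₀).source := by
      have := φ.map_target hy
      rwa [hφ, extChartAt_source] at this
    have h3 := TangentBundle.continuousLinearMapAt_trivializationAt (I := 𝓡 m) hs
    have h4 := congrArg (fun L : EuclideanSpace ℝ (Fin m) →L[ℝ] EuclideanSpace ℝ (Fin m) ↦
      L (v (φ.symm y))) h3
    refine h4.symm.trans ?_
    exact e.continuousLinearMapAt_apply_of_mem ℝ (by simpa [e] using hs) _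
  obtain ⟨ε, hε, a, r, L, K, hr, hpl⟩ := IsPicardLindelof.of_contDiffAt_one hw
  obtain ⟨α, hα, hαc⟩ :=
    (hpl 0).exists_forall_mem_closedBall_eq_hasDerivWithinAt_continuousOn
  have hdom : Metric.closedBall (φ p₀) r ×ˢ Icc (0 - ε) (0 + ε) ∈ 𝓝 (φ p₀, (0 : ℝ)) :=
    prod_mem_nhds (Metric.closedBall_mem_nhds _ hr) (Icc_mem_nhds (by linarith) (by linarith))
  have h0 : α (φ p₀, 0) = φ p₀ := (hα _ (Metric.mem_closedBall_self r.2)).1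
  have htar : ∀ᶠ z in 𝓝 (φ p₀, (0 : ℝ)), α z ∈ φ.target ∧
      z ∈ Metric.closedBall (φ p₀) r ×ˢ Icc (0 - ε) (0 + ε) := by
    have h1 := (hαc.continuousAt hdom).eventually (p := fun y ↦ y ∈ φ.target) (by
      rw [h0]; exact extChartAt_target_mem_nhds p₀)
    filter_upwards [h1, hdom] with z hz hz' using ⟨hz, hz'⟩
  rw [nhds_prod_eq, Filter.eventually_prod_iff] at htar
  obtain ⟨P, hP, Q, hQ, hPQ⟩ := htar
  obtain ⟨δ, hδ, hball⟩ := Metric.eventually_nhds_iff_ball.1 hQ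
  rw [Real.ball_eq_Ioo, zero_sub, zero_add] at hball
  refine ⟨{p | p ∈ φ.source ∧ P (φ p)}, ?_, min δ ε, lt_min hδ hε,
    fun z ↦ φ.symm (α (φ z.1, z.2)), ?_, ?_⟩
  · filter_upwards [extChartAt_source_mem_nhds (I := 𝓡 m) p₀,
      (continuousAt_extChartAt (I := 𝓡 m) p₀).eventually hP] with p h1 h2 using ⟨h1, h2⟩
  · rintro p ⟨hps, hpP⟩
    have hpt := fun t ht ↦ hPQ hpP (hball t ht)
    refine ⟨?_, ?_⟩
    · have h1 := (hα (φ p) (hpt 0 ⟨by linarith, hδ⟩).2.1).1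
      simp only
      rw [h1, φ.left_inv hps]
    · rintro t ⟨ht1, ht2⟩
      have ht1' : -δ < t := lt_of_le_of_lt (neg_le_neg (min_le_left _ _)) ht1
      have ht1'' : -ε < t := lt_of_le_of_lt (neg_le_neg (min_le_right _ _)) ht1
      have ht2' : t < δ := ht2.trans_le (min_le_left _ _)
      have ht2'' : t < ε := ht2.trans_le (min_le_right _ _)
      obtain ⟨h1, h2⟩ := hpt t ⟨ht1', ht2'⟩
      have h3 := ((hα (φ p) h2.1).2 t h2.2).hasDerivAt
        (Icc_mem_nhds (by linarith) (by linarith))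
      set y := α (φ p, t) with hy
      have hs : φ.symm y ∈ (chartAt (EuclideanSpace ℝ (Fin m)) p₀).source := by
        have := φ.map_target h1
        rwa [hφ, extChartAt_source] at this
      have h4 : HasMFDerivAt 𝓘(ℝ, ℝ) 𝓘(ℝ, EuclideanSpace ℝ (Fin m)) (fun t ↦ α (φ p, t)) t
        ((1 : ℝ →L[ℝ] ℝ).smulRight (w y)) := h3.hasFDerivAt.hasMFDerivAt
      have h5 : MDifferentiableAt 𝓘(ℝ, EuclideanSpace ℝ (Fin m)) (𝓡 m) φ.symm y := by
        have := mdifferentiableAt_extChartAt_symm' p₀ hs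
        rwa [← hφ, φ.right_inv h1] at this
      have h6 := HasMFDerivAt.comp t h5.hasMFDerivAt h4
      refine HasMFDerivAt.hasMFDerivWithinAt ?_
      have h7 := mfderivWithin_extChartAt_symm_comp_mfderiv_extChartAt (I := 𝓡 m) (x := p₀) h1
      rw [(𝓡 m).range_eq_univ, mfderivWithin_univ] at h7
      have h8 : mfderiv 𝓘(ℝ, EuclideanSpace ℝ (Fin m)) (𝓡 m) φ.symm y (w y) = v (φ.symm y) :=
        congrArg (fun L : EuclideanSpace ℝ (Fin m) →L[ℝ] EuclideanSpace ℝ (Fin m) ↦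
          L (v (φ.symm y))) h7
      refine h6.congr_mfderiv ?_
      have h9 : ∀ c : ℝ, mfderiv 𝓘(ℝ, EuclideanSpace ℝ (Fin m)) (𝓡 m) φ.symm y (c • w y) =
          c • v (φ.symm y) := fun c ↦ (map_smul
        (mfderiv 𝓘(ℝ, EuclideanSpace ℝ (Fin m)) (𝓡 m) φ.symm y) c (w y)).trans
          (congrArg (c • ·) h8)
      exact ContinuousLinearMap.ext (M₁ := ℝ) (M₂ := EuclideanSpace ℝ (Fin m)) h9
  · have hmaps : ∀ z ∈ {p | p ∈ φ.source ∧ P (φ p)} ×ˢ Ioo (-min δ ε) (min δ ε),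
        α (φ z.1, z.2) ∈ φ.target ∧
        (φ z.1, z.2) ∈ Metric.closedBall (φ p₀) r ×ˢ Icc (0 - ε) (0 + ε) := by
      rintro ⟨p, t⟩ ⟨⟨hps, hpP⟩, ht1, ht2⟩
      exact hPQ hpP (hball t ⟨lt_of_le_of_lt (neg_le_neg (min_le_left _ _)) ht1,
        ht2.trans_le (min_le_left _ _)⟩)
    have hcomp : ContinuousOn (fun z : M × ℝ ↦ (φ z.1, z.2))
        ({p | p ∈ φ.source ∧ P (φ p)} ×ˢ Ioo (-min δ ε) (min δ ε)) := ?_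
    · exact (continuousOn_extChartAt_symm (I := 𝓡 m) p₀).comp
        (hαc.comp hcomp fun z hz ↦ (hmaps z hz).2) fun z hz ↦ (hmaps z hz).1
    exact ((continuousOn_extChartAt (I := 𝓡 m) p₀).comp continuousOn_fst
      fun z hz ↦ hz.1.1).prodMk continuousOn_snd

variable [T2Space M] [CompactSpace M]

/-- The integral curves of a smooth vector field on a compact manifold form a flow. -/
lemma VecField.exists_flow (hv : VecField.IsSmooth v) :
    ∃ Ψ : Flow ℝ M, ∀ p, IsMIntegralCurve (fun t ↦ Ψ t p) v := by
  have hv1 : ContMDiff (𝓡 m) (𝓡 m).tangent 1 (fun p ↦ (⟨p, v p⟩ : TangentBundle (𝓡 m) M)) :=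
    ContMDiff.of_le hv (by simp)
  choose W hW ε hε α hα hαc using VecField.exists_local_flow hv
  -- a uniform existence time
  obtain ⟨T, -, hT⟩ := isCompact_univ.elim_nhds_subcover (fun p ↦ interior (W p))
    fun p _ ↦ interior_mem_nhds.2 (hW p)
  obtain ⟨δ, hδ, hδε⟩ : ∃ δ > 0, ∀ p ∈ T, δ ≤ ε p := by
    rcases T.eq_empty_or_nonempty with rfl | hne
    · exact ⟨1, one_pos, by simp⟩
    · obtain ⟨p, hp, h⟩ := T.exists_min_image ε hne
      exact ⟨ε p, hε p, h⟩
  have hcov : ∀ p, ∃ q ∈ T, p ∈ interior (W q) := fun p ↦ by simpa using hT (mem_univ p)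
  have hex : ∀ p, ∃ γ : ℝ → M, γ 0 = p ∧ IsMIntegralCurve γ v := by
    refine exists_isMIntegralCurve_of_isMIntegralCurveOn hv1 hδ fun p ↦ ?_
    obtain ⟨q, hq, hpq'⟩ := hcov p
    have hpq := interior_subset hpq'
    exact ⟨_, (hα q p hpq).1, (hα q p hpq).2.mono
      (Ioo_subset_Ioo (neg_le_neg (hδε q hq)) (hδε q hq))⟩
  choose Ψ hΨ0 hΨ using hex
  have hadd : ∀ s t p, Ψ p (s + t) = Ψ (Ψ p t) s := by
    intro s t p
    have := isMIntegralCurve_Ioo_eq_of_contMDiff_boundaryless (t₀ := 0) hv1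
      ((hΨ p).comp_add t) (hΨ (Ψ p t)) (by simp [hΨ0])
    exact congrFun this s
  have hloc : ∀ p, ∀ q ∈ T, p ∈ W q → ∀ t ∈ Ioo (-δ) δ, Ψ p t = α q (p, t) := by
    intro p q hq hpq
    have hsub := Ioo_subset_Ioo (neg_le_neg (hδε q hq)) (hδε q hq)
    exact isMIntegralCurveOn_Ioo_eqOn_of_contMDiff_boundaryless (t₀ := 0) ⟨by linarith, hδ⟩ hv1
      ((hΨ p).isMIntegralCurveOn _) ((hα q p hpq).2.mono hsub) (by simp [hΨ0, (hα q p hpq).1])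
  have hcloc : ∀ p, ∀ t ∈ Ioo (-δ) δ, ContinuousAt (fun z : M × ℝ ↦ Ψ z.1 z.2) (p, t) := by
    intro p t ht
    obtain ⟨q, hq, hpq⟩ := hcov p
    have hsub := Ioo_subset_Ioo (neg_le_neg (hδε q hq)) (hδε q hq)
    have hn : W q ×ˢ Ioo (-ε q) (ε q) ∈ 𝓝 (p, t) :=
      prod_mem_nhds (mem_interior_iff_mem_nhds.1 hpq) (isOpen_Ioo.mem_nhds (hsub ht))
    refine ((hαc q).continuousAt hn).congr ?_
    filter_upwards [prod_mem_nhds (mem_interior_iff_mem_nhds.1 hpq) (isOpen_Ioo.mem_nhds ht)]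
      with z hz
    exact (hloc z.1 q hq hz.1 z.2 hz.2).symm
  have hc1 : ∀ t ∈ Ioo (-δ) δ, Continuous fun p ↦ Ψ p t := fun t ht ↦
    continuous_iff_continuousAt.2 fun p ↦ ContinuousAt.comp (f := fun p ↦ (p, t))
      (g := fun z : M × ℝ ↦ Ψ z.1 z.2) (hcloc p t ht) (by fun_prop)
  have hc2 : ∀ (k : ℕ), ∀ t ∈ Ioo (-δ) δ, Continuous fun p ↦ Ψ p (k * t) := by
    intro k t ht
    induction k with
    | zero => simpa [hΨ0] using continuous_id'
    | succ k ih =>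
      have : (fun p ↦ Ψ p ((k + 1 : ℕ) * t)) = fun p ↦ Ψ (Ψ p t) (k * t) := by
        funext p
        rw [← hadd]
        congr 1
        push_cast
        ring
      rw [this]
      exact ih.comp (hc1 t ht)
  have hc3 : ∀ t, Continuous fun p ↦ Ψ p t := by
    intro t
    obtain ⟨k, hk⟩ := exists_nat_gt (|t| / δ)
    have hk0 : (0 : ℝ) < k := lt_of_le_of_lt (by positivity) hk
    have h1 : t / k ∈ Ioo (-δ) δ := by
      rw [mem_Ioo, ← abs_lt, abs_div, Nat.abs_cast, div_lt_iff₀ hk0, mul_comm]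
      exact (div_lt_iff₀ hδ).1 hk
    have := hc2 k _ h1
    rwa [mul_div_cancel₀ _ hk0.ne'] at this
  refine ⟨⟨fun t p ↦ Ψ p t, ?_, fun s t p ↦ hadd s t p, hΨ0⟩, hΨ⟩
  rw [continuous_iff_continuousAt]
  rintro ⟨t₀, p⟩
  have h1 : Function.uncurry (fun t p ↦ Ψ p t) = fun z : ℝ × M ↦ Ψ (Ψ z.2 (z.1 - t₀)) t₀ := by
    funext ⟨t, q⟩
    rw [← hadd]
    simp
  rw [h1]
  refine (hc3 t₀).continuousAt.comp ?_
  refine ContinuousAt.comp (f := fun z : ℝ × M ↦ (z.2, z.1 - t₀))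
      (g := fun z : M × ℝ ↦ Ψ z.1 z.2) ?_ (by fun_prop)
  exact hcloc _ _ (by simp [hδ])

end Flow

namespace SasakianStructure

variable {n : ℕ} {M : Type*} [TopologicalSpace M]
  [ChartedSpace (EuclideanSpace ℝ (Fin (2 * n + 1))) M] [IsManifold (𝓡 (2 * n + 1)) ∞ M]
  [T2Space M] [CompactSpace M] (S : SasakianStructure n M)

lemma exists_flow_eq_reebFlow : ∃ Ψ : Flow ℝ M, (∀ t p, S.reebFlow t p = Ψ t p) ∧
    ∀ p, IsMIntegralCurve (I := 𝓡 (2 * n + 1)) (fun t ↦ Ψ t p) S.ξ := by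
  obtain ⟨Ψ, hΨ⟩ := VecField.exists_flow S.smooth_ξ
  refine ⟨Ψ, fun t p ↦ ?_, hΨ⟩
  have h : ∃ γ : ℝ → M, γ 0 = p ∧ IsMIntegralCurve (I := 𝓡 (2 * n + 1)) γ S.ξ :=
    ⟨_, Ψ.map_zero_apply p, hΨ p⟩
  rw [reebFlow, dif_pos h]
  have hv1 : ContMDiff (𝓡 (2 * n + 1)) (𝓡 (2 * n + 1)).tangent 1
      (fun p ↦ (⟨p, S.ξ p⟩ : TangentBundle (𝓡 (2 * n + 1)) M)) :=
    ContMDiff.of_le S.smooth_ξ (by simp)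
  exact congrFun (isMIntegralCurve_Ioo_eq_of_contMDiff_boundaryless (t₀ := 0) hv1
    h.choose_spec.2 (hΨ p) (h.choose_spec.1.trans (Ψ.map_zero_apply p).symm)) t

/-- The Reeb flow of a compact Sasakian manifold. -/
def flow : Flow ℝ M := S.exists_flow_eq_reebFlow.choose

lemma reebFlow_eq_flow (t : ℝ) (p : M) : S.reebFlow t p = S.flow t p :=
  S.exists_flow_eq_reebFlow.choose_spec.1 t p

lemma isMIntegralCurve_flow (p : M) :
    IsMIntegralCurve (I := 𝓡 (2 * n + 1)) (fun t ↦ S.flow t p) S.ξ :=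
  S.exists_flow_eq_reebFlow.choose_spec.2 p

lemma period_pos_of_regular {x : M} (hx : x ∈ S.regularPoints) : 0 < S.period := hx.1.1

/-- The Reeb flow is the identity at the period, as an infimum of times at which it is. The infimum
is not the junk value `0` of an empty set, because it is positive. -/
lemma flow_period_of_regular {x : M} (hx : x ∈ S.regularPoints) (p : M) :
    S.flow S.period p = p := by
  set A := {t : ℝ | 0 < t ∧ ∀ p : M, S.reebFlow t p = p} with hA
  have hpos : 0 < sInf A := hx.1.1
  have hne : A.Nonempty := by
    by_contra h
    rw [not_nonempty_iff_eq_empty.1 h, Real.sInf_empty] at hpos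
    exact lt_irrefl _ hpos
  have hmem : sInf A ∈ closure A := csInf_mem_closure hne ⟨0, fun t ht ↦ ht.1.le⟩
  have hclosed : IsClosed {t : ℝ | S.flow t p = p} :=
    isClosed_eq (S.flow.continuous continuous_id continuous_const) continuous_const
  exact hclosed.closure_subset_iff.2 (fun t ht ↦ (S.reebFlow_eq_flow t p).symm.trans (ht.2 p)) hmem

lemma flow_nat_mul_period {x : M} (hx : x ∈ S.regularPoints) (k : ℕ) (p : M) :
    S.flow (k * S.period) p = p := by
  induction k with
  | zero => simp
  | succ k ih =>
    rw [Nat.cast_succ, add_one_mul, S.flow.map_add, S.flow_period_of_regular hx, ih]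

/-- The Reeb loop at a regular point. -/
def orbitLoop {x : M} (hx : x ∈ S.regularPoints) : Path x x where
  toFun t := S.flow (t * S.period) x
  continuous_toFun := S.flow.continuous (by fun_prop) continuous_const
  source' := by simp
  target' := by simp [S.flow_period_of_regular hx]

end SasakianStructure

/-! ### The covering space of germs of flat sections -/

/-- A copy of the model fibre with the discrete topology, as the fibre of a covering space. -/
def DiscreteFiber (F : Type*) : Type _ := F

instance (F : Type*) : TopologicalSpace (DiscreteFiber F) := ⊥

instance (F : Type*) : DiscreteTopology (DiscreteFiber F) := ⟨rfl⟩

namespace FlatConnection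

section FlatSpace

variable {m : ℕ} {M : Type*} [TopologicalSpace M]
    [ChartedSpace (EuclideanSpace ℝ (Fin m)) M] [IsManifold (𝓡 m) ∞ M]
    {F : Type*} [NormedAddCommGroup F] [NormedSpace ℂ F]
    {V : M → Type*} [TopologicalSpace (TotalSpace F V)]
    [∀ p, AddCommGroup (V p)] [∀ p, Module ℂ (V p)] [∀ p, TopologicalSpace (V p)]
    [∀ p, IsTopologicalAddGroup (V p)] [∀ p, ContinuousSMul ℝ (V p)]
    [FiberBundle F V] [VectorBundle ℝ F V]
    [ContMDiffVectorBundle ∞ F V (𝓡 m)]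
    (E : FlatConnection m M F V)

/-- The space of germs of flat sections: the total space of the bundle, with the finest topology
for which all local flat sections are continuous. -/
def FlatSpace (_E : FlatConnection m M F V) : Type _ := TotalSpace F V

/-- The projection of the space of germs of flat sections. -/
def FlatSpace.proj (e : E.FlatSpace) : M := TotalSpace.proj (F := F) (E := V) e

/-- The point of the space of germs of flat sections given by a vector. -/
def FlatSpace.mk (p : M) (v : V p) : E.FlatSpace := TotalSpace.mk' F p v

instance : TopologicalSpace E.FlatSpace where
  IsOpen A := ∀ (W : Set M) (s : Π p, V p), IsOpen W → E.IsFlatOn W s →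
    IsOpen {q | q ∈ W ∧ FlatSpace.mk E q (s q) ∈ A}
  isOpen_univ W s hW _ := by simpa using hW
  isOpen_inter A B hA hB W s hW hs := by
    have : {q | q ∈ W ∧ FlatSpace.mk E q (s q) ∈ A ∩ B} =
        {q | q ∈ W ∧ FlatSpace.mk E q (s q) ∈ A} ∩ {q | q ∈ W ∧ FlatSpace.mk E q (s q) ∈ B} := by
      ext q
      simp only [mem_inter_iff, mem_ofPred_eq]
      tauto
    rw [this]
    exact (hA W s hW hs).inter (hB W s hW hs)
  isOpen_sUnion T hT W s hW hs := by
    have : {q | q ∈ W ∧ FlatSpace.mk E q (s q) ∈ ⋃₀ T} =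
        ⋃ A ∈ T, {q | q ∈ W ∧ FlatSpace.mk E q (s q) ∈ A} := by
      ext q
      simp only [mem_ofPred_eq, mem_sUnion, mem_iUnion]
      tauto
    rw [this]
    exact isOpen_biUnion fun A hA ↦ hT A hA W s hW hs

variable {E}

lemma FlatSpace.continuous_proj : Continuous (FlatSpace.proj E) :=
  ⟨fun _ hO _ _ hW _ ↦ hW.inter hO⟩

lemma IsFlatOn.continuousOn_mk {W : Set M} {s : Π p, V p} (hs : E.IsFlatOn W s) (hW : IsOpen W) :
    ContinuousOn (fun q ↦ FlatSpace.mk E q (s q)) W :=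
  (continuousOn_open_iff hW).2 fun _ hA ↦ hA W s hW hs

/-- A flat frame trivializes the space of germs of flat sections. -/
def FlatFrame.trivialization {U : Set M} (Φ : E.FlatFrame U) (hU : IsOpen U) :
    Trivialization (DiscreteFiber F) (FlatSpace.proj E) where
  toFun e := (FlatSpace.proj E e, Φ.coord (FlatSpace.proj E e) e.2)
  invFun z := FlatSpace.mk E z.1 (Φ.sec z.2 z.1)
  source := FlatSpace.proj E ⁻¹' U
  target := U ×ˢ univ
  baseSet := U
  map_source' e he := ⟨he, mem_univ _⟩
  map_target' z hz := hz.1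
  left_inv' e he := by
    obtain ⟨q, v⟩ := e
    exact congrArg (FlatSpace.mk E q) (Φ.sec_coord q he v)
  right_inv' z hz := Prod.ext rfl (Φ.coord_sec z.1 hz.1 z.2)
  open_source := hU.preimage FlatSpace.continuous_proj
  open_target := hU.prod isOpen_univ
  open_baseSet := hU
  source_eq := rfl
  target_eq := rfl
  proj_toFun _ _ := rfl
  continuousOn_toFun := by
    refine FlatSpace.continuous_proj.continuousOn.prodMk ?_
    refine (continuousOn_open_iff (hU.preimage FlatSpace.continuous_proj)).2 fun B _ ↦ ?_
    intro W s hW hs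
    rw [isOpen_iff_mem_nhds]
    rintro q ⟨hqW, hqU, hqB⟩
    filter_upwards [Φ.eventually_eq_sec hU hW hs hqU hqW, hW.mem_nhds hqW, hU.mem_nhds hqU]
      with p hp hpW hpU
    refine ⟨hpW, hpU, ?_⟩
    have h : Φ.coord p (s p) = Φ.coord q (s q) := by rw [hp, Φ.coord_sec p hpU]
    exact (congrArg (· ∈ B) h).mpr hqB
  continuousOn_invFun := by
    rintro ⟨q, f⟩ ⟨hq, -⟩
    refine ContinuousAt.continuousWithinAt ?_
    have h1 := ((Φ.flat f).continuousOn_mk hU).continuousAt (hU.mem_nhds hq)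
    have h2 : ContinuousAt (fun z : M × DiscreteFiber F ↦
        FlatSpace.mk E z.1 (Φ.sec (id f : F) z.1)) (q, f) :=
      ContinuousAt.comp (f := Prod.fst) h1 continuousAt_fst
    refine h2.congr ?_
    rw [nhds_prod_eq, nhds_discrete (DiscreteFiber F), Filter.prod_pure]
    exact Filter.eventually_map.2 (Filter.Eventually.of_forall fun _ ↦ rfl)

section Covering

variable [T2Space M] [FiniteDimensional ℂ F]

/-- The space of germs of flat sections is a covering space. -/
theorem FlatSpace.isCoveringMap (E : FlatConnection m M F V) :
    IsCoveringMap (FlatSpace.proj E) := by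
  choose U hU hp Φ using E.exists_flatFrame
  exact IsCoveringMap.mk _ (fun _ ↦ DiscreteFiber F)
    (fun p ↦ (Φ p).some.trivialization (hU p)) hp

variable {X : Type*} [TopologicalSpace X]

/-- Continuous families of germs are locally given by flat sections. -/
lemma FlatSpace.exists_eventually_eq {σ : X → E.FlatSpace} {t₀ : X} (hσ : ContinuousAt σ t₀) :
    ∃ U : Set M, IsOpen U ∧ FlatSpace.proj E (σ t₀) ∈ U ∧ ∃ s, E.IsFlatOn U s ∧
      ∀ᶠ t in 𝓝 t₀, σ t = FlatSpace.mk E (FlatSpace.proj E (σ t)) (s (FlatSpace.proj E (σ t))) := by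
  obtain ⟨U, hU, hp, ⟨Φ⟩⟩ := E.exists_flatFrame (FlatSpace.proj E (σ t₀))
  let e := Φ.trivialization hU
  refine ⟨U, hU, hp, Φ.sec (Φ.coord _ (σ t₀).2), Φ.flat _, ?_⟩
  have h1 : ContinuousAt (fun t ↦ (e (σ t)).2) t₀ :=
    ContinuousAt.comp (g := fun z ↦ (e z).2) (f := σ)
      ((e.continuousOn_toFun.continuousAt (e.open_source.mem_nhds hp)).snd) hσ
  have h2 := h1.eventually (p := fun f ↦ f = (e (σ t₀)).2)
    (by rw [nhds_discrete]; exact Filter.eventually_pure.2 rfl)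
  have h3 := hσ.eventually (e.open_source.mem_nhds hp)
  filter_upwards [h2, h3] with t h2 h3
  have h4 := e.left_inv' h3
  refine h4.symm.trans ?_
  exact congrArg (fun f ↦ FlatSpace.mk E (FlatSpace.proj E (σ t)) (Φ.sec f _)) h2

lemma FlatSpace.continuousAt_of_eventually_eq {σ : X → E.FlatSpace} {t₀ : X} {g : X → M}
    (hg : ContinuousAt g t₀) {U : Set M} (hU : IsOpen U) (h0 : g t₀ ∈ U) {s : Π p, V p}
    (hs : E.IsFlatOn U s) (h : ∀ᶠ t in 𝓝 t₀, σ t = FlatSpace.mk E (g t) (s (g t))) :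
    ContinuousAt σ t₀ :=
  ContinuousAt.congr (ContinuousAt.comp (g := fun q ↦ FlatSpace.mk E q (s q))
    ((hs.continuousOn_mk hU).continuousAt (hU.mem_nhds h0)) hg) (h.mono fun _ h ↦ h.symm)

/-- Parallel lifts of a path are its lifts to the space of germs of flat sections. -/
lemma isParallelLift_iff {x y : M} (γ : Path x y) (σ : unitInterval → E.FlatSpace) :
    E.IsParallelLift γ σ ↔ Continuous σ ∧ ∀ t, FlatSpace.proj E (σ t) = γ t := by
  constructor
  · intro h
    refine ⟨continuous_iff_continuousAt.2 fun t₀ ↦ ?_, fun t ↦ ?_⟩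
    · obtain ⟨U, hU, h0, s, hs, h⟩ := h t₀
      exact FlatSpace.continuousAt_of_eventually_eq γ.continuous.continuousAt hU h0 hs h
    · obtain ⟨U, hU, h0, s, hs, h⟩ := h t
      exact congrArg (FlatSpace.proj E) h.self_of_nhds
  · rintro ⟨hσ, hp⟩ t₀
    obtain ⟨U, hU, h0, s, hs, h⟩ := FlatSpace.exists_eventually_eq hσ.continuousAt
    refine ⟨U, hU, hp t₀ ▸ h0, s, hs, ?_⟩
    filter_upwards [h] with t ht
    rw [hp] at ht
    exact ht

end Covering

section Linear

lemma IsFlatOn.add {W : Set M} (hW : IsOpen W) {s s' : Π p, V p} (hs : E.IsFlatOn W s)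
    (hs' : E.IsFlatOn W s') : E.IsFlatOn W (s + s') := by
  refine ⟨hs.1.add_section hs'.1, fun p hp ↦ ?_⟩
  have hd : ∀ {s : Π p, V p}, E.IsFlatOn W s → MDifferentiableAt (𝓡 m) ((𝓡 m).prod 𝓘(ℝ, F))
      (fun q ↦ TotalSpace.mk' F q (s q)) p := fun hs ↦
    ((hs.1 p hp).contMDiffAt (hW.mem_nhds hp)).mdifferentiableAt (by simp)
  rw [E.D.isCovariantDerivativeOnUniv.add (hd hs) (hd hs'), hs.2 p hp, hs'.2 p hp, add_zero]

lemma IsFlatOn.const_smul [VectorBundle ℂ F V] {W : Set M} (hW : IsOpen W) {s : Π p, V p}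
    (hs : E.IsFlatOn W s) (c : ℂ) : E.IsFlatOn W (fun q ↦ c • s q) := by
  refine ⟨fun p hp ↦ ?_, fun p hp ↦ ?_⟩
  · refine ContMDiffAt.contMDiffWithinAt ?_
    have h0 := (hs.1 p hp).contMDiffAt (hW.mem_nhds hp)
    let e := trivializationAt F V p
    have he : p ∈ e.baseSet := FiberBundle.mem_baseSet_trivializationAt' p
    rw [e.contMDiffAt_section_iff he] at h0 ⊢
    have h1 : ContMDiffAt (𝓡 m) 𝓘(ℝ, F) ∞ (fun q ↦ c • (e ⟨q, s q⟩).2) p :=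
      ((c • (1 : F →L[ℝ] F)).contMDiff.contMDiffAt).comp p h0
    refine h1.congr_of_eventuallyEq ?_
    filter_upwards [e.open_baseSet.mem_nhds he] with q hq
    have := (e.linear ℂ hq).map_smul c (s q)
    exact this
  · ext v
    have hd := ((hs.1 p hp).contMDiffAt (hW.mem_nhds hp)).mdifferentiableAt (by simp)
    rw [E.map_smul c s p v hd, hs.2 p hp]
    exact smul_zero c

variable [T2Space M] [FiniteDimensional ℂ F] {X : Type*} [TopologicalSpace X]

lemma FlatSpace.continuous_add {g : X → M} {u w : Π t, V (g t)}
    (hu : Continuous fun t ↦ FlatSpace.mk E (g t) (u t))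
    (hw : Continuous fun t ↦ FlatSpace.mk E (g t) (w t)) :
    Continuous fun t ↦ FlatSpace.mk E (g t) (u t + w t) := by
  have hg : Continuous g := FlatSpace.continuous_proj.comp hu
  refine continuous_iff_continuousAt.2 fun t₀ ↦ ?_
  obtain ⟨U, hU, hU0, s, hs, hsu⟩ := FlatSpace.exists_eventually_eq (t₀ := t₀) hu.continuousAt
  obtain ⟨W, hW, hW0, s', hs', hsw⟩ := FlatSpace.exists_eventually_eq (t₀ := t₀) hw.continuousAt
  have h1 : E.IsFlatOn (U ∩ W) s := ⟨hs.1.mono inter_subset_left, fun p hp ↦ hs.2 p hp.1⟩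
  have h2 : E.IsFlatOn (U ∩ W) s' := ⟨hs'.1.mono inter_subset_right, fun p hp ↦ hs'.2 p hp.2⟩
  refine FlatSpace.continuousAt_of_eventually_eq hg.continuousAt (hU.inter hW) ⟨hU0, hW0⟩
    (h1.add (hU.inter hW) h2) ?_
  filter_upwards [hsu, hsw] with t ht ht'
  have h3 : u t = s (g t) := TotalSpace.mk_inj.1 ht
  have h4 : w t = s' (g t) := TotalSpace.mk_inj.1 ht'
  rw [h3, h4]
  rfl

lemma FlatSpace.continuous_const_smul [VectorBundle ℂ F V] {g : X → M} {u : Π t, V (g t)}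
    (hu : Continuous fun t ↦ FlatSpace.mk E (g t) (u t)) (c : ℂ) :
    Continuous fun t ↦ FlatSpace.mk E (g t) (c • u t) := by
  have hg : Continuous g := FlatSpace.continuous_proj.comp hu
  refine continuous_iff_continuousAt.2 fun t₀ ↦ ?_
  obtain ⟨U, hU, hU0, s, hs, hsu⟩ := FlatSpace.exists_eventually_eq (t₀ := t₀) hu.continuousAt
  refine FlatSpace.continuousAt_of_eventually_eq hg.continuousAt hU hU0
    (hs.const_smul hU c) ?_
  filter_upwards [hsu] with t ht
  have h3 : u t = s (g t) := TotalSpace.mk_inj.1 ht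
  rw [h3]

end Linear

end FlatSpace
end FlatConnection

/-! ### Flows on covering spaces -/

section FlowLift

variable {X Y : Type*} [TopologicalSpace X] [TopologicalSpace Y] {p : Y → X}

/-- Flows lift to covering spaces. -/
theorem IsCoveringMap.exists_flow_lift (cov : IsCoveringMap p) (φ : Flow ℝ X) :
    ∃ ψ : Flow ℝ Y, ∀ t y, p (ψ t y) = φ t (p y) := by
  let H : C(unitInterval × (ℝ × Y), X) := ⟨fun z ↦ φ (z.1 * z.2.1) (p z.2.2),
    φ.continuous (by fun_prop) (cov.continuous.comp (by fun_prop))⟩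
  let f : C(ℝ × Y, Y) := ⟨Prod.snd, continuous_snd⟩
  have H0 : ∀ a, H (0, a) = p (f a) := fun a ↦ by simp [H, f]
  let L := cov.liftHomotopy H f H0
  have hL : ∀ z, p (L z) = H z := congrFun (cov.liftHomotopy_lifts H f H0)
  let ψ : ℝ → Y → Y := fun t y ↦ L (1, (t, y))
  have hψ : Continuous (Function.uncurry ψ) := by
    change Continuous fun z : ℝ × Y ↦ L (1, (z.1, z.2))
    fun_prop
  have hp : ∀ t y, p (ψ t y) = φ t (p y) := fun t y ↦ by
    simp only [ψ, hL, H, ContinuousMap.coe_mk]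
    simp
  have h0 : ∀ y, ψ 0 y = y := fun y ↦ by
    have := cov.eq_of_comp_eq (A := unitInterval) (g₁ := fun s ↦ L (s, (0, y))) (g₂ := fun _ ↦ y)
      (by fun_prop) continuous_const (by
        funext s
        simp only [Function.comp_apply, hL, H, ContinuousMap.coe_mk]
        simp) 0 (cov.liftHomotopy_zero H f H0 (0, y))
    exact congrFun this 1
  refine ⟨⟨ψ, hψ, fun s t y ↦ ?_, h0⟩, hp⟩
  have := cov.eq_of_comp_eq (A := ℝ) (g₁ := fun s ↦ ψ (s + t) y) (g₂ := fun s ↦ ψ s (ψ t y))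
    (hψ.comp (f := fun s : ℝ ↦ (s + t, y)) (by fun_prop))
    (hψ.comp (f := fun s : ℝ ↦ (s, ψ t y)) (by fun_prop)) (by
      funext s
      simp only [Function.comp_apply, hp, φ.map_add]) 0 (by simp [h0])
  exact congrFun this s

/-- A continuous lift to a covering space of a piece of an orbit lies on an orbit of the lifted
flow. -/
lemma IsCoveringMap.eq_flow_lift (cov : IsCoveringMap p) {φ : Flow ℝ X} {ψ : Flow ℝ Y}
    (h : ∀ t y, p (ψ t y) = φ t (p y)) {A : Type*} [TopologicalSpace A] [PreconnectedSpace A]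
    {T : A → ℝ} (hT : Continuous T) {σ : A → Y} (hσ : Continuous σ) {x : X}
    (hpσ : ∀ a, p (σ a) = φ (T a) x) {a₀ : A} (h0 : T a₀ = 0) (a : A) :
    σ a = ψ (T a) (σ a₀) := by
  have hx : p (σ a₀) = x := by rw [hpσ, h0, φ.map_zero_apply]
  refine congrFun (cov.eq_of_comp_eq hσ (ψ.continuous hT continuous_const) ?_ a₀ ?_) a
  · funext a
    simp [hpσ, h, h0]
  · rw [h0, ψ.map_zero_apply]

/-- At a time at which a flow on a path-connected space is the identity, its lift to a covering
space is a deck transformation, and hence is the identity if it fixes one fibre. -/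
lemma IsCoveringMap.flow_lift_eq_self [PathConnectedSpace X] (cov : IsCoveringMap p)
    {φ : Flow ℝ X} {ψ : Flow ℝ Y} (h : ∀ t y, p (ψ t y) = φ t (p y)) {T : ℝ}
    (hT : ∀ x, φ T x = x) {x : X} (hx : ∀ y, p y = x → ψ T y = y) (y : Y) : ψ T y = y := by
  obtain ⟨γ⟩ := PathConnectedSpace.joined (p y) x
  let Γ := cov.liftPath γ y γ.source
  have hΓ : ∀ s, p (Γ s) = γ s := congrFun (cov.liftPath_lifts γ y γ.source)
  have := cov.eq_of_comp_eq (A := unitInterval) (g₁ := fun s ↦ ψ T (Γ s)) (g₂ := Γ)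
    (ψ.continuous continuous_const Γ.continuous) Γ.continuous (by
      funext s
      simp only [Function.comp_apply, h, hT]) 1 (hx _ (by rw [hΓ]; exact γ.target))
  have h0 := congrFun this 0
  rwa [cov.liftPath_zero] at h0

end FlowLift

/-! ### Parallel transport -/

namespace FlatConnection

section Monodromy

variable {m : ℕ} {M : Type*} [TopologicalSpace M]
    [ChartedSpace (EuclideanSpace ℝ (Fin m)) M] [IsManifold (𝓡 m) ∞ M]
    {F : Type*} [NormedAddCommGroup F] [NormedSpace ℂ F]
    {V : M → Type*} [TopologicalSpace (TotalSpace F V)]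
    [∀ p, AddCommGroup (V p)] [∀ p, Module ℂ (V p)] [∀ p, TopologicalSpace (V p)]
    [∀ p, IsTopologicalAddGroup (V p)] [∀ p, ContinuousSMul ℝ (V p)]
    [FiberBundle F V] [VectorBundle ℝ F V]
    [ContMDiffVectorBundle ∞ F V (𝓡 m)]
    {E : FlatConnection m M F V}

/-- The vector that a point of the space of germs over `p` gives. -/
def FlatSpace.vec {p : M} (e : E.FlatSpace) (h : FlatSpace.proj E e = p) : V p := h ▸ e.2

lemma FlatSpace.mk_vec {p : M} (e : E.FlatSpace) (h : FlatSpace.proj E e = p) :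
    FlatSpace.mk E p (e.vec h) = e := by
  subst h
  rfl

lemma FlatSpace.mk_injective (p : M) : Function.Injective (FlatSpace.mk E p) :=
  fun _ _ h ↦ TotalSpace.mk_inj.1 h

variable [T2Space M] [FiniteDimensional ℂ F]

/-- Sums of parallel sections along a path are parallel. -/
lemma FlatSpace.liftPath_add {x y : M} (γ : Path x y) (v w : V x) :
    ∃ (u u' : Π t, V (γ t)),
      (∀ t, (FlatSpace.isCoveringMap E).liftPath γ (FlatSpace.mk E x v) γ.source t =
        FlatSpace.mk E (γ t) (u t)) ∧
      (∀ t, (FlatSpace.isCoveringMap E).liftPath γ (FlatSpace.mk E x w) γ.source t =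
        FlatSpace.mk E (γ t) (u' t)) ∧
      (∀ t, (FlatSpace.isCoveringMap E).liftPath γ (FlatSpace.mk E x (v + w)) γ.source t =
        FlatSpace.mk E (γ t) (u t + u' t)) := by
  let cov := FlatSpace.isCoveringMap E
  have h1 := congrFun (cov.liftPath_lifts γ (FlatSpace.mk E x v) γ.source)
  have h2 := congrFun (cov.liftPath_lifts γ (FlatSpace.mk E x w) γ.source)
  let u : Π t, V (γ t) := fun t ↦ FlatSpace.vec _ (h1 t)
  let u' : Π t, V (γ t) := fun t ↦ FlatSpace.vec _ (h2 t)
  have hu := fun t ↦ FlatSpace.mk_vec _ (h1 t)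
  have hu' := fun t ↦ FlatSpace.mk_vec _ (h2 t)
  refine ⟨u, u', fun t ↦ (hu t).symm, fun t ↦ (hu' t).symm, fun t ↦ ?_⟩
  have hc : Continuous fun t ↦ FlatSpace.mk E (γ t) (u t) :=
    (ContinuousMap.continuous _).congr fun t ↦ (hu t).symm
  have hc' : Continuous fun t ↦ FlatSpace.mk E (γ t) (u' t) :=
    (ContinuousMap.continuous _).congr fun t ↦ (hu' t).symm
  have h0 : ∀ (w : V x) (a : V (γ 0)), FlatSpace.mk E (γ 0) a = FlatSpace.mk E x w →
      HEq a w := fun w a h ↦ (Sigma.mk.inj_iff.1 (congrArg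
        (fun e : TotalSpace F V ↦ (⟨e.1, e.2⟩ : Σ p, V p)) h)).2
  have hadd : ∀ p (hp : p = x) (a b : V p), HEq a v → HEq b w →
      FlatSpace.mk E p (a + b) = FlatSpace.mk E x (v + w) := by
    rintro p rfl a b ha hb
    rw [eq_of_heq ha, eq_of_heq hb]
  refine (congrFun ((cov.eq_liftPath_iff (Γ := fun t ↦ FlatSpace.mk E (γ t) (u t + u' t))
    γ.source).2 ⟨FlatSpace.continuous_add hc hc', rfl, ?_⟩) t).symm
  refine hadd _ γ.source _ _ (h0 v _ ?_) (h0 w _ ?_)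
  · exact (hu 0).trans (cov.liftPath_zero ..)
  · exact (hu' 0).trans (cov.liftPath_zero ..)

/-- Scalar multiples of parallel sections along a path are parallel. -/
lemma FlatSpace.liftPath_smul [VectorBundle ℂ F V] {x y : M} (γ : Path x y) (c : ℂ) (v : V x) :
    ∃ (u : Π t, V (γ t)),
      (∀ t, (FlatSpace.isCoveringMap E).liftPath γ (FlatSpace.mk E x v) γ.source t =
        FlatSpace.mk E (γ t) (u t)) ∧
      (∀ t, (FlatSpace.isCoveringMap E).liftPath γ (FlatSpace.mk E x (c • v)) γ.source t =
        FlatSpace.mk E (γ t) (c • u t)) := by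
  let cov := FlatSpace.isCoveringMap E
  have h1 := congrFun (cov.liftPath_lifts γ (FlatSpace.mk E x v) γ.source)
  let u : Π t, V (γ t) := fun t ↦ FlatSpace.vec _ (h1 t)
  have hu := fun t ↦ FlatSpace.mk_vec _ (h1 t)
  refine ⟨u, fun t ↦ (hu t).symm, fun t ↦ ?_⟩
  have hc : Continuous fun t ↦ FlatSpace.mk E (γ t) (u t) :=
    (ContinuousMap.continuous _).congr fun t ↦ (hu t).symm
  have hsmul : ∀ p (hp : p = x) (a : V p), FlatSpace.mk E p a = FlatSpace.mk E x v →
      FlatSpace.mk E p (c • a) = FlatSpace.mk E x (c • v) := by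
    rintro p rfl a ha
    rw [FlatSpace.mk_injective p ha]
  refine (congrFun ((cov.eq_liftPath_iff (Γ := fun t ↦ FlatSpace.mk E (γ t) (c • u t))
    γ.source).2 ⟨FlatSpace.continuous_const_smul hc c, rfl, ?_⟩) t).symm
  exact hsmul _ γ.source _ ((hu 0).trans (cov.liftPath_zero ..))

variable [VectorBundle ℂ F V]

/-- Parallel transport along loops, as a homomorphism to the endomorphisms of the fibre. -/
def parallelTransport (E : FlatConnection m M F V) (x : M) :
    FundamentalGroup M x →* Module.End ℂ (V x) where
  toFun g :=
    { toFun := fun v ↦ FlatSpace.vec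
        ((FlatSpace.isCoveringMap E).monodromy g ⟨FlatSpace.mk E x v, rfl⟩).1
        ((FlatSpace.isCoveringMap E).monodromy g ⟨FlatSpace.mk E x v, rfl⟩).2
      map_add' := fun v w ↦ by
        apply FlatSpace.mk_injective (E := E)
        refine (FlatSpace.mk_vec _ _).trans ?_
        obtain ⟨γ⟩ := g
        obtain ⟨u, u', h, h', h''⟩ := FlatSpace.liftPath_add (E := E) γ v w
        have hadd : ∀ p (hp : p = x) (a b : V p) (e e' : E.FlatSpace)
            (he : FlatSpace.proj E e = x) (he' : FlatSpace.proj E e' = x),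
            e = FlatSpace.mk E p a → e' = FlatSpace.mk E p b →
            FlatSpace.mk E p (a + b) = FlatSpace.mk E x (e.vec he + e'.vec he') := by
          rintro p rfl a b e e' he he' rfl rfl
          rfl
        exact (h'' 1).trans (hadd _ γ.target _ _ _ _ _ _ (h 1) (h' 1))
      map_smul' := fun c v ↦ by
        apply FlatSpace.mk_injective (E := E)
        refine (FlatSpace.mk_vec _ _).trans ?_
        obtain ⟨γ⟩ := g
        obtain ⟨u, h, h''⟩ := FlatSpace.liftPath_smul (E := E) γ c v
        have hsmul : ∀ p (hp : p = x) (a : V p) (e : E.FlatSpace)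
            (he : FlatSpace.proj E e = x), e = FlatSpace.mk E p a →
            FlatSpace.mk E p (c • a) = FlatSpace.mk E x (c • e.vec he) := by
          rintro p rfl a e he rfl
          rfl
        exact (h'' 1).trans (hsmul _ γ.target _ _ _ (h 1)) }
  map_one' := by
    ext v
    apply FlatSpace.mk_injective (E := E)
    refine (FlatSpace.mk_vec _ _).trans ?_
    exact congrArg Subtype.val (congrFun (FlatSpace.isCoveringMap E).monodromy_refl _)
  map_mul' g g' := by
    ext v
    apply FlatSpace.mk_injective (E := E)
    refine (FlatSpace.mk_vec _ _).trans ((congrArg Subtype.val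
      ((FlatSpace.isCoveringMap E).monodromy_trans_apply g' g _)).trans ?_)
    refine Eq.trans ?_ (FlatSpace.mk_vec _ _).symm
    refine congrArg (fun e ↦ ((FlatSpace.isCoveringMap E).monodromy g e).1) ?_
    exact Subtype.ext (FlatSpace.mk_vec _ _).symm

lemma mk_parallelTransport (x : M) (g : FundamentalGroup M x) (v : V x) :
    FlatSpace.mk E x (E.parallelTransport x g v) =
      ((FlatSpace.isCoveringMap E).monodromy g ⟨FlatSpace.mk E x v, rfl⟩).1 :=
  FlatSpace.mk_vec _ _

lemma isMonodromy_parallelTransport (x : M) :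
    E.IsMonodromy x (E.parallelTransport x).toHomUnits := by
  intro γ v
  let cov := FlatSpace.isCoveringMap E
  refine ⟨cov.liftPath γ (FlatSpace.mk E x v) γ.source, ?_, cov.liftPath_zero .., ?_⟩
  · exact (isParallelLift_iff γ _).2 ⟨ContinuousMap.continuous _,
      congrFun (cov.liftPath_lifts γ (FlatSpace.mk E x v) γ.source)⟩
  · exact (mk_parallelTransport (E := E) x (FundamentalGroup.fromPath ⟦γ⟧) v).symm

/-- The monodromy representation of the flat bundle is the monodromy of the covering by germs of
flat sections. -/
lemma mk_monodromy (x : M) (g : FundamentalGroup M x) (v : V x) :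
    FlatSpace.mk E x ((E.monodromy x g : V x →ₗ[ℂ] V x) v) =
      ((FlatSpace.isCoveringMap E).monodromy g ⟨FlatSpace.mk E x v, rfl⟩).1 := by
  have h : ∃ ρ, E.IsMonodromy x ρ := ⟨_, E.isMonodromy_parallelTransport x⟩
  have hρ : E.IsMonodromy x (E.monodromy x) := by
    rw [FlatConnection.monodromy, dif_pos h]
    exact h.choose_spec
  obtain ⟨γ⟩ := g
  obtain ⟨σ, hσ, h0, h1⟩ := hρ γ v
  obtain ⟨hc, hp⟩ := (isParallelLift_iff (E := E) γ σ).1 hσ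
  have := ((FlatSpace.isCoveringMap E).eq_liftPath_iff (Γ := σ) (γ := γ)
    (e := FlatSpace.mk E x v) γ.source).2 ⟨hc, funext hp, h0⟩
  exact h1.symm.trans (congrFun this 1)

end Monodromy

/-! ### The flow of the basic bundle -/

section Basic

variable {n : ℕ} {M : Type*} [TopologicalSpace M]
    [ChartedSpace (EuclideanSpace ℝ (Fin (2 * n + 1))) M] [IsManifold (𝓡 (2 * n + 1)) ∞ M]
    [T2Space M] [CompactSpace M]
    {F : Type*} [NormedAddCommGroup F] [NormedSpace ℂ F] [FiniteDimensional ℂ F]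
    {V : M → Type*} [TopologicalSpace (TotalSpace F V)]
    [∀ p, AddCommGroup (V p)] [∀ p, Module ℂ (V p)] [∀ p, TopologicalSpace (V p)]
    [∀ p, IsTopologicalAddGroup (V p)] [∀ p, ContinuousSMul ℝ (V p)]
    [FiberBundle F V] [VectorBundle ℝ F V]
    [ContMDiffVectorBundle ∞ F V (𝓡 (2 * n + 1))]
    (E : FlatConnection (2 * n + 1) M F V) (S : SasakianStructure n M)

/-- The lift of the Reeb flow to the space of germs of flat sections. -/
def flatFlow : Flow ℝ E.FlatSpace :=
  ((FlatSpace.isCoveringMap E).exists_flow_lift S.flow).choose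

lemma proj_flatFlow (t : ℝ) (e : E.FlatSpace) :
    FlatSpace.proj E (E.flatFlow S t e) = S.flow t (FlatSpace.proj E e) :=
  ((FlatSpace.isCoveringMap E).exists_flow_lift S.flow).choose_spec t e

/-- Flat sections are basic, and basic sections are flat along the Reeb orbits. -/
lemma isBasicLift_iff (p : M) (σ : ℝ → E.FlatSpace) :
    E.IsBasicLift S p σ ↔ Continuous σ ∧ ∀ t, FlatSpace.proj E (σ t) = S.flow t p := by
  constructor
  · intro h
    refine ⟨continuous_iff_continuousAt.2 fun t₀ ↦ ?_, fun t ↦ ?_⟩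
    · obtain ⟨W, hW, h0, s, hs, h⟩ := h t₀
      obtain ⟨U, hU, h0U, ⟨Φ⟩⟩ := E.exists_flatFrame (S.flow t₀ p)
      rw [S.reebFlow_eq_flow] at h0
      have h1 := Φ.eventually_eq_sec_of_integralCurve hU hW hs.1 hs.2
        (S.isMIntegralCurve_flow p) h0U h0
      refine FlatSpace.continuousAt_of_eventually_eq (g := fun t ↦ S.flow t p)
        (S.flow.continuous continuous_id continuous_const).continuousAt hU h0U
        (Φ.flat (Φ.coord _ (s (S.flow t₀ p)))) ?_
      filter_upwards [h, h1] with t ht ht1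
      rw [S.reebFlow_eq_flow, ht1] at ht
      exact ht
    · obtain ⟨U, hU, h0, s, hs, h⟩ := h t
      refine (congrArg (FlatSpace.proj E) h.self_of_nhds).trans (S.reebFlow_eq_flow t p)
  · rintro ⟨hσ, hp⟩ t₀
    obtain ⟨U, hU, h0, s, hs, h⟩ := FlatSpace.exists_eventually_eq (t₀ := t₀) hσ.continuousAt
    refine ⟨U, hU, by rwa [S.reebFlow_eq_flow, ← hp t₀], s,
      ⟨hs.1, fun p hp ↦ by rw [hs.2 p hp]; rfl⟩, ?_⟩
    filter_upwards [h] with t ht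
    rw [hp, ← S.reebFlow_eq_flow] at ht
    exact ht

lemma basicFlow_eq (t : ℝ) (e : E.FlatSpace) : E.basicFlow S t e = E.flatFlow S t e := by
  have h : ∃ σ : ℝ → TotalSpace F V, E.IsBasicLift S (FlatSpace.proj E e) σ ∧ σ 0 = e :=
    ⟨fun t ↦ E.flatFlow S t e, (E.isBasicLift_iff S _ _).2
      ⟨(E.flatFlow S).continuous continuous_id continuous_const,
        fun t ↦ E.proj_flatFlow S t e⟩, (E.flatFlow S).map_zero_apply e⟩
  have hb : E.basicFlow S t e = h.choose t := dif_pos h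
  obtain ⟨h1, h2⟩ := h.choose_spec
  obtain ⟨h3, h4⟩ := (E.isBasicLift_iff S _ _).1 h1
  rw [hb]
  refine ((FlatSpace.isCoveringMap E).eq_flow_lift (E.proj_flatFlow S) (T := id) continuous_id h3
    h4 (a₀ := 0) rfl t).trans ?_
  exact congrArg (E.flatFlow S t) h2

variable [VectorBundle ℂ F V] {x : M} (hx : x ∈ S.regularPoints)

/-- On the fibre over a regular point, the flow of the basic bundle at the period is the monodromy
along the Reeb loop. -/
lemma flatFlow_period (v : V x) :
    E.flatFlow S S.period (FlatSpace.mk E x v) = FlatSpace.mk E x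
      ((E.monodromy x (FundamentalGroup.fromPath ⟦S.orbitLoop hx⟧) : V x →ₗ[ℂ] V x) v) := by
  rw [mk_monodromy]
  have h := ((FlatSpace.isCoveringMap E).eq_liftPath_iff (γ := S.orbitLoop hx)
    (Γ := fun t ↦ E.flatFlow S (t * S.period) (FlatSpace.mk E x v))
    (e := FlatSpace.mk E x v) (S.orbitLoop hx).source).2
      ⟨(E.flatFlow S).continuous (by fun_prop) continuous_const,
        funext fun t ↦ E.proj_flatFlow S _ _, by simp⟩
  have h1 := congrFun h 1
  simp only [Icc.coe_one, one_mul] at h1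
  exact h1

lemma flatFlow_nat_mul_period (k : ℕ) (v : V x) :
    E.flatFlow S (k * S.period) (FlatSpace.mk E x v) = FlatSpace.mk E x
      ((E.monodromy x (FundamentalGroup.fromPath ⟦S.orbitLoop hx⟧) ^ k :
        LinearMap.GeneralLinearGroup ℂ (V x)).1 v) := by
  induction k with
  | zero => simp
  | succ k ih =>
    have h : ((k + 1 : ℕ) : ℝ) * S.period = S.period + k * S.period := by push_cast; ring
    rw [h, (E.flatFlow S).map_add, ih, E.flatFlow_period S hx, pow_succ']
    rfl

/-- The `k`-th power of the monodromy along the Reeb loop decides whether the flow of the basic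
bundle is the identity at `k` times the period. -/
lemma forall_basicFlow_eq_iff [ConnectedSpace M] (k : ℕ) :
    (∀ e : TotalSpace F V, E.basicFlow S (k * S.period) e = e) ↔
      E.monodromy x (FundamentalGroup.fromPath ⟦S.orbitLoop hx⟧) ^ k = 1 := by
  have : LocallyPathConnectedSpace M := ChartedSpace.locallyPathConnectedSpace
    (EuclideanSpace ℝ (Fin (2 * n + 1))) M
  have : PathConnectedSpace M := .of_locallyPathConnectedSpace
  constructor
  · intro h
    refine Units.ext (LinearMap.ext fun v ↦ FlatSpace.mk_injective (E := E) x ?_)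
    rw [← E.flatFlow_nat_mul_period S hx, ← E.basicFlow_eq]
    exact h _
  · intro h e
    refine (E.basicFlow_eq S _ e).trans ?_
    refine (FlatSpace.isCoveringMap E).flow_lift_eq_self (E.proj_flatFlow S)
      (S.flow_nat_mul_period hx k) (x := x) ?_ e
    rintro ⟨q, v⟩ rfl
    exact (E.flatFlow_nat_mul_period S hx k v).trans (by rw [h]; rfl)

/-- Regularity of the basic bundle is triviality of the monodromy along the Reeb loop. -/
lemma isRegular_iff [ConnectedSpace M] : E.IsRegular S ↔
    E.monodromy x (FundamentalGroup.fromPath ⟦S.orbitLoop hx⟧) = 1 := by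
  have := E.forall_basicFlow_eq_iff S hx 1
  rwa [Nat.cast_one, one_mul, pow_one] at this

/-- Quasi-regularity of the basic bundle is finiteness of the monodromy along the Reeb loop. -/
lemma isQuasiRegular_iff [ConnectedSpace M] : E.IsQuasiRegular S ↔
    (range fun k : ℤ ↦
      E.monodromy x (FundamentalGroup.fromPath ⟦S.orbitLoop hx⟧) ^ k).Finite := by
  rw [← Subgroup.coe_zpowers, finite_zpowers, isOfFinOrder_iff_pow_eq_one]
  exact exists_congr fun k ↦ and_congr_right fun _ ↦ E.forall_basicFlow_eq_iff S hx k

end Basic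

end FlatConnection

/-! ### Contractibility of the unit sphere of `ℓ²` -/

namespace SasakianStructure.UniversalCircleBundle

/-- The shift `(a₀, a₁, …) ↦ (0, a₀, a₁, …)` of sequences. -/
def shiftSeq (a : ℕ → ℂ) : ℕ → ℂ
  | 0 => 0
  | i + 1 => a i

lemma hasSum_norm_shiftSeq (a : lp (fun _ : ℕ ↦ ℂ) 2) :
    HasSum (fun i ↦ ‖shiftSeq a i‖ ^ (2 : ENNReal).toReal) (‖a‖ ^ (2 : ENNReal).toReal) := by
  have h := lp.hasSum_norm (p := 2) (by simp) a
  have h1 := (hasSum_nat_add_iff' (f := fun i ↦ ‖shiftSeq a i‖ ^ (2 : ENNReal).toReal) 1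
    (g := ‖a‖ ^ (2 : ENNReal).toReal)).1
  refine h1 ?_
  have h2 : ∑ i ∈ Finset.range 1, ‖shiftSeq a i‖ ^ (2 : ENNReal).toReal = 0 := by
    simp [shiftSeq]
  rw [h2, sub_zero]
  exact h

/-- The shift of `ℓ²`. -/
def shift (a : lp (fun _ : ℕ ↦ ℂ) 2) : lp (fun _ : ℕ ↦ ℂ) 2 :=
  ⟨shiftSeq a, (memℓp_gen_iff (by simp)).2 (hasSum_norm_shiftSeq a).summable⟩

@[simp] lemma shift_zero (a : lp (fun _ : ℕ ↦ ℂ) 2) : shift a 0 = 0 := rfl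

@[simp] lemma shift_succ (a : lp (fun _ : ℕ ↦ ℂ) 2) (i : ℕ) : shift a (i + 1) = a i := rfl

lemma norm_shift (a : lp (fun _ : ℕ ↦ ℂ) 2) : ‖shift a‖ = ‖a‖ := by
  have h := (lp.hasSum_norm (p := 2) (by simp) (shift a)).unique (hasSum_norm_shiftSeq a)
  exact (Real.rpow_left_inj (norm_nonneg _) (norm_nonneg _) (by simp)).1 h

lemma continuous_shift : Continuous shift := by
  refine (Isometry.of_dist_eq fun a b ↦ ?_).continuous
  have : shift a - shift b = shift (a - b) := by
    ext i
    cases i <;> simp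
  rw [dist_eq_norm, dist_eq_norm, this, norm_shift]

/-- A path of non-vanishing maps gives a homotopy of maps to the unit sphere. -/
lemma homotopic_of_lineMap_ne_zero {f g : C(UniversalCircleBundle, UniversalCircleBundle)}
    (h : ∀ (t : unitInterval) a, (1 - t : ℝ) • (f a).1 + (t : ℝ) • (g a).1 ≠ 0) :
    f.Homotopic g := by
  let H : unitInterval × UniversalCircleBundle → lp (fun _ : ℕ ↦ ℂ) 2 :=
    fun z ↦ (1 - z.1 : ℝ) • (f z.2).1 + (z.1 : ℝ) • (g z.2).1
  have hH : Continuous H := by fun_prop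
  have hn : ∀ z, ‖H z‖ ≠ 0 := fun z ↦ norm_ne_zero_iff.2 (h z.1 z.2)
  have h1 : ∀ a : UniversalCircleBundle, ‖a.1‖ = 1 := fun a ↦ by simp
  refine ⟨⟨⟨fun z ↦ ⟨‖H z‖⁻¹ • H z, ?_⟩, ?_⟩, fun a ↦ ?_, fun a ↦ ?_⟩⟩
  · rw [mem_sphere_zero_iff_norm, norm_smul, norm_inv, norm_norm, inv_mul_cancel₀ (hn z)]
  · exact ((hH.norm.inv₀ hn).smul hH).subtype_mk _
  · ext1
    simp [H, h1]
  · ext1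
    simp [H, h1]

/-- The unit sphere of `ℓ²` is contractible: the identity is homotopic to the shift, and the shift
is homotopic to a constant map. -/
instance : ContractibleSpace UniversalCircleBundle := by
  rw [contractible_iff_id_nullhomotopic]
  have h1 : ∀ a : UniversalCircleBundle, ‖a.1‖ = 1 := fun a ↦ by simp
  have hmem : ∀ a : UniversalCircleBundle, shift a.1 ∈ Metric.sphere 0 1 := fun a ↦ by
    simp [norm_shift]
  let s : C(UniversalCircleBundle, UniversalCircleBundle) :=
    ⟨fun a ↦ ⟨shift a.1, hmem a⟩, (continuous_shift.comp continuous_subtype_val).subtype_mk hmem⟩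
  have hz : ∀ a : UniversalCircleBundle, (∀ i, a.1 i = 0) → False := fun a ha ↦ by
    have : a.1 = 0 := by ext i; exact ha i
    have := h1 a
    simp_all
  refine ⟨universalBasePoint, (homotopic_of_lineMap_ne_zero (g := s) fun t a h ↦ ?_).trans
    (homotopic_of_lineMap_ne_zero fun t a h ↦ ?_)⟩
  · have h0 := congrArg (fun b : lp (fun _ : ℕ ↦ ℂ) 2 ↦ b 0) h
    have hs := fun i ↦ congrArg (fun b : lp (fun _ : ℕ ↦ ℂ) 2 ↦ b (i + 1)) h
    simp only [ContinuousMap.id_apply, s, ContinuousMap.coe_mk, lp.coeFn_add, lp.coeFn_smul,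
      Pi.add_apply, Pi.smul_apply, shift_zero, shift_succ, smul_zero, add_zero, lp.coeFn_zero,
      Pi.zero_apply] at h0 hs
    by_cases ht : (1 - t : ℝ) = 0
    · have ht1 : (t : ℝ) = 1 := by linarith
      refine hz a fun i ↦ ?_
      have := hs i
      rw [ht, ht1] at this
      simpa using this
    · refine hz a fun i ↦ ?_
      induction i with
      | zero => exact (smul_eq_zero.1 h0).resolve_left ht
      | succ i ih =>
        have := hs i
        rw [ih, smul_zero, add_zero] at this
        exact (smul_eq_zero.1 this).resolve_left ht
  · have h0 := congrArg (fun b : lp (fun _ : ℕ ↦ ℂ) 2 ↦ b 0) h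
    have hs := fun i ↦ congrArg (fun b : lp (fun _ : ℕ ↦ ℂ) 2 ↦ b (i + 1)) h
    simp only [s, ContinuousMap.coe_mk, ContinuousMap.const_apply, universalBasePoint,
      lp.coeFn_add, lp.coeFn_smul, Pi.add_apply, Pi.smul_apply, shift_zero, shift_succ, smul_zero,
      zero_add, lp.coeFn_zero, Pi.zero_apply, lp.single_apply_self] at h0 hs
    have ht : (t : ℝ) = 0 := by simpa using h0
    refine hz a fun i ↦ ?_
    have := hs i
    rw [ht] at this
    simpa using this

end SasakianStructure.UniversalCircleBundle

/-! ### Periodic flows -/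

/-- The continuous flow `ψ` is periodic of period `T > 0`, that is, an action of the circle
`ℝ / Tℤ`. -/
structure IsPeriodicFlow {Y : Type*} [TopologicalSpace Y] (T : ℝ) (ψ : ℝ → Y → Y) : Prop where
  pos : 0 < T
  continuous : Continuous (Function.uncurry ψ)
  map_zero : ∀ y, ψ 0 y = y
  map_add : ∀ s t y, ψ (s + t) y = ψ s (ψ t y)
  map_period : ∀ y, ψ T y = y

namespace IsPeriodicFlow

variable {Y : Type*} [TopologicalSpace Y] {T : ℝ} {ψ : ℝ → Y → Y}

lemma continuous_apply (h : IsPeriodicFlow T ψ) (t : ℝ) : Continuous (ψ t) :=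
  h.continuous.comp (f := fun y ↦ (t, y)) (by fun_prop)

lemma map_neg_map (h : IsPeriodicFlow T ψ) (t : ℝ) (y : Y) : ψ (-t) (ψ t y) = y := by
  rw [← h.map_add, neg_add_cancel, h.map_zero]

lemma map_map_neg (h : IsPeriodicFlow T ψ) (t : ℝ) (y : Y) : ψ t (ψ (-t) y) = y := by
  rw [← h.map_add, add_neg_cancel, h.map_zero]

lemma map_int_mul (h : IsPeriodicFlow T ψ) (k : ℤ) (y : Y) : ψ (k * T) y = y := by
  have hn : ∀ (k : ℕ) (y : Y), ψ (k * T) y = y := fun k y ↦ by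
    induction k with
    | zero => simpa using h.map_zero y
    | succ k ih => rw [Nat.cast_succ, add_one_mul, h.map_add, h.map_period, ih]
  obtain ⟨k, rfl | rfl⟩ := k.eq_nat_or_neg
  · exact_mod_cast hn k y
  · have := h.map_neg_map (k * T) y
    rw [hn] at this
    simpa using this

lemma map_eq_of_coe_angle (h : IsPeriodicFlow T ψ) {θ θ' : ℝ}
    (hθ : (θ : Real.Angle) = θ') (y : Y) :
    ψ (-(T / (2 * Real.pi)) * θ) y = ψ (-(T / (2 * Real.pi)) * θ') y := by
  obtain ⟨k, hk⟩ := Real.Angle.angle_eq_iff_two_pi_dvd_sub.1 hθ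
  have : -(T / (2 * Real.pi)) * θ = -(T / (2 * Real.pi)) * θ' + (-k : ℤ) * T := by
    rw [sub_eq_iff_eq_add.1 hk]
    push_cast
    field_simp
    ring
  rw [this, h.map_add, h.map_int_mul]

/-- Rotation by the inverse of the argument of a complex number is continuous, also across the
branch cut, by periodicity. -/
lemma continuousAt_arg (h : IsPeriodicFlow T ψ) {w : ℂ × Y} (hw : w.1 ≠ 0) :
    ContinuousAt (fun z : ℂ × Y ↦ ψ (-(T / (2 * Real.pi)) * z.1.arg) z.2) w := by
  have key : ∀ g : ℂ × Y → ℝ, ContinuousAt g w → ContinuousAt (fun z ↦ ψ (g z) z.2) w :=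
    fun g hg ↦ ContinuousAt.comp (f := fun z : ℂ × Y ↦ (g z, z.2)) h.continuous.continuousAt
      (hg.prodMk continuousAt_snd)
  by_cases hs : w.1 ∈ Complex.slitPlane
  · exact key _ (((Complex.continuousAt_arg hs).comp continuousAt_fst).const_mul _)
  · have hs' : -w.1 ∈ Complex.slitPlane :=
      (Complex.mem_slitPlane_or_neg_mem_slitPlane hw).resolve_left hs
    have h1 := key (fun z ↦ -(T / (2 * Real.pi)) * ((-z.1).arg + Real.pi))
      (((ContinuousAt.comp (f := fun z : ℂ × Y ↦ -z.1) (Complex.continuousAt_arg hs')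
        continuousAt_fst.neg).add continuousAt_const).const_mul _)
    refine h1.congr ?_
    filter_upwards [continuousAt_fst.eventually_ne hw] with z hz
    refine (h.map_eq_of_coe_angle ?_ z.2)
    rw [Real.Angle.coe_add, Complex.arg_neg_coe_angle hz, add_assoc, Real.Angle.coe_pi_add_coe_pi,
      add_zero]

lemma prod {Z : Type*} [TopologicalSpace Z] {χ : ℝ → Z → Z} (h : IsPeriodicFlow T ψ)
    (h' : IsPeriodicFlow T χ) :
    IsPeriodicFlow T (fun t (z : Y × Z) ↦ (ψ t z.1, χ t z.2)) where
  pos := h.pos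
  continuous := (h.continuous.comp (f := fun z : ℝ × (Y × Z) ↦ (z.1, z.2.1)) (by fun_prop)).prodMk
    (h'.continuous.comp (f := fun z : ℝ × (Y × Z) ↦ (z.1, z.2.2)) (by fun_prop))
  map_zero z := Prod.ext (h.map_zero _) (h'.map_zero _)
  map_add s t z := Prod.ext (h.map_add s t _) (h'.map_add s t _)
  map_period z := Prod.ext (h.map_period _) (h'.map_period _)

end IsPeriodicFlow

/-! ### The universal circle bundle -/

open SasakianStructure (UniversalCircleBundle universalBasePoint)

namespace SasakianStructure.UniversalCircleBundle

/-- Multiplication by `exp(2πi t / T)` on the unit sphere of `ℓ²`. -/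
def rotate (T t : ℝ) (a : UniversalCircleBundle) : UniversalCircleBundle :=
  ⟨Complex.exp (2 * Real.pi * Complex.I * (t / T : ℝ)) • a.1, by
    have h : 2 * Real.pi * Complex.I * (t / T : ℝ) = (2 * Real.pi * (t / T) : ℝ) * Complex.I := by
      push_cast; ring
    rw [mem_sphere_zero_iff_norm, norm_smul, h, Complex.norm_exp_ofReal_mul_I]
    simp⟩

lemma rotate_apply (T t : ℝ) (a : UniversalCircleBundle) (k : ℕ) :
    (rotate T t a).1 k = Complex.exp ((2 * Real.pi * (t / T) : ℝ) * Complex.I) * a.1 k := by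
  have h : 2 * Real.pi * Complex.I * (t / T : ℝ) = (2 * Real.pi * (t / T) : ℝ) * Complex.I := by
    push_cast; ring
  simp only [rotate, h, lp.coeFn_smul, Pi.smul_apply, smul_eq_mul]

lemma continuous_coord (k : ℕ) : Continuous fun a : UniversalCircleBundle ↦ a.1 k :=
  (lp.evalCLM ℂ (fun _ : ℕ ↦ ℂ) (p := 2) k).continuous.comp continuous_subtype_val

lemma exists_coord_ne_zero (a : UniversalCircleBundle) : ∃ k, a.1 k ≠ 0 := by
  by_contra! h
  have h0 : a.1 = 0 := by ext i; exact h i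
  have h1 : ‖a.1‖ = 1 := by simp
  simp [h0] at h1

lemma isPeriodicFlow_rotate {T : ℝ} (hT : 0 < T) : IsPeriodicFlow T (rotate T) where
  pos := hT
  continuous := by
    refine Continuous.subtype_mk ?_ _
    fun_prop
  map_zero a := by ext k; simp [rotate_apply]
  map_add s t a := by
    ext k
    rw [rotate_apply, rotate_apply, rotate_apply, ← mul_assoc, ← Complex.exp_add]
    congr 2
    push_cast
    ring
  map_period a := by
    ext k
    rw [rotate_apply, div_self hT.ne']
    simp

/-- The circle acts freely on the unit sphere of `ℓ²`. -/
lemma exists_int_of_rotate_eq {T : ℝ} (hT : 0 < T) {t : ℝ} {a : UniversalCircleBundle}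
    (h : rotate T t a = a) : ∃ k : ℤ, t = k * T := by
  obtain ⟨k, hk⟩ := exists_coord_ne_zero a
  have h1 := rotate_apply T t a k
  rw [h, eq_comm, mul_eq_right₀ hk, Complex.exp_eq_one_iff] at h1
  obtain ⟨j, hj⟩ := h1
  refine ⟨j, ?_⟩
  have h2 : ((2 * Real.pi * (t / T) : ℝ) : ℂ) = ((j * (2 * Real.pi) : ℝ) : ℂ) := by
    refine mul_right_cancel₀ Complex.I_ne_zero (hj.trans ?_)
    push_cast
    ring
  have h3 := Complex.ofReal_injective h2
  have hpi := Real.pi_pos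
  field_simp at h3
  linarith

end SasakianStructure.UniversalCircleBundle

open SasakianStructure.UniversalCircleBundle

/-! ### Borel constructions -/

/-- The orbit relation of the diagonal action of the circle `ℝ / Tℤ` on `ES¹ × Y`. For the Reeb flow
it is `SasakianStructure.borelRel` by definition. -/
def HomotopyQuotient.rel {Y : Type*} (T : ℝ) (ψ : ℝ → Y → Y)
    (a b : UniversalCircleBundle × Y) : Prop :=
  ∃ t : ℝ, (b.1.1 : lp (fun _ : ℕ ↦ ℂ) 2) =
      Complex.exp (2 * Real.pi * Complex.I * (t / T : ℝ)) • (a.1.1 : lp (fun _ : ℕ ↦ ℂ) 2) ∧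
    b.2 = ψ t a.2

/-- The Borel construction `ES¹ ×_{S¹} Y` of a periodic flow, with the quotient topology. -/
def HomotopyQuotient {Y : Type*} (T : ℝ) (ψ : ℝ → Y → Y) : Type _ := Quot (HomotopyQuotient.rel T ψ)

namespace HomotopyQuotient

variable {Y : Type*} [TopologicalSpace Y] {T : ℝ} {ψ : ℝ → Y → Y}

instance : TopologicalSpace (HomotopyQuotient T ψ) :=
  inferInstanceAs (TopologicalSpace (Quot (HomotopyQuotient.rel T ψ)))

variable (T ψ) in
/-- The diagonal flow on `ES¹ × Y`. -/
def diag (t : ℝ) (a : UniversalCircleBundle × Y) : UniversalCircleBundle × Y :=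
  (rotate T t a.1, ψ t a.2)

variable (T ψ) in
/-- The circle bundle `ES¹ × Y → ES¹ ×_{S¹} Y`. -/
def mk (a : UniversalCircleBundle × Y) : HomotopyQuotient T ψ := Quot.mk _ a

lemma continuous_mk : Continuous (mk T ψ) := continuous_quot_mk

lemma mk_surjective : Function.Surjective (mk T ψ) := Quot.exists_rep

lemma rel_iff {a b : UniversalCircleBundle × Y} : rel T ψ a b ↔ ∃ t, b = diag T ψ t a := by
  exact exists_congr fun t ↦ ⟨fun h ↦ Prod.ext (Subtype.ext h.1) h.2,
    fun h ↦ h ▸ ⟨rfl, rfl⟩⟩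

lemma mk_diag (t : ℝ) (a : UniversalCircleBundle × Y) : mk T ψ (diag T ψ t a) = mk T ψ a :=
  (Quot.sound (rel_iff.2 ⟨t, rfl⟩)).symm

lemma isPeriodicFlow_diag (h : IsPeriodicFlow T ψ) : IsPeriodicFlow T (diag T ψ) :=
  (isPeriodicFlow_rotate h.pos).prod h

lemma mk_eq_iff (h : IsPeriodicFlow T ψ) {a b : UniversalCircleBundle × Y} :
    mk T ψ a = mk T ψ b ↔ ∃ t, b = diag T ψ t a := by
  have hd := isPeriodicFlow_diag h
  have he : Equivalence (rel T ψ) :=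
    ⟨fun a ↦ rel_iff.2 ⟨0, (hd.map_zero a).symm⟩, fun {a b} hab ↦ by
      obtain ⟨t, rfl⟩ := rel_iff.1 hab
      exact rel_iff.2 ⟨-t, (hd.map_neg_map t a).symm⟩, fun {a b c} hab hbc ↦ by
      obtain ⟨t, rfl⟩ := rel_iff.1 hab
      obtain ⟨s, rfl⟩ := rel_iff.1 hbc
      exact rel_iff.2 ⟨s + t, (hd.map_add s t a).symm⟩⟩
  exact (Quot.eq.trans he.eqvGen_iff).trans rel_iff

lemma isOpenMap_mk (h : IsPeriodicFlow T ψ) : IsOpenMap (mk T ψ) := by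
  intro A hA
  have : mk T ψ ⁻¹' (mk T ψ '' A) = ⋃ t, diag T ψ t ⁻¹' A := by
    ext b
    simp only [mem_preimage, mem_image, mem_iUnion]
    constructor
    · rintro ⟨a, ha, hab⟩
      obtain ⟨t, rfl⟩ := (mk_eq_iff h).1 hab.symm
      exact ⟨t, ha⟩
    · rintro ⟨t, ht⟩
      exact ⟨_, ht, mk_diag t b⟩
  refine isQuotientMap_quot_mk.isOpen_preimage.1 ?_
  change IsOpen (mk T ψ ⁻¹' (mk T ψ '' A))
  rw [this]
  exact isOpen_iUnion fun t ↦ hA.preimage ((isPeriodicFlow_diag h).continuous_apply t)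

variable (T ψ) in
/-- The open set of the Borel construction where the `k`-th coordinate of `ES¹` does not vanish. -/
def chart (k : ℕ) : Set (HomotopyQuotient T ψ) := mk T ψ '' {a | a.1.1 k ≠ 0}

lemma diag_coord (t : ℝ) (a : UniversalCircleBundle × Y) (k : ℕ) :
    (diag T ψ t a).1.1 k = Complex.exp ((2 * Real.pi * (t / T) : ℝ) * Complex.I) * a.1.1 k :=
  rotate_apply T t a.1 k

lemma isOpen_chart (h : IsPeriodicFlow T ψ) (k : ℕ) : IsOpen (chart T ψ k) :=
  isOpenMap_mk h _ (isOpen_ne_fun ((continuous_coord k).comp continuous_fst) continuous_const)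

lemma mk_mem_chart (h : IsPeriodicFlow T ψ) {a : UniversalCircleBundle × Y} {k : ℕ} :
    mk T ψ a ∈ chart T ψ k ↔ a.1.1 k ≠ 0 := by
  refine ⟨?_, fun ha ↦ mem_image_of_mem _ ha⟩
  rintro ⟨b, hb, hab⟩
  obtain ⟨t, rfl⟩ := (mk_eq_iff h).1 hab
  rw [diag_coord]
  exact mul_ne_zero (Complex.exp_ne_zero _) hb

lemma exists_mem_chart (b : HomotopyQuotient T ψ) : ∃ k, b ∈ chart T ψ k := by
  obtain ⟨a, rfl⟩ := mk_surjective b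
  obtain ⟨k, hk⟩ := exists_coord_ne_zero a.1
  exact ⟨k, mem_image_of_mem _ hk⟩

variable (T ψ) in
/-- The point of the orbit of `a` at which the `k`-th coordinate of `ES¹` is positive, if that
coordinate does not vanish. -/
def normalize (k : ℕ) (a : UniversalCircleBundle × Y) : UniversalCircleBundle × Y :=
  diag T ψ (-(T / (2 * Real.pi)) * (a.1.1 k).arg) a

lemma normalize_diag (h : IsPeriodicFlow T ψ) {k : ℕ} {a : UniversalCircleBundle × Y}
    (ha : a.1.1 k ≠ 0) (t : ℝ) : normalize T ψ k (diag T ψ t a) = normalize T ψ k a := by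
  have hd := isPeriodicFlow_diag h
  have h1 : (((diag T ψ t a).1.1 k).arg : Real.Angle) =
      (((2 * Real.pi * (t / T)) + (a.1.1 k).arg : ℝ) : Real.Angle) := by
    rw [diag_coord, Complex.arg_mul_coe_angle (Complex.exp_ne_zero _) ha, Complex.arg_exp_mul_I,
      Real.Angle.coe_add, Real.Angle.coe_toIocMod]
  rw [normalize, hd.map_eq_of_coe_angle h1, normalize, ← hd.map_add]
  congr 1
  have := h.pos.ne'
  have := Real.pi_pos.ne'
  field_simp
  ring

lemma normalize_coord (h : IsPeriodicFlow T ψ) (k : ℕ) (a : UniversalCircleBundle × Y) :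
    (normalize T ψ k a).1.1 k = ‖a.1.1 k‖ := by
  rw [normalize, diag_coord]
  have h1 : 2 * Real.pi * (-(T / (2 * Real.pi)) * (a.1.1 k).arg / T) = -(a.1.1 k).arg := by
    have := h.pos.ne'
    have := Real.pi_pos.ne'
    field_simp
  rw [h1]
  nth_rewrite 2 [← Complex.norm_mul_exp_arg_mul_I (a.1.1 k)]
  rw [mul_left_comm, ← Complex.exp_add]
  simp

lemma normalize_eq_self (h : IsPeriodicFlow T ψ) {k : ℕ} {a : UniversalCircleBundle × Y}
    (ha : (a.1.1 k).arg = 0) : normalize T ψ k a = a := by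
  rw [normalize, ha, mul_zero, (isPeriodicFlow_diag h).map_zero]

lemma continuousAt_normalize (h : IsPeriodicFlow T ψ) {k : ℕ} {a : UniversalCircleBundle × Y}
    (ha : a.1.1 k ≠ 0) : ContinuousAt (normalize T ψ k) a :=
  ContinuousAt.comp (f := fun a : UniversalCircleBundle × Y ↦ (a.1.1 k, a))
    ((isPeriodicFlow_diag h).continuousAt_arg (w := (a.1.1 k, a)) ha)
    ((((continuous_coord k).comp continuous_fst).prodMk continuous_id).continuousAt)

/-- The section over a chart whose `k`-th coordinate is positive. Outside the chart it is an arbitrary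
representative. -/
def slice (k : ℕ) (b : HomotopyQuotient T ψ) : UniversalCircleBundle × Y := normalize T ψ k (Quot.out b)

lemma mk_slice (k : ℕ) (b : HomotopyQuotient T ψ) : mk T ψ (slice k b) = b :=
  (mk_diag _ _).trans (Quot.out_eq b)

lemma slice_mk (h : IsPeriodicFlow T ψ) {k : ℕ} {a : UniversalCircleBundle × Y}
    (ha : a.1.1 k ≠ 0) : slice k (mk T ψ a) = normalize T ψ k a := by
  obtain ⟨t, ht⟩ := (mk_eq_iff h).1 (Quot.out_eq (mk T ψ a)).symm
  rw [slice, ht, normalize_diag h ha]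

lemma continuousOn_slice (h : IsPeriodicFlow T ψ) (k : ℕ) :
    ContinuousOn (slice k) (chart T ψ k) := by
  rintro _ ⟨a, ha, rfl⟩
  refine ContinuousAt.continuousWithinAt ?_
  have h1 : 𝓝 (mk T ψ a) = (𝓝 a).map (mk T ψ) :=
    le_antisymm ((isOpenMap_mk h).nhds_le a) continuous_mk.continuousAt
  rw [ContinuousAt, h1, Filter.tendsto_map'_iff, slice_mk h ha]
  refine Filter.Tendsto.congr' ?_ (continuousAt_normalize h ha)
  filter_upwards [((continuous_coord k).comp continuous_fst).continuousAt.eventually_ne ha]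
    with b hb
  exact (slice_mk h hb).symm

lemma slice_coord (h : IsPeriodicFlow T ψ) {k : ℕ} {b : HomotopyQuotient T ψ} (hb : b ∈ chart T ψ k) :
    (slice k b).1.1 k ≠ 0 ∧ ((slice k b).1.1 k).arg = 0 := by
  obtain ⟨a, ha, rfl⟩ := hb
  rw [slice_mk h ha, normalize_coord h]
  exact ⟨by simpa using ha, Complex.arg_ofReal_of_nonneg (norm_nonneg _)⟩

lemma slice_mk_of_arg (h : IsPeriodicFlow T ψ) {k : ℕ} {a : UniversalCircleBundle × Y}
    (ha : a.1.1 k ≠ 0 ∧ (a.1.1 k).arg = 0) : slice k (mk T ψ a) = a := by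
  rw [slice_mk h ha.1, normalize_eq_self h ha.2]

/-- Paths lift along the circle bundle `ES¹ × Y → ES¹ ×_{S¹} Y`. -/
theorem exists_path_lift (h : IsPeriodicFlow T ψ) (β : C(unitInterval, HomotopyQuotient T ψ))
    {a : UniversalCircleBundle × Y} (ha : mk T ψ a = β 0) :
    ∃ d : C(unitInterval, UniversalCircleBundle × Y), (∀ t, mk T ψ (d t) = β t) ∧ d 0 = a := by
  have hd := isPeriodicFlow_diag h
  obtain ⟨t, t_0, t_mono, ⟨n_max, h_max⟩, t_sub⟩ :=
    exists_monotone_Icc_subset_open_cover_unitInterval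
      (fun k ↦ (isOpen_chart h k).preimage β.continuous)
      fun t _ ↦ mem_iUnion.2 (exists_mem_chart (β t))
  suffices ∀ n, ∃ d : unitInterval → UniversalCircleBundle × Y, ContinuousOn d (Icc 0 (t n)) ∧
      (∀ s ∈ Icc 0 (t n), mk T ψ (d s) = β s) ∧ d 0 = a by
    obtain ⟨d, hc, hl, h0⟩ := this n_max
    have hu : Icc 0 (t n_max) = univ := by
      rw [h_max _ le_rfl]
      exact eq_univ_of_forall fun s ↦ ⟨bot_le, le_top⟩
    rw [hu] at hc hl
    exact ⟨⟨d, continuousOn_univ.1 hc⟩, fun s ↦ hl s (mem_univ s), h0⟩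
  intro n
  induction n with
  | zero =>
    refine ⟨fun _ ↦ a, continuousOn_const, fun s hs ↦ ?_, rfl⟩
    rw [t_0, Icc_self, mem_singleton_iff] at hs
    rw [hs, ha]
  | succ n ih =>
    obtain ⟨d, hc, hl, h0⟩ := ih
    obtain ⟨k, hk⟩ := t_sub n
    have hn : t n ∈ Icc 0 (t n) := ⟨t_0 ▸ t_mono n.zero_le, le_rfl⟩
    -- rotate the section over the chart so that it continues the lift
    obtain ⟨τ, hτ⟩ := (mk_eq_iff h).1 ((mk_slice k (β (t n))).trans (hl _ hn).symm)
    refine ⟨fun s ↦ if s ≤ t n then d s else diag T ψ τ (slice k (β s)),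
      ContinuousOn.if (fun s hs ↦ ?_) (hc.mono fun s hs ↦ ?_) ?_, fun s hs ↦ ?_, ?_⟩
    · obtain rfl : s = t n := frontier_Iic_subset _ hs.2
      exact hτ
    · rw [closure_le_eq continuous_id' continuous_const] at hs
      exact ⟨hs.1.1, hs.2⟩
    · refine (hd.continuous_apply τ).comp_continuousOn
        ((continuousOn_slice h k).comp β.continuous.continuousOn ?_)
      simp_rw [not_le]
      intro s hs
      exact hk ⟨closure_lt_subset_le continuous_const continuous_subtype_val hs.2, hs.1.2⟩
    · dsimp only
      split_ifs with hst
      · exact hl s ⟨hs.1, hst⟩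
      · rw [mk_diag, mk_slice]
    · dsimp only
      rw [if_pos (t_0 ▸ t_mono n.zero_le), h0]

/-- Loops lift along the circle bundle `ES¹ × Y → ES¹ ×_{S¹} Y`: rotate a lifted path so that it
closes up. -/
theorem exists_loop_lift (h : IsPeriodicFlow T ψ) {a : UniversalCircleBundle × Y}
    (β : Path (mk T ψ a) (mk T ψ a)) : ∃ d : Path a a, d.map continuous_mk = β := by
  obtain ⟨d, hl, h0⟩ := exists_path_lift h β.toContinuousMap β.source.symm
  obtain ⟨τ, hτ⟩ := (mk_eq_iff h).1 ((hl 1).trans β.target)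
  refine ⟨⟨⟨fun s ↦ diag T ψ (s * τ) (d s), (isPeriodicFlow_diag h).continuous.comp
    (f := fun s : unitInterval ↦ ((s : ℝ) * τ, d s)) (by fun_prop)⟩, ?_, ?_⟩, ?_⟩
  · simp [h0, (isPeriodicFlow_diag h).map_zero]
  · simpa using hτ.symm
  · ext s
    exact (mk_diag _ _).trans (hl s)

section Map

variable {Z : Type*} [TopologicalSpace Z] {χ : ℝ → Z → Z} {p : Z → Y}

/-- The map of Borel constructions that an equivariant map induces. -/
def map (hp : ∀ t z, p (χ t z) = ψ t (p z)) : HomotopyQuotient T χ → HomotopyQuotient T ψ :=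
  Quot.map (fun a ↦ (a.1, p a.2)) fun a b hab ↦ by
    obtain ⟨t, rfl⟩ := rel_iff.1 hab
    exact rel_iff.2 ⟨t, Prod.ext rfl (hp t a.2)⟩

lemma map_mk (hp : ∀ t z, p (χ t z) = ψ t (p z)) (a : UniversalCircleBundle × Z) :
    map (T := T) hp (mk T χ a) = mk T ψ (a.1, p a.2) := rfl

lemma continuous_map (hp : ∀ t z, p (χ t z) = ψ t (p z)) (hc : Continuous p) :
    Continuous (map (T := T) hp) :=
  continuous_quot_lift _ (continuous_mk.comp (by fun_prop))

lemma slice_map (h : IsPeriodicFlow T ψ) (h' : IsPeriodicFlow T χ)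
    (hp : ∀ t z, p (χ t z) = ψ t (p z)) {k : ℕ} {b : HomotopyQuotient T χ} (hb : b ∈ chart T χ k) :
    slice k (map hp b) = ((slice k b).1, p (slice k b).2) := by
  nth_rewrite 1 [← mk_slice k b]
  rw [map_mk]
  exact slice_mk_of_arg h (slice_coord h' hb)

lemma map_mem_chart (h : IsPeriodicFlow T ψ) (h' : IsPeriodicFlow T χ)
    (hp : ∀ t z, p (χ t z) = ψ t (p z)) {k : ℕ} {b : HomotopyQuotient T χ} :
    map hp b ∈ chart T ψ k ↔ b ∈ chart T χ k := by
  obtain ⟨a, rfl⟩ := mk_surjective b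
  rw [map_mk, mk_mem_chart h, mk_mem_chart h']

/-- A trivialization of an equivariant map over `U` induces a trivialization of the map of Borel
constructions, over the points of a chart whose representative in the slice lies over `U`. -/
def trivialization (h : IsPeriodicFlow T ψ) (h' : IsPeriodicFlow T χ)
    (hp : ∀ t z, p (χ t z) = ψ t (p z)) (hc : Continuous p) {D : Type*} [TopologicalSpace D]
    (e : Trivialization D p) (k : ℕ) : Trivialization D (map (T := T) hp) where
  toFun b := (map hp b, (e (slice k b).2).2)
  invFun z := mk T χ ((slice k z.1).1, e.invFun ((slice k z.1).2, z.2))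
  source := chart T χ k ∩ {b | p (slice k b).2 ∈ e.baseSet}
  baseSet := chart T ψ k ∩ {b | (slice k b).2 ∈ e.baseSet}
  target := (chart T ψ k ∩ {b | (slice k b).2 ∈ e.baseSet}) ×ˢ univ
  map_source' b hb := by
    refine ⟨⟨(map_mem_chart h h' hp).2 hb.1, ?_⟩, mem_univ _⟩
    have := slice_map h h' hp hb.1
    simp only [mem_ofPred_eq, this]
    exact hb.2
  map_target' z hz := by
    have h1 : slice k (mk T χ ((slice k z.1).1, e.invFun ((slice k z.1).2, z.2))) =
        ((slice k z.1).1, e.invFun ((slice k z.1).2, z.2)) :=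
      slice_mk_of_arg h' (slice_coord h hz.1.1)
    refine ⟨(mk_mem_chart h').2 (slice_coord h hz.1.1).1, ?_⟩
    simp only [mem_ofPred_eq, h1]
    have h2 := e.proj_symm_apply (x := ((slice k z.1).2, z.2)) (e.mem_target.2 hz.1.2)
    exact (congrArg (· ∈ e.baseSet) h2).mpr hz.1.2
  left_inv' b hb := by
    have h1 := slice_map h h' hp hb.1
    have h2 := e.symm_apply_mk_proj (x := (slice k b).2) (e.mem_source.2 hb.2)
    simp only [h1]
    refine Eq.trans ?_ (mk_slice k b)
    exact congrArg (fun y ↦ mk T χ ((slice k b).1, y)) h2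
  right_inv' z hz := by
    have h1 : slice k (mk T χ ((slice k z.1).1, e.invFun ((slice k z.1).2, z.2))) =
        ((slice k z.1).1, e.invFun ((slice k z.1).2, z.2)) :=
      slice_mk_of_arg h' (slice_coord h hz.1.1)
    have h2 := e.proj_symm_apply (x := ((slice k z.1).2, z.2)) (e.mem_target.2 hz.1.2)
    have h3 := e.apply_symm_apply (x := ((slice k z.1).2, z.2)) (e.mem_target.2 hz.1.2)
    refine Prod.ext ?_ ?_
    · refine Eq.trans ?_ (mk_slice k z.1)
      exact congrArg (fun y ↦ mk T ψ ((slice k z.1).1, y)) h2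
    · simp only [h1]
      exact congrArg Prod.snd h3
  open_source := (hc.comp_continuousOn (continuousOn_slice h' k).snd).isOpen_inter_preimage
    (isOpen_chart h' k) e.open_baseSet
  open_baseSet := (continuousOn_slice h k).snd.isOpen_inter_preimage (isOpen_chart h k)
    e.open_baseSet
  open_target := ((continuousOn_slice h k).snd.isOpen_inter_preimage (isOpen_chart h k)
    e.open_baseSet).prod isOpen_univ
  source_eq := by
    ext b
    simp only [mem_inter_iff, mem_ofPred_eq, mem_preimage, map_mem_chart h h' hp]
    refine and_congr_right fun hb ↦ ?_
    rw [slice_map h h' hp hb]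
  target_eq := rfl
  proj_toFun _ _ := rfl
  continuousOn_toFun := by
    refine (continuous_map hp hc).continuousOn.prodMk ?_
    refine ContinuousOn.snd (f := fun b ↦ e (slice k b).2) ?_
    exact e.continuousOn_toFun.comp ((continuousOn_slice h' k).snd.mono inter_subset_left)
      fun b hb ↦ e.mem_source.2 hb.2
  continuousOn_invFun := by
    refine continuous_mk.comp_continuousOn ?_
    have h1 : ContinuousOn (fun z : HomotopyQuotient T ψ × D ↦ slice k z.1)
        ((chart T ψ k ∩ {b | (slice k b).2 ∈ e.baseSet}) ×ˢ univ) :=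
      (continuousOn_slice h k).comp continuousOn_fst fun z hz ↦ hz.1.1
    refine h1.fst.prodMk ?_
    exact e.continuousOn_invFun.comp (h1.snd.prodMk continuousOn_snd)
      fun z hz ↦ e.mem_target.2 hz.1.2

/-- An equivariant covering induces a covering of Borel constructions. -/
theorem isCoveringMap_map (h : IsPeriodicFlow T ψ) (h' : IsPeriodicFlow T χ)
    (hp : ∀ t z, p (χ t z) = ψ t (p z)) (cov : IsCoveringMap p) (hs : Function.Surjective p) :
    IsCoveringMap (map (T := T) hp) := by
  have hne : ∀ y, Nonempty (p ⁻¹' {y}) := fun y ↦ (hs y).elim fun z hz ↦ ⟨⟨z, hz⟩⟩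
  have hd : ∀ y, DiscreteTopology (p ⁻¹' {y}) := fun y ↦ (cov y).1
  choose k hk using fun b : HomotopyQuotient T ψ ↦ exists_mem_chart b
  exact IsCoveringMap.mk _ (fun b ↦ p ⁻¹' {(slice (k b) b).2})
    (fun b ↦ trivialization h h' hp cov.continuous (cov (slice (k b) b).2).toTrivialization (k b))
    fun b ↦ ⟨hk b, (cov _).mem_toTrivialization_baseSet⟩

end Map

end HomotopyQuotient

/-! ### The orbifold fundamental group -/

/-- A path of `ES¹ × Y` whose first component is a loop is homotopic to its second component, since
`ES¹` is simply connected. -/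
lemma SasakianStructure.UniversalCircleBundle.homotopic_prod {Y : Type*} [TopologicalSpace Y]
    {e : UniversalCircleBundle} {y y' : Y} (d : Path (e, y) (e, y')) :
    d.Homotopic ((Path.refl e).prod (d.map continuous_snd)) := by
  have h1 : d = (d.map continuous_fst).prod (d.map continuous_snd) := by
    ext t <;> rfl
  have h2 : (d.map continuous_fst).Homotopic (Path.refl e) :=
    SimplyConnectedSpace.paths_homotopic _ _
  nth_rewrite 1 [h1]
  exact ⟨Path.Homotopic.prodHomotopy h2.some (Path.Homotopy.refl _)⟩

namespace SasakianStructure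

variable {n : ℕ} {M : Type*} [TopologicalSpace M]
  [ChartedSpace (EuclideanSpace ℝ (Fin (2 * n + 1))) M] [IsManifold (𝓡 (2 * n + 1)) ∞ M]
  [T2Space M] [CompactSpace M] (S : SasakianStructure n M) {x : M} (hx : x ∈ S.regularPoints)

include hx in
lemma isPeriodicFlow_reebFlow : IsPeriodicFlow S.period S.reebFlow := by
  have h : S.reebFlow = fun t p ↦ S.flow t p := by
    funext t p
    exact S.reebFlow_eq_flow t p
  rw [h]
  exact ⟨S.period_pos_of_regular hx, S.flow.cont', S.flow.map_zero_apply, S.flow.map_add,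
    S.flow_period_of_regular hx⟩

include hx in
/-- Every loop in the Borel construction comes from a loop of the manifold. -/
theorem toOrbifoldFundamentalGroup_surjective :
    Function.Surjective (S.toOrbifoldFundamentalGroup x) := by
  rintro ⟨β⟩
  obtain ⟨d, rfl⟩ := HomotopyQuotient.exists_loop_lift (S.isPeriodicFlow_reebFlow hx)
    (a := (universalBasePoint, x)) β
  refine ⟨FundamentalGroup.fromPath (Path.Homotopic.Quotient.mk (d.map continuous_snd)), ?_⟩
  exact (Path.Homotopic.Quotient.eq.2 ((homotopic_prod d).map
    ⟨HomotopyQuotient.mk S.period S.reebFlow, HomotopyQuotient.continuous_mk⟩)).symm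

/-- The Reeb loop becomes trivial in the Borel construction, where it is homotopic to a loop of
`ES¹`. -/
theorem toOrbifoldFundamentalGroup_orbitLoop :
    S.toOrbifoldFundamentalGroup x (FundamentalGroup.fromPath ⟦S.orbitLoop hx⟧) = 1 := by
  have h := S.isPeriodicFlow_reebFlow hx
  have hr := isPeriodicFlow_rotate h.pos
  -- the loop of `ES¹` that rotates against the Reeb flow
  let δ : Path universalBasePoint universalBasePoint :=
    { toFun := fun t ↦ rotate S.period (-(t * S.period)) universalBasePoint
      continuous_toFun := hr.continuous.comp
        (f := fun t : unitInterval ↦ (-((t : ℝ) * S.period), universalBasePoint)) (by fun_prop)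
      source' := by simp [hr.map_zero]
      target' := by
        have := hr.map_neg_map S.period universalBasePoint
        rw [hr.map_period] at this
        simpa using this }
  let d : Path (universalBasePoint, x) (universalBasePoint, x) := δ.prod (Path.refl x)
  have hd := (homotopic_prod d).map
    ⟨HomotopyQuotient.mk S.period S.reebFlow, HomotopyQuotient.continuous_mk⟩
  have h1 : (S.orbitLoop hx).map S.toBorel.continuous = d.map
      (HomotopyQuotient.continuous_mk (T := S.period) (ψ := S.reebFlow)) := by
    ext t
    refine Eq.trans ?_ (HomotopyQuotient.mk_diag (T := S.period) (ψ := S.reebFlow)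
      (t * S.period) (d t))
    refine congrArg (HomotopyQuotient.mk S.period S.reebFlow) (Prod.ext ?_ ?_)
    · exact (hr.map_map_neg _ _).symm
    · exact (S.reebFlow_eq_flow _ _).symm
  have h2 : ((Path.refl universalBasePoint).prod (d.map continuous_snd)).map
      (HomotopyQuotient.continuous_mk (T := S.period) (ψ := S.reebFlow)) =
      Path.refl (S.toBorel x) := by
    ext t
    rfl
  refine (Path.Homotopic.Quotient.eq.2 (?_ :
    ((S.orbitLoop hx).map S.toBorel.continuous).Homotopic (Path.refl (S.toBorel x))))
  rw [h1, ← h2]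
  exact hd

end SasakianStructure

namespace FlatConnection

variable {n : ℕ} {M : Type*} [TopologicalSpace M]
    [ChartedSpace (EuclideanSpace ℝ (Fin (2 * n + 1))) M] [IsManifold (𝓡 (2 * n + 1)) ∞ M]
    [T2Space M] [CompactSpace M] [ConnectedSpace M]
    {F : Type*} [NormedAddCommGroup F] [NormedSpace ℂ F] [FiniteDimensional ℂ F]
    {V : M → Type*} [TopologicalSpace (TotalSpace F V)]
    [∀ p, AddCommGroup (V p)] [∀ p, Module ℂ (V p)] [∀ p, TopologicalSpace (V p)]
    [∀ p, IsTopologicalAddGroup (V p)] [∀ p, ContinuousSMul ℝ (V p)]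
    [FiberBundle F V] [VectorBundle ℂ F V] [VectorBundle ℝ F V]
    [ContMDiffVectorBundle ∞ F V (𝓡 (2 * n + 1))]
    (E : FlatConnection (2 * n + 1) M F V) (S : SasakianStructure n M)
    {x : M} (hx : x ∈ S.regularPoints)

include hx in
lemma isPeriodicFlow_flatFlow (hE : E.IsRegular S) :
    IsPeriodicFlow S.period fun t e ↦ E.flatFlow S t e :=
  ⟨S.period_pos_of_regular hx, (E.flatFlow S).cont', (E.flatFlow S).map_zero_apply,
    (E.flatFlow S).map_add, fun e ↦ (E.basicFlow_eq S _ e).symm.trans (hE e)⟩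

include hx in
/-- The covering by germs of flat sections of a regular basic bundle descends to the Borel
construction. Hence loops that are null-homotopic there have trivial monodromy. -/
theorem ker_toOrbifoldFundamentalGroup_le (hE : E.IsRegular S) :
    (S.toOrbifoldFundamentalGroup x).ker ≤ (E.monodromy x).ker := by
  intro g hg
  have h := S.isPeriodicFlow_reebFlow hx
  have h' := E.isPeriodicFlow_flatFlow S hx hE
  have hp : ∀ t e, FlatSpace.proj E (E.flatFlow S t e) = S.reebFlow t (FlatSpace.proj E e) :=
    fun t e ↦ (E.proj_flatFlow S t e).trans (S.reebFlow_eq_flow t _).symm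
  have cov := FlatSpace.isCoveringMap E
  have cov' := HomotopyQuotient.isCoveringMap_map h h' hp cov fun p ↦ ⟨FlatSpace.mk E p 0, rfl⟩
  refine MonoidHom.mem_ker.2 (Units.ext (LinearMap.ext fun v ↦
    FlatSpace.mk_injective (E := E) x ((E.mk_monodromy x g v).trans ?_)))
  obtain ⟨γ⟩ := g
  have hg' : (γ.map S.toBorel.continuous).Homotopic (Path.refl (S.toBorel x)) :=
    Path.Homotopic.Quotient.eq.1 (MonoidHom.mem_ker.1 hg)
  let Γ := cov.liftPath γ (FlatSpace.mk E x v) γ.source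
  have hΓ := congrFun (cov.liftPath_lifts γ (FlatSpace.mk E x v) γ.source)
  let mk := HomotopyQuotient.mk S.period fun t e ↦ E.flatFlow S t e
  -- lift the null-homotopy to the covering of the Borel construction
  have h1 := cov'.liftPath_apply_one_eq_of_homotopicRel hg'
    (mk (universalBasePoint, FlatSpace.mk E x v)) (Path.source _) rfl
  have h2 := congrFun ((cov'.eq_liftPath_iff (γ := (γ.map S.toBorel.continuous).toContinuousMap)
    (Γ := fun t ↦ mk (universalBasePoint, Γ t))
    (e := mk (universalBasePoint, FlatSpace.mk E x v)) (Path.source _)).2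
      ⟨HomotopyQuotient.continuous_mk.comp (by fun_prop), funext fun t ↦
        congrArg (fun p ↦ HomotopyQuotient.mk S.period S.reebFlow (universalBasePoint, p)) (hΓ t),
        congrArg (fun e ↦ mk (universalBasePoint, e)) (cov.liftPath_zero ..)⟩) 1
  have h3 := congrArg (fun f : C(unitInterval, _) ↦ f 1) (cov'.liftPath_const
    (x := S.toBorel x) (e := mk (universalBasePoint, FlatSpace.mk E x v)) rfl)
  obtain ⟨t, ht⟩ := (HomotopyQuotient.mk_eq_iff h').1 (h2.trans (h1.trans h3)).symm
  -- the circle acts freely on `ES¹`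
  obtain ⟨k, rfl⟩ := exists_int_of_rotate_eq h.pos (congrArg Prod.fst ht).symm
  exact (congrArg Prod.snd ht).trans (h'.map_int_mul k _)

end FlatConnection
end

theorem corollary3p9 (n : ℕ) (M : Type*) [TopologicalSpace M]
    [ChartedSpace (EuclideanSpace ℝ (Fin (2 * n + 1))) M] [IsManifold (𝓡 (2 * n + 1)) ∞ M]
    [T2Space M] [CompactSpace M] [ConnectedSpace M]
    (S : SasakianStructure n M) (hS : S.IsQuasiRegular)
    (F : Type*) [NormedAddCommGroup F] [NormedSpace ℂ F] [FiniteDimensional ℂ F]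
    (V : M → Type*) [TopologicalSpace (TotalSpace F V)]
    [∀ p, AddCommGroup (V p)] [∀ p, Module ℂ (V p)] [∀ p, TopologicalSpace (V p)]
    [∀ p, IsTopologicalAddGroup (V p)] [∀ p, ContinuousSMul ℝ (V p)]
    [FiberBundle F V] [VectorBundle ℂ F V] [VectorBundle ℝ F V]
    [ContMDiffVectorBundle ∞ F V (𝓡 (2 * n + 1))]
    (E : FlatConnection (2 * n + 1) M F V)
    (x : M) (hx : x ∈ S.regularPoints) :
    (E.IsRegular S ↔
      ∃ τ : S.OrbifoldFundamentalGroup x →* LinearMap.GeneralLinearGroup ℂ (V x),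
        E.monodromy x = τ.comp (S.toOrbifoldFundamentalGroup x)) ∧
    (∃ γ : Path x x, (∀ t : unitInterval, γ t = S.reebFlow (t * S.period) x) ∧
      (E.IsQuasiRegular S ↔
        (range fun k : ℤ ↦ E.monodromy x (FundamentalGroup.fromPath ⟦γ⟧) ^ k).Finite)) := by
  refine ⟨⟨fun hE ↦ ?_, ?_⟩, S.orbitLoop hx, fun t ↦ (S.reebFlow_eq_flow _ _).symm,
    E.isQuasiRegular_iff S hx⟩
  · have hs := S.toOrbifoldFundamentalGroup_surjective hx
    have hk := E.ker_toOrbifoldFundamentalGroup_le S hx hE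
    exact ⟨(S.toOrbifoldFundamentalGroup x).liftOfSurjective hs ⟨E.monodromy x, hk⟩,
      MonoidHom.ext fun g ↦ (MonoidHom.liftOfRightInverse_comp_apply _ _
        (Function.rightInverse_surjInv hs) ⟨E.monodromy x, hk⟩ g).symm⟩
  · rintro ⟨τ, hτ⟩
    rw [E.isRegular_iff S hx, hτ, MonoidHom.comp_apply, S.toOrbifoldFundamentalGroup_orbitLoop hx,
      map_one]
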